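/- Let $M$ be a smooth manifold and let $(\eta: A\to M, v_A)$ be a special affine bundle: a smooth affine bundle of finite rank with a distinguished nowhere vanishing smooth section $v_A$ of its model vector bundle $\mathcal V(A)\to M$, where the model vector bundle of an affine bundle consists of the vectors $[a,b]$ with $a,b$ in one fibre, and $a+[a,b]=b$. Put $\underline A=A/\langle v_A\rangle$, with projection $\zeta:A\to\underline A$. Let $A^\#\to M$ be the bundle of special affine functions on the fibres of $A$ (affine functions whose linear part takes the value $1$ on $v_A$), let $\underline{A^\#}=A^\#/\langle 1_A\rangle$ be its quotient by the constant functions, and let $F=\mathcal V(\underline A)\to M$. For sections $\sigma,\sigma'$ of $\zeta$ let $\sigma'-\sigma$ be the function $f$ on $\underline A$ with $\sigma'=\sigma-f\,v_A$. The affine phase bundle $PA$ consists of the affine differentials $d_x\sigma$: the classes of pairs $(x,\sigma)$, with $x\in\underline A$ and $\sigma$ a smooth section of $\zeta$ near $x$, where $(x,\sigma)\sim(x,\sigma')$ iff $d_x(\sigma'-\sigma)=0$. It is fibred over $\underline A$ by $d_x\sigma\mapsto x$, with affine combinations $\lambda\, d_x\sigma+(1-\lambda)\, d_x\sigma'=d_x(\lambda\sigma+(1-\lambda)\sigma')$.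 It is fibred over $\underline{A^\#}$ by sending $d_x\sigma$, with $x$ over $m\in M$ and $\sigma$ affine on the fibres of $\underline A$, to the class of the function $f_\sigma$ on $A_m$ with $f_\sigma(a)v_A=[\sigma(\zeta(a)),a]$. Here the affine combination of $d_{x_1}\sigma_0+\alpha_1$ and $d_{x_2}\sigma_0+\alpha_2$, with $\sigma_0$ affine on the fibres and $\alpha_1,\alpha_2\in T^*_mM$ pulled back to $\underline A$, is $d_{\lambda x_1+(1-\lambda)x_2}\sigma_0+\lambda\alpha_1+(1-\lambda)\alpha_2$. With these structures $(PA;\underline A,\underline{A^\#};M)$ is a double affine bundle. Its model double vector bundle is $(\mathcal{VV}(PA);\mathcal V(\underline A),\mathcal V(\underline{A^\#});M)$. Its total space is obtained as follows: first form the model vector bundle $\mathcal V_1(PA)$ of $PA\to\underline A$; it is again an affine bundle over $\mathcal V(\underline{A^\#})$; then take the model vector bundle of this affine bundle. So the elements of $\mathcal{VV}(PA)$ are the classes $[[\omega_1,\omega_1'],[\omega_2,\omega_2']]$ where $\omega_i,\omega_i'\in PA$ lie over the same point of $\underline A$, and $[\omega_1,\omega_1']$, $[\omega_2,\omega_2']$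 have the same image in $\mathcal V(\underline{A^\#})$. **Proposition.** $(\mathcal{VV}(PA);\mathcal V(\underline A),\mathcal V(\underline{A^\#});M)$ and the cotangent bundle $(T^*F;F,F^*;M)$ are double vector bundles, and they are canonically isomorphic. Precisely, there is exactly one (smooth) isomorphism of double vector bundles $\Phi:\mathcal{VV}(PA)\to T^*F$ over the identity of $M$ with the following properties: 1. $\Phi$ covers the identity of the side bundle $\mathcal V(\underline A)=F$. 2. On the other side bundle, $\Phi$ covers the map $\mathcal V(\underline{A^\#})\to F^*$ that sends $[\underline\varphi,\underline\psi]$ to the linear function $[\zeta(a),\zeta(b)]\mapsto(\psi-\varphi)(b)-(\psi-\varphi)(a)$. 3. For $P=[[d_{x_1}\sigma_1,d_{x_1}\sigma_1'],[d_{x_2}\sigma_2,d_{x_2}\sigma_2']]$ and any smooth curves $\gamma_1,\gamma_2$ in $\underline A$ with $\gamma_i(0)=x_i$ and the same projection to $M$, $$\Big\langle \Phi(P),\tfrac{d}{dt}\Big|_{0}[\gamma_1(t),\gamma_2(t)]\Big\rangle=\tfrac{d}{dt}\Big|_{0}(\sigma_2'-\sigma_2)(\gamma_2(t))-\tfrac{d}{dt}\Big|_{0}(\sigma_1'-\sigma_1)(\gamma_1(t)).$$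 -/

import Mathlib

open scoped Manifold ContDiff Topology

noncomputable section

/-! ## Diffeological preliminaries

Smooth manifolds are treated inside Mathlib's diffeological spaces: a manifold carries the diffeology
of all smooth maps from the spaces `ℝⁿ` to it, smooth maps of manifolds are precisely the `DSmooth`
ones, and embedded submanifolds, products and quotients by surjective submersions carry the
sub-, product and quotient diffeologies. A bundle in the sense below over a manifold is
locally diffeomorphic to `U × ℝᵏ`, hence its total space is again a manifold. -/

namespace DAff

open Diffeology

/-- The Euclidean space `ℝⁿ`. -/
abbrev Euc (n : ℕ) : Type := EuclideanSpace ℝ (Fin n)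

/-- The diffeology of `M` is the one of the smooth manifold `M` (of dimension `d`). -/
class IsContMDiffCompatible (d : ℕ) (M : Type*) [TopologicalSpace M] [ChartedSpace (Euc d) M]
    [DiffeologicalSpace M] : Prop where
  isPlot_iff : ∀ {n : ℕ} {p : Euc n → M}, IsPlot p ↔ ContMDiff (𝓡 n) (𝓡 d) ∞ p

/-- The standard diffeology of a smooth manifold. -/
@[reducible] def manifoldDiffeology (d : ℕ) (M : Type*) [TopologicalSpace M]
    [ChartedSpace (Euc d) M] : DiffeologicalSpace M :=
  .ofCorePlotsOn {
    isPlotOn := fun {n u} _ p => ContMDiffOn (𝓡 n) (𝓡 d) ∞ p u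
    isPlotOn_congr := fun _ _ _ h => contMDiffOn_congr h
    isPlot := fun {n} p => ContMDiff (𝓡 n) (𝓡 d) ∞ p
    isPlotOn_univ := contMDiffOn_univ
    isPlot_const := fun _ => contMDiff_const
    isPlotOn_reparam := fun _ _ _ h hp hf => hp.comp hf.contMDiffOn h
    locality := fun _ _ h x hx => by
      obtain ⟨v, hv, hxv, hv'⟩ := h x hx
      exact ((hv' x hxv).contMDiffAt (hv.mem_nhds hxv)).contMDiffWithinAt }

theorem manifoldDiffeology_compatible (d : ℕ) (M : Type*) [TopologicalSpace M]
    [ChartedSpace (Euc d) M] :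
    @IsContMDiffCompatible d M _ _ (manifoldDiffeology d M) :=
  @IsContMDiffCompatible.mk d M _ _ (manifoldDiffeology d M) Iff.rfl

/-- The diffeology pulled back along a map. -/
@[reducible] def inducedDiffeology {X Y : Type*} [DiffeologicalSpace Y] (f : X → Y) :
    DiffeologicalSpace X where
  plots n := {p | IsPlot (f ∘ p)}
  constant_plots x := isPlot_const (x := f x)
  plot_reparam hp hf := isPlot_reparam hp hf
  locality {n p} hp := DiffeologicalSpace.locality (p := f ∘ p) fun x => by
    obtain ⟨u, hu, hx, h⟩ := hp x
    exact ⟨u, hu, hx, fun hf hc => h hf hc⟩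

/-- The diffeology pushed forward along a map (the quotient diffeology if the map is onto). -/
@[reducible] def coinducedDiffeology {X Y : Type*} [DiffeologicalSpace X] (f : X → Y) :
    DiffeologicalSpace Y :=
  .generateFrom {q | ∃ p : Euc q.1 → X, IsPlot p ∧ q.2 = f ∘ p}

instance instDiffeologicalSpaceProd {X Y : Type*} [DiffeologicalSpace X] [DiffeologicalSpace Y] :
    DiffeologicalSpace (X × Y) :=
  inducedDiffeology (Prod.fst : X × Y → X) ⊓ inducedDiffeology (Prod.snd : X × Y → Y)

instance instDiffeologicalSpaceSubtype {X : Type*} [DiffeologicalSpace X] {p : X → Prop} :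
    DiffeologicalSpace {x // p x} :=
  inducedDiffeology Subtype.val

instance instDiffeologicalSpaceQuot {X : Type*} [DiffeologicalSpace X] {r : X → X → Prop} :
    DiffeologicalSpace (Quot r) :=
  coinducedDiffeology (Quot.mk r)

/-- Openness in the D-topology (for manifolds: the manifold topology). -/
def DOpen {X : Type*} [DiffeologicalSpace X] (U : Set X) : Prop :=
  IsOpen[DiffeologicalSpace.dTopology] U

/-- Smoothness of the restriction of a map to a set. -/
def DSmoothOn {X Y : Type*} [DiffeologicalSpace X] [DiffeologicalSpace Y] (f : X → Y)
    (U : Set X) : Prop :=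
  ∀ (n : ℕ) (p : Euc n → X), IsPlot p → (∀ u, p u ∈ U) → IsPlot (f ∘ p)

/-! ## Affine and vector bundles

The (partially defined, fibrewise) structure maps are given by their graphs. -/

/-- The structure maps of an affine bundle: `comb t a b c` says that `a` and `b` lie in one fibre and
`c` is their affine combination `t a + (1 - t) b`. -/
structure AffData (A B : Type*) where
  proj : A → B
  comb : ℝ → A → A → A → Prop

/-- The structure maps of a vector bundle: `add x y z` says that `x` and `y` lie in one fibre and
`z = x + y`, and `smul t x y` says that `y = t x`. -/
structure VecData (D B : Type*) where
  proj : D → B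
  add : D → D → D → Prop
  smul : ℝ → D → D → Prop

section Bundles

variable {A D B : Type*} [DiffeologicalSpace A] [DiffeologicalSpace D] [DiffeologicalSpace B]

/-- `a ↦ (proj a, φ a)` is a diffeomorphism `proj⁻¹ U → U × ℝᵏ`, with inverse `ψ`. -/
structure IsTrivialization (proj : A → B) (U : Set B) {k : ℕ} (φ : A → Euc k)
    (ψ : B × Euc k → A) : Prop where
  proj_inv : ∀ b ∈ U, ∀ x, proj (ψ (b, x)) = b
  right_inv : ∀ b ∈ U, ∀ x, φ (ψ (b, x)) = x
  left_inv : ∀ a, proj a ∈ U → ψ (proj a, φ a) = a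
  smooth : DSmoothOn φ {a | proj a ∈ U}
  smooth_inv : DSmoothOn ψ {q | q.1 ∈ U}

/-- A smooth, locally trivial bundle of affine spaces (of constant finite rank). -/
structure AffData.IsAffineBundle (S : AffData A B) : Prop where
  smooth_proj : DSmooth S.proj
  comb_proj : ∀ t a b c, S.comb t a b c → S.proj a = S.proj b ∧ S.proj c = S.proj a
  locally_trivial : ∃ k : ℕ, ∀ b, ∃ (U : Set B) (φ : A → Euc k) (ψ : B × Euc k → A),
    DOpen U ∧ b ∈ U ∧ IsTrivialization S.proj U φ ψ ∧
    ∀ t a₁ a₂ a₃, S.proj a₁ ∈ U → S.proj a₂ = S.proj a₁ → S.proj a₃ = S.proj a₁ →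
      (S.comb t a₁ a₂ a₃ ↔ φ a₃ = t • φ a₁ + (1 - t) • φ a₂)

/-- A smooth, locally trivial vector bundle (of constant finite rank). -/
structure VecData.IsVectorBundle (E : VecData D B) : Prop where
  smooth_proj : DSmooth E.proj
  add_proj : ∀ x y z, E.add x y z → E.proj x = E.proj y ∧ E.proj z = E.proj x
  smul_proj : ∀ t x y, E.smul t x y → E.proj y = E.proj x
  locally_trivial : ∃ k : ℕ, ∀ b, ∃ (U : Set B) (φ : D → Euc k) (ψ : B × Euc k → D),
    DOpen U ∧ b ∈ U ∧ IsTrivialization E.proj U φ ψ ∧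
    (∀ x y z, E.proj x ∈ U → E.proj y = E.proj x → E.proj z = E.proj x →
      (E.add x y z ↔ φ z = φ x + φ y)) ∧
    ∀ t x y, E.proj x ∈ U → E.proj y = E.proj x → (E.smul t x y ↔ φ y = t • φ x)

end Bundles

/-! ### The model vector bundle of an affine bundle -/

namespace AffData

variable {A B : Type*} (S : AffData A B)

/-- Pairs of points in one fibre. -/
abbrev Pair : Type _ := {p : A × A // S.proj p.1 = S.proj p.2}

/-- `(a, b) ∼ (a', b')` iff `aff(a, b'; 1/2) = aff(b, a'; 1/2)`, in one fibre. -/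
def parallel (p q : S.Pair) : Prop :=
  S.proj p.1.1 = S.proj q.1.1 ∧
    ∃ c, S.comb (1 / 2) p.1.1 q.1.2 c ∧ S.comb (1 / 2) p.1.2 q.1.1 c

/-- The total space of the model vector bundle: the vectors `[a, b]`. -/
def Model : Type _ := Quot S.parallel

instance [DiffeologicalSpace A] : DiffeologicalSpace S.Model :=
  inferInstanceAs (DiffeologicalSpace (Quot S.parallel))

/-- The vector `[a, b]`. -/
def vec (a b : A) (h : S.proj a = S.proj b) : S.Model := Quot.mk _ ⟨(a, b), h⟩

/-- `a` and `b` lie in one fibre and `X = [a, b]`. -/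
def IsVec (a b : A) (X : S.Model) : Prop := ∃ h : S.proj a = S.proj b, X = S.vec a b h

/-- The model vector bundle, with `t [a, b] = [a, aff(b, a; t)]` and
`[a, b] + [a, c] = 2 [a, aff(b, c; 1/2)]`. -/
def model : VecData S.Model B where
  proj := Quot.lift (fun p => S.proj p.1.1) fun _ _ h => h.1
  add X Y Z := ∃ a b c d e, S.IsVec a b X ∧ S.IsVec a c Y ∧
    S.comb (1 / 2) b c d ∧ S.comb 2 d a e ∧ S.IsVec a e Z
  smul t X Y := ∃ a b c, S.IsVec a b X ∧ S.comb t b a c ∧ S.IsVec a c Y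

end AffData

/-! ## Double affine bundles and double vector bundles -/

/-- The structure maps of a double affine bundle
```
   A --π₂--> A₂
   |π₁       |π₁'
   A₁ --π₂'-> M
```
with `str₁`, `str₂`, `base₁`, `base₂` the structures over the projections `π₁`, `π₂`, `π₁'`, `π₂'`. -/
structure DoubleAffData (A A₁ A₂ M : Type*) where
  str₁ : AffData A A₁
  str₂ : AffData A A₂
  base₁ : AffData A₂ M
  base₂ : AffData A₁ M
  comm : ∀ a, base₁.proj (str₂.proj a) = base₂.proj (str₁.proj a)

/-- The structure maps of a double vector bundle `(D; D₁, D₂; M)`, with the same conventions. -/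
structure DoubleVecData (D D₁ D₂ M : Type*) where
  str₁ : VecData D D₁
  str₂ : VecData D D₂
  base₁ : VecData D₂ M
  base₂ : VecData D₁ M

/-- Double affine bundles. -/
structure DoubleAffData.IsDoubleAffineBundle {A A₁ A₂ M : Type*} [DiffeologicalSpace A]
    [DiffeologicalSpace A₁] [DiffeologicalSpace A₂] [DiffeologicalSpace M]
    (S : DoubleAffData A A₁ A₂ M) : Prop where
  str₁ : S.str₁.IsAffineBundle
  str₂ : S.str₂.IsAffineBundle
  base₁ : S.base₁.IsAffineBundle
  base₂ : S.base₂.IsAffineBundle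
  /-- the projections are morphisms of affine bundles -/
  map₁ : ∀ t a b c, S.str₂.comb t a b c →
    S.base₂.comb t (S.str₁.proj a) (S.str₁.proj b) (S.str₁.proj c)
  map₂ : ∀ t a b c, S.str₁.comb t a b c →
    S.base₁.comb t (S.str₂.proj a) (S.str₂.proj b) (S.str₂.proj c)
  surj : ∀ a₁ a₂, S.base₂.proj a₁ = S.base₁.proj a₂ →
    ∃ a, S.str₁.proj a = a₁ ∧ S.str₂.proj a = a₂
  /-- the interchange law: the affine combinations of each structure are morphisms for the other -/
  interchange : ∀ s t x₁ x₂ x y₁ y₂ y z₁ z₂ z, S.str₁.comb s x₁ x₂ x → S.str₁.comb s y₁ y₂ y →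
    S.str₂.comb t x₁ y₁ z₁ → S.str₂.comb t x₂ y₂ z₂ →
    (S.str₂.comb t x y z ↔ S.str₁.comb s z₁ z₂ z)

namespace DoubleVecData

/-- Double vector bundles. -/
structure IsDoubleVectorBundle {D D₁ D₂ M : Type*} [DiffeologicalSpace D]
    [DiffeologicalSpace D₁] [DiffeologicalSpace D₂] [DiffeologicalSpace M]
    (S : DoubleVecData D D₁ D₂ M) : Prop where
  str₁ : S.str₁.IsVectorBundle
  str₂ : S.str₂.IsVectorBundle
  base₁ : S.base₁.IsVectorBundle
  base₂ : S.base₂.IsVectorBundle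
  comm : ∀ x, S.base₁.proj (S.str₂.proj x) = S.base₂.proj (S.str₁.proj x)
  /-- the projections are morphisms of vector bundles -/
  map_add₁ : ∀ x y z, S.str₂.add x y z →
    S.base₂.add (S.str₁.proj x) (S.str₁.proj y) (S.str₁.proj z)
  map_add₂ : ∀ x y z, S.str₁.add x y z →
    S.base₁.add (S.str₂.proj x) (S.str₂.proj y) (S.str₂.proj z)
  map_smul₁ : ∀ t x y, S.str₂.smul t x y → S.base₂.smul t (S.str₁.proj x) (S.str₁.proj y)
  map_smul₂ : ∀ t x y, S.str₁.smul t x y → S.base₁.smul t (S.str₂.proj x) (S.str₂.proj y)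
  surj : ∀ a₁ a₂, S.base₂.proj a₁ = S.base₁.proj a₂ →
    ∃ x, S.str₁.proj x = a₁ ∧ S.str₂.proj x = a₂
  /-- the interchange laws -/
  add_add : ∀ x₁ x₂ x y₁ y₂ y z₁ z₂ z, S.str₁.add x₁ x₂ x → S.str₁.add y₁ y₂ y →
    S.str₂.add x₁ y₁ z₁ → S.str₂.add x₂ y₂ z₂ → (S.str₂.add x y z ↔ S.str₁.add z₁ z₂ z)
  smul_add₁ : ∀ t x y z x' y' z', S.str₁.smul t x x' → S.str₁.smul t y y' →
    S.str₂.add x y z → (S.str₁.smul t z z' ↔ S.str₂.add x' y' z')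
  smul_add₂ : ∀ t x y z x' y' z', S.str₂.smul t x x' → S.str₂.smul t y y' →
    S.str₁.add x y z → (S.str₂.smul t z z' ↔ S.str₁.add x' y' z')
  smul_smul : ∀ s t x y z w, S.str₁.smul s x y → S.str₂.smul t x z →
    (S.str₂.smul t y w ↔ S.str₁.smul s z w)

/-- Isomorphisms of double vector bundles over the identity of `M`. -/
@[ext] structure Iso {D D₁ D₂ D' D₁' D₂' M : Type*} [DiffeologicalSpace D]
    [DiffeologicalSpace D₁] [DiffeologicalSpace D₂] [DiffeologicalSpace D']
    [DiffeologicalSpace D₁'] [DiffeologicalSpace D₂']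
    (S : DoubleVecData D D₁ D₂ M) (S' : DoubleVecData D' D₁' D₂' M) where
  toEquiv : D ≃ D'
  side₁ : D₁ ≃ D₁'
  side₂ : D₂ ≃ D₂'
  smooth : DSmooth toEquiv
  smooth_symm : DSmooth toEquiv.symm
  smooth₁ : DSmooth side₁
  smooth₁_symm : DSmooth side₁.symm
  smooth₂ : DSmooth side₂
  smooth₂_symm : DSmooth side₂.symm
  proj₁ : ∀ x, S'.str₁.proj (toEquiv x) = side₁ (S.str₁.proj x)
  proj₂ : ∀ x, S'.str₂.proj (toEquiv x) = side₂ (S.str₂.proj x)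
  base_proj₁ : ∀ x, S'.base₁.proj (side₂ x) = S.base₁.proj x
  base_proj₂ : ∀ x, S'.base₂.proj (side₁ x) = S.base₂.proj x
  add₁ : ∀ x y z, S.str₁.add x y z ↔ S'.str₁.add (toEquiv x) (toEquiv y) (toEquiv z)
  add₂ : ∀ x y z, S.str₂.add x y z ↔ S'.str₂.add (toEquiv x) (toEquiv y) (toEquiv z)
  smul₁ : ∀ t x y, S.str₁.smul t x y ↔ S'.str₁.smul t (toEquiv x) (toEquiv y)
  smul₂ : ∀ t x y, S.str₂.smul t x y ↔ S'.str₂.smul t (toEquiv x) (toEquiv y)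
  base_add₁ : ∀ x y z, S.base₁.add x y z ↔ S'.base₁.add (side₂ x) (side₂ y) (side₂ z)
  base_add₂ : ∀ x y z, S.base₂.add x y z ↔ S'.base₂.add (side₁ x) (side₁ y) (side₁ z)
  base_smul₁ : ∀ t x y, S.base₁.smul t x y ↔ S'.base₁.smul t (side₂ x) (side₂ y)
  base_smul₂ : ∀ t x y, S.base₂.smul t x y ↔ S'.base₂.smul t (side₁ x) (side₁ y)

end DoubleVecData

/-! ### The model double vector bundle of a double affine bundle -/

namespace DoubleAffData

variable {A A₁ A₂ M : Type*} (S : DoubleAffData A A₁ A₂ M)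

/-- `π₂ᵛ : 𝒱₁(A) → 𝒱(A₂)`, `[a, b]₁ ↦ [π₂ a, π₂ b]` (independent of the representative, since `π₂` is
a morphism of affine bundles). -/
def linearPart₂ (X : S.str₁.Model) : S.base₁.Model :=
  S.base₁.vec (S.str₂.proj (Quot.out X).1.1) (S.str₂.proj (Quot.out X).1.2) (by
    rw [S.comm, S.comm, (Quot.out X).2])

/-- The affine bundle `π₂ᵛ : 𝒱₁(A) → 𝒱(A₂)`: if `v = [a, b]₁`, `w = [a', b']₁` with `π₂ a = π₂ a'` and
`π₂ b = π₂ b'`, then `aff(v, w; t) = [aff₂(a, a'; t), aff₂(b, b'; t)]₁`. -/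
def modelAff : AffData S.str₁.Model S.base₁.Model where
  proj := S.linearPart₂
  comb t X Y Z := ∃ a b a' b' c d, S.str₁.IsVec a b X ∧ S.str₁.IsVec a' b' Y ∧
    S.str₂.proj a = S.str₂.proj a' ∧ S.str₂.proj b = S.str₂.proj b' ∧
    S.str₂.comb t a a' c ∧ S.str₂.comb t b b' d ∧ S.str₁.IsVec c d Z

/-- The total space `𝒱₂𝒱₁(A)`. -/
abbrev VV : Type _ := S.modelAff.Model

theorem base_proj_linearPart₂ (X : S.str₁.Model) :
    S.base₁.model.proj (S.linearPart₂ X) = S.base₂.proj (S.str₁.model.proj X) := by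
  conv_rhs => rw [← Quot.out_eq X]
  exact S.comm _

/-- `𝒱₁(π₁)ᵛ : 𝒱₂𝒱₁(A) → 𝒱(A₁)`, `[X, Y]₂ ↦ [x, y]` for `X`, `Y` over `x`, `y` (independent of the
representative). -/
def linearPart₁ (P : S.VV) : S.base₂.Model :=
  S.base₂.vec (S.str₁.model.proj (Quot.out P).1.1) (S.str₁.model.proj (Quot.out P).1.2) (by
    rw [← S.base_proj_linearPart₂, ← S.base_proj_linearPart₂]
    exact congrArg S.base₁.model.proj (Quot.out P).2)

/-- The model double vector bundle `(𝒱₂𝒱₁(A); 𝒱(A₁), 𝒱(A₂); M)`. The structure over `𝒱(A₂)` is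
that of the model vector bundle of `π₂ᵛ`; the one over `𝒱(A₁)` is induced by the vector bundle
`𝒱₁(A) → A₁`: `[X, Y]₂ + [X', Y']₂ = [X + X', Y + Y']₂` and `t [X, Y]₂ = [t X, t Y]₂`. -/
def modelDouble : DoubleVecData S.VV S.base₂.Model S.base₁.Model M where
  str₁ := {
    proj := S.linearPart₁
    add := fun P Q R => ∃ X Y X' Y' X'' Y'', S.modelAff.IsVec X Y P ∧ S.modelAff.IsVec X' Y' Q ∧
      S.str₁.model.add X X' X'' ∧ S.str₁.model.add Y Y' Y'' ∧ S.modelAff.IsVec X'' Y'' R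
    smul := fun t P Q => ∃ X Y X' Y', S.modelAff.IsVec X Y P ∧
      S.str₁.model.smul t X X' ∧ S.str₁.model.smul t Y Y' ∧ S.modelAff.IsVec X' Y' Q }
  str₂ := S.modelAff.model
  base₁ := S.base₁.model
  base₂ := S.base₂.model

end DoubleAffData

/-! ## Functions on fibres, the dual of a vector bundle -/

/-- A function on one fibre of `proj`. -/
structure FibreFun {X M : Type*} (proj : X → M) where
  base : M
  fn : ∀ x, proj x = base → ℝ

/-- The functional diffeology: a family of functions on fibres is smooth if so are its base points
and its values along all smooth families of arguments. -/
instance {X M : Type*} [DiffeologicalSpace X] [DiffeologicalSpace M] {proj : X → M} :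
    DiffeologicalSpace (FibreFun proj) :=
  .generateFrom {q | IsPlot (fun u => (q.2 u).base) ∧
    ∀ (k : ℕ) (f : Euc k → Euc q.1) (a : Euc k → X) (h : ∀ w, proj (a w) = (q.2 (f w)).base),
      ContDiff ℝ ∞ f → IsPlot a → ContDiff ℝ ∞ fun w => (q.2 (f w)).fn (a w) (h w)}

namespace VecData

variable {D M : Type*} (E : VecData D M)

/-- Linear functions on the fibres of `E`. -/
def IsLinear (φ : FibreFun E.proj) : Prop :=
  (∀ x y z hx hy hz, E.add x y z → φ.fn z hz = φ.fn x hx + φ.fn y hy) ∧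
  ∀ t x y hx hy, E.smul t x y → φ.fn y hy = t * φ.fn x hx

/-- The total space of the dual bundle `E*`. -/
abbrev Dual : Type _ := {φ : FibreFun E.proj // E.IsLinear φ}

/-- The dual vector bundle. -/
def dual : VecData E.Dual M where
  proj φ := φ.1.base
  add φ ψ χ := φ.1.base = ψ.1.base ∧ χ.1.base = φ.1.base ∧
    ∀ x h₁ h₂ h₃, χ.1.fn x h₃ = φ.1.fn x h₁ + ψ.1.fn x h₂
  smul t φ ψ := ψ.1.base = φ.1.base ∧ ∀ x h₁ h₂, ψ.1.fn x h₂ = t * φ.1.fn x h₁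

/-- The zero of the fibre of `E*` at `m`. -/
def dualZero (m : M) : {φ : E.Dual // φ.1.base = m} :=
  ⟨⟨⟨m, fun _ _ => 0⟩, ⟨by intros; simp, by intros; simp⟩⟩, rfl⟩

end VecData

/-! ## The cotangent bundle -/

section Cotangent

variable (X : Type*) [DiffeologicalSpace X]

/-- A point together with a function that is smooth near that point. -/
structure FunGerm where
  pt : X
  fn : X → ℝ
  smooth : ∃ O : Set X, DOpen O ∧ pt ∈ O ∧ DSmoothOn fn O

variable {X}

/-- The derivative of `f` along every smooth curve through `x` vanishes at `x`. -/
def HasZeroDifferential (f : X → ℝ) (x : X) : Prop :=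
  ∀ γ : ℝ → X, DSmooth γ → γ 0 = x → HasDerivAt (fun t => f (γ t)) 0 0

/-- `(x, f) ∼ (y, g)` iff `x = y` and `d_x (f - g) = 0`. -/
def FunGerm.rel (f g : FunGerm X) : Prop :=
  f.pt = g.pt ∧ HasZeroDifferential (fun x => f.fn x - g.fn x) f.pt

variable (X)

/-- The total space of the cotangent bundle `T*X`: the differentials `d_x f`. -/
def Cotangent : Type _ := Quot (FunGerm.rel (X := X))

variable {X}

/-- `f` is smooth near `x` and `θ = d_x f`. -/
def IsDifferential (x : X) (f : X → ℝ) (θ : Cotangent X) : Prop :=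
  ∃ g : FunGerm X, g.pt = x ∧ g.fn = f ∧ θ = Quot.mk _ g

/-- The diffeology of `T*X` is generated by the families `u ↦ d_{x(u)} f(u, ·)` with `x(u)` smooth
in `u` and `f(u, y)` smooth in `(u, y)` near the graph of `x`. -/
instance : DiffeologicalSpace (Cotangent X) :=
  .generateFrom {q | ∃ (x : Euc q.1 → X) (f : Euc q.1 × X → ℝ) (W : Set (Euc q.1 × X)),
    IsPlot x ∧ DOpen W ∧ (∀ u, (u, x u) ∈ W) ∧ DSmoothOn f W ∧
    ∀ u, IsDifferential (x u) (fun y => f (u, y)) (q.2 u)}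

/-- The foot point. -/
def Cotangent.pt : Cotangent X → X := Quot.lift FunGerm.pt fun _ _ h => h.1

/-- `⟨θ, γ'(0)⟩ = r`, for a smooth curve `γ` through the foot point of `θ`. -/
def Cotangent.HasPairing (θ : Cotangent X) (γ : ℝ → X) (r : ℝ) : Prop :=
  θ.pt = γ 0 ∧ ∀ f, IsDifferential (γ 0) f θ → HasDerivAt (fun t => f (γ t)) r 0

/-- The cotangent vector bundle `T*X → X`. -/
def cotangentVec (X : Type*) [DiffeologicalSpace X] : VecData (Cotangent X) X where
  proj := Cotangent.pt
  add θ₁ θ₂ θ₃ := ∃ x f g, IsDifferential x f θ₁ ∧ IsDifferential x g θ₂ ∧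
    IsDifferential x (fun y => f y + g y) θ₃
  smul t θ₁ θ₂ := ∃ x f, IsDifferential x f θ₁ ∧ IsDifferential x (fun y => t * f y) θ₂

namespace VecData

variable {D M : Type*} [DiffeologicalSpace D] (E : VecData D M)

open Classical in
/-- The projection `T*E → E*`: the restriction of a covector at `x` to the vertical vectors,
`φ(w) = ⟨θ, d/dt (x + t w)⟩`. -/
def verticalPart (θ : Cotangent D) : E.Dual :=
  (@Classical.epsilon {φ : E.Dual // φ.1.base = E.proj θ.pt} ⟨E.dualZero _⟩ fun φ =>
    ∀ w hw (γ : ℝ → D), (∀ t, ∃ y, E.smul t w y ∧ E.add θ.pt y (γ t)) →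
      θ.HasPairing γ (φ.1.1.fn w hw)).1

/-- The double vector bundle `(T*E; E, E*; M)`. The structure over `E*` is characterised by
`⟨θ +₂ θ', X + X'⟩ = ⟨θ, X⟩ + ⟨θ', X'⟩` and `⟨t ·₂ θ, t X⟩ = t ⟨θ, X⟩`, where `X + X'` and `t X`
are formed by means of the tangent maps of the addition and of the homotheties of `E`. -/
def cotangentDouble : DoubleVecData (Cotangent D) D E.Dual M where
  str₁ := cotangentVec D
  str₂ := {
    proj := E.verticalPart
    add := fun θ₁ θ₂ θ₃ => E.verticalPart θ₁ = E.verticalPart θ₂ ∧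
      E.verticalPart θ₃ = E.verticalPart θ₁ ∧ E.add θ₁.pt θ₂.pt θ₃.pt ∧
      ∀ γ₁ γ₂ γ₃ : ℝ → D, DSmooth γ₁ → DSmooth γ₂ → DSmooth γ₃ →
        (∀ t, E.add (γ₁ t) (γ₂ t) (γ₃ t)) →
        ∀ r₁ r₂, θ₁.HasPairing γ₁ r₁ → θ₂.HasPairing γ₂ r₂ → θ₃.HasPairing γ₃ (r₁ + r₂)
    smul := fun s θ₁ θ₂ => E.verticalPart θ₂ = E.verticalPart θ₁ ∧ E.smul s θ₁.pt θ₂.pt ∧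
      ∀ γ₁ γ₂ : ℝ → D, DSmooth γ₁ → DSmooth γ₂ → (∀ t, E.smul s (γ₁ t) (γ₂ t)) →
        ∀ r, θ₁.HasPairing γ₁ r → θ₂.HasPairing γ₂ (s * r) }
  base₁ := E.dual
  base₂ := E

end VecData

end Cotangent

/-! ## Special affine bundles and the affine phase bundle -/

/-- A special affine bundle `(A, v_A)` over `M`: an affine bundle with a distinguished nowhere
vanishing smooth section of its model vector bundle. -/
structure SpecialAffineBundle (A M : Type*) [DiffeologicalSpace A] [DiffeologicalSpace M]
    extends AffData A M where
  isAffineBundle : toAffData.IsAffineBundle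
  v : M → toAffData.Model
  smooth_v : DSmooth v
  proj_v : ∀ m, toAffData.model.proj (v m) = m
  v_ne_zero : ∀ a, ¬ toAffData.IsVec a a (v (toAffData.proj a))

namespace SpecialAffineBundle

variable {A M : Type*} [DiffeologicalSpace A] [DiffeologicalSpace M]
  (S : SpecialAffineBundle A M)

/-- `a` and `b` lie in one fibre and `[a, b] = t v_A`. -/
def Shift (a b : A) (t : ℝ) : Prop :=
  ∃ X, S.toAffData.model.smul t (S.v (S.proj a)) X ∧ S.toAffData.IsVec a b X

/-- The quotient `A̲ = A / ⟨v_A⟩`. -/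
def Red : Type _ := Quot fun a b : A => ∃ t, S.Shift a b t

instance : DiffeologicalSpace S.Red :=
  inferInstanceAs (DiffeologicalSpace (Quot fun a b : A => ∃ t, S.Shift a b t))

/-- The projection `ζ : A → A̲`. -/
def ζ (a : A) : S.Red := Quot.mk _ a

/-- The affine bundle `A̲ → M`. -/
def red : AffData S.Red M where
  proj := Quot.lift S.proj fun _ _ ⟨_, _, _, h, _⟩ => h
  comb t x y z := ∃ a b c, S.comb t a b c ∧ S.ζ a = x ∧ S.ζ b = y ∧ S.ζ c = z

/-- Special affine functions on the fibres of `A`: affine functions whose linear part takes the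
value `1` on `v_A`. -/
def IsSpecialAffine (φ : FibreFun S.proj) : Prop :=
  (∀ t a b c ha hb hc, S.comb t a b c → φ.fn c hc = t * φ.fn a ha + (1 - t) * φ.fn b hb) ∧
  ∀ a b ha hb, S.toAffData.IsVec a b (S.v φ.base) → φ.fn b hb - φ.fn a ha = 1

/-- The total space of the special affine dual `A^#`. -/
abbrev Sharp : Type _ := {φ : FibreFun S.proj // S.IsSpecialAffine φ}

/-- Special affine functions on one fibre that differ by a constant. -/
def constRel (φ ψ : S.Sharp) : Prop :=
  φ.1.base = ψ.1.base ∧ ∃ c : ℝ, ∀ a h₁ h₂, ψ.1.fn a h₂ = φ.1.fn a h₁ + c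

/-- The quotient of `A^#` by the constants `⟨1_A⟩`. -/
def SharpRed : Type _ := Quot S.constRel

instance : DiffeologicalSpace S.SharpRed :=
  inferInstanceAs (DiffeologicalSpace (Quot S.constRel))

/-- The projection of `A^#` onto its quotient. -/
def toSharpRed (φ : S.Sharp) : S.SharpRed := Quot.mk _ φ

/-- The affine bundle `A^# / ⟨1_A⟩ → M`, with the pointwise affine combinations. -/
def sharpRed : AffData S.SharpRed M where
  proj := Quot.lift (fun φ => φ.1.base) fun _ _ h => h.1
  comb t x y z := ∃ φ ψ χ : S.Sharp, φ.1.base = ψ.1.base ∧ χ.1.base = φ.1.base ∧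
    (∀ a h₁ h₂ h₃, χ.1.fn a h₃ = t * φ.1.fn a h₁ + (1 - t) * ψ.1.fn a h₂) ∧
    S.toSharpRed φ = x ∧ S.toSharpRed ψ = y ∧ S.toSharpRed χ = z

theorem nonempty_sharp (m : M) : Nonempty {Y : S.SharpRed // S.sharpRed.proj Y = m} := by
  obtain ⟨k, hk⟩ := S.isAffineBundle.locally_trivial
  obtain ⟨U, φ, ψ, -, hm, hT, hc⟩ := hk m
  have key : ∀ (a b a' b' : A) (X : S.toAffData.Model), S.proj a = m → S.proj a' = m →
      S.toAffData.IsVec a b X → S.toAffData.IsVec a' b' X → φ b - φ a = φ b' - φ a' := by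
    intro a b a' b' X ha ha' ⟨h, hX⟩ ⟨h', hX'⟩
    classical
    let g : S.toAffData.Model → Euc k := Quot.lift
      (fun p => if S.proj p.1.1 = m then φ p.1.2 - φ p.1.1 else 0) (by
        rintro ⟨⟨p₁, p₂⟩, hp⟩ ⟨⟨q₁, q₂⟩, hq⟩ ⟨h₁, c, h₂, h₃⟩
        simp only at hp hq h₁ h₂ h₃ ⊢
        by_cases hpm : S.proj p₁ = m
        · have hq1 : S.proj q₁ = m := h₁ ▸ hpm
          simp only [hpm, hq1, if_true]
          have hcp := S.isAffineBundle.comb_proj _ _ _ _ h₂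
          rw [hc _ _ _ _ (by rw [hpm]; exact hm) (by rw [← hq, hq1, hpm]) hcp.2] at h₂
          rw [hc _ _ _ _ (by rw [← hp, hpm]; exact hm) (by rw [← hp, hq1, hpm])
            (by rw [hcp.2, hp])] at h₃
          rw [h₂] at h₃
          have h4 : φ p₁ + φ q₂ = φ p₂ + φ q₁ := by
            have := congrArg (fun x => (2 : ℝ) • x) h₃
            simp only [smul_add, smul_smul] at this
            norm_num at this
            exact this
          rw [sub_eq_sub_iff_add_eq_add, ← h4, add_comm]
        · have hq1 : ¬ S.proj q₁ = m := h₁ ▸ hpm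
          simp only [hpm, hq1, if_false])
    have e : g (S.toAffData.vec a b h) = g (S.toAffData.vec a' b' h') := by rw [← hX, ← hX']
    simpa [g, AffData.vec, ha, ha'] using e
  obtain ⟨⟨⟨a, b⟩, hab⟩, hv⟩ := Quot.exists_rep (S.v m)
  simp only at hab
  have ha : S.proj a = m := by
    have := S.proj_v m
    rw [← hv] at this
    exact this
  have hvec : S.toAffData.IsVec a b (S.v m) := ⟨hab, hv.symm⟩
  have hne : φ b - φ a ≠ 0 := by
    intro h0
    have : a = b := by
      rw [← hT.left_inv a (ha.symm ▸ hm), ← hT.left_inv b (hab ▸ ha.symm ▸ hm), ← hab,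
        sub_eq_zero.1 h0]
    subst this
    exact S.v_ne_zero a (ha.symm ▸ hvec)
  set w := φ b - φ a with hw
  have hw2 : inner ℝ w w ≠ (0 : ℝ) := inner_self_ne_zero.2 hne
  refine ⟨⟨S.toSharpRed ⟨⟨m, fun x _ => inner ℝ w (φ x) / inner ℝ w w⟩, ?_, ?_⟩, rfl⟩⟩
  · intro t x y z hx hy hz h
    simp only at hx hy hz ⊢
    rw [hc _ _ _ _ (hx.symm ▸ hm) (hy.trans hx.symm) (hz.trans hx.symm)] at h
    rw [h, inner_add_right, real_inner_smul_right, real_inner_smul_right]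
    ring
  · intro x y hx hy h
    simp only at hx hy h ⊢
    rw [← sub_div, ← inner_sub_right, key x y a b _ hx ha h hvec, ← hw, div_self hw2]

/-! ### Affine differentials -/

/-- A point of `A̲` together with a section of `ζ : A → A̲` that is smooth near that point. -/
structure Germ where
  pt : S.Red
  sec : S.Red → A
  smooth : ∃ O : Set S.Red, DOpen O ∧ pt ∈ O ∧ DSmoothOn sec O ∧ ∀ y ∈ O, S.ζ (sec y) = y

/-- `f = σ' - σ` on `O`. The distinguished section of the bundle of affine values `ζ : A → A̲` is
`-v_A`, so this means `σ' = σ + f (-v_A)`, that is `[σ', σ] = f v_A`. -/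
def IsDifference (σ' σ : S.Red → A) (f : S.Red → ℝ) (O : Set S.Red) : Prop :=
  ∀ y ∈ O, S.Shift (σ' y) (σ y) (f y)

/-- `(x, σ) ∼ (x', σ')` iff `x = x'` and `d_x (σ - σ') = 0`. -/
def Germ.rel (g g' : S.Germ) : Prop :=
  g.pt = g'.pt ∧ ∃ (O : Set S.Red) (f : S.Red → ℝ), DOpen O ∧ g.pt ∈ O ∧
    S.IsDifference g.sec g'.sec f O ∧ HasZeroDifferential f g.pt

/-- The total space `P A` of the affine phase bundle: the affine differentials `d_x σ`. -/
def Phase : Type _ := Quot (Germ.rel S)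

/-- `σ` is a smooth section near `x` and `θ = d_x σ`. -/
def IsAffDifferential (x : S.Red) (σ : S.Red → A) (θ : S.Phase) : Prop :=
  ∃ g : S.Germ, g.pt = x ∧ g.sec = σ ∧ θ = Quot.mk _ g

/-- The diffeology of `P A` is generated by the families `u ↦ d_{x(u)} σ(u, ·)` with `x(u)` smooth
in `u` and `σ(u, y)` smooth in `(u, y)` near the graph of `x`. -/
instance : DiffeologicalSpace S.Phase :=
  .generateFrom {q | ∃ (x : Euc q.1 → S.Red) (σ : Euc q.1 × S.Red → A)
    (W : Set (Euc q.1 × S.Red)), IsPlot x ∧ DOpen W ∧ (∀ u, (u, x u) ∈ W) ∧ DSmoothOn σ W ∧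
    (∀ r ∈ W, S.ζ (σ r) = r.2) ∧
    ∀ u, S.IsAffDifferential (x u) (fun y => σ (u, y)) (q.2 u)}

/-- The foot point: the projection `P ζ : P A → A̲`. -/
def phasePt : S.Phase → S.Red := Quot.lift Germ.pt fun _ _ h => h.1

/-- The affine bundle `P ζ : P A → A̲`: affine differentials at one point are combined by combining
the sections pointwise. -/
def phaseAff₁ : AffData S.Phase S.Red where
  proj := S.phasePt
  comb t θ₁ θ₂ θ₃ := ∃ x σ₁ σ₂ σ₃, S.IsAffDifferential x σ₁ θ₁ ∧ S.IsAffDifferential x σ₂ θ₂ ∧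
    S.IsAffDifferential x σ₃ θ₃ ∧
    ∃ O : Set S.Red, DOpen O ∧ x ∈ O ∧ ∀ y ∈ O, S.comb t (σ₁ y) (σ₂ y) (σ₃ y)

/-- `σ` is a smooth section of `A` over the part of `A̲` over `U ⊆ M` and is affine on the fibres. -/
structure IsAffineSection (U : Set M) (σ : S.Red → A) : Prop where
  smooth : DSmoothOn σ {y | S.red.proj y ∈ U}
  section_eq : ∀ y, S.red.proj y ∈ U → S.ζ (σ y) = y
  affine : ∀ t x y z, S.red.proj x ∈ U → S.red.comb t x y z → S.comb t (σ x) (σ y) (σ z)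

/-- The projection of `P A` onto `A^# / ⟨1_A⟩`: `d_x σ`, for an affine section `σ`, is sent to the class
of the special affine function `f_σ` on the fibre with `f_σ(a) v_A = [σ(ζ a), a]`. -/
def phaseSharp (θ : S.Phase) : {Y : S.SharpRed // S.sharpRed.proj Y = S.red.proj (S.phasePt θ)} :=
  @Classical.epsilon _ (S.nonempty_sharp _) fun Y =>
    ∃ (U : Set M) (σ : S.Red → A) (φ : S.Sharp), DOpen U ∧ S.red.proj (S.phasePt θ) ∈ U ∧
      S.IsAffineSection U σ ∧ S.IsAffDifferential (S.phasePt θ) σ θ ∧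
      (∀ a h, S.Shift (σ (S.ζ a)) a (φ.1.fn a h)) ∧
      φ.1.base = S.red.proj (S.phasePt θ) ∧ Y.1 = S.toSharpRed φ

/-- The affine bundle `P A → A^# / ⟨1_A⟩`: for an affine section `σ₀`, points `x₁`, `x₂` of the fibre of
`A̲` over `m` and `αᵢ = d_m hᵢ` pulled back to `A̲`, the affine combination of `d_{x₁} σ₀ + α₁` and
`d_{x₂} σ₀ + α₂` is `d_x σ₀ + (t α₁ + (1 - t) α₂)` with `x = aff(x₁, x₂; t)`. -/
def phaseAff₂ : AffData S.Phase S.SharpRed where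
  proj θ := (S.phaseSharp θ).1
  comb t θ₁ θ₂ θ₃ := ∃ (U : Set M) (σ₀ τ₁ τ₂ τ₃ : S.Red → A) (h₁ h₂ : M → ℝ) (x₁ x₂ x₃ : S.Red),
    DOpen U ∧ S.red.proj x₁ ∈ U ∧ S.IsAffineSection U σ₀ ∧ DSmoothOn h₁ U ∧ DSmoothOn h₂ U ∧
    S.IsDifference τ₁ σ₀ (fun y => h₁ (S.red.proj y)) {y | S.red.proj y ∈ U} ∧
    S.IsDifference τ₂ σ₀ (fun y => h₂ (S.red.proj y)) {y | S.red.proj y ∈ U} ∧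
    S.IsDifference τ₃ σ₀ (fun y => t * h₁ (S.red.proj y) + (1 - t) * h₂ (S.red.proj y))
      {y | S.red.proj y ∈ U} ∧
    S.red.comb t x₁ x₂ x₃ ∧
    S.IsAffDifferential x₁ τ₁ θ₁ ∧ S.IsAffDifferential x₂ τ₂ θ₂ ∧ S.IsAffDifferential x₃ τ₃ θ₃

/-- The double affine phase bundle `(P A; A̲, A^# / ⟨1_A⟩; M)`. -/
def phaseDouble : DoubleAffData S.Phase S.Red S.SharpRed M where
  str₁ := S.phaseAff₁
  str₂ := S.phaseAff₂
  base₁ := S.sharpRed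
  base₂ := S.red
  comm θ := (S.phaseSharp θ).2

/-- The vector bundle `F = 𝒱(A̲) → M`. -/
def modelRed : VecData S.red.Model M := S.red.model

/-- The description of the canonical isomorphism `Φ : 𝒱𝒱(P A) → T*F`, `F = 𝒱(A̲)`. -/
structure IsCanonical (Φ : S.phaseDouble.modelDouble.Iso S.modelRed.cotangentDouble) : Prop where
  /-- it covers the identity of the side bundle `𝒱(A̲) = F` -/
  side₁ : ∀ w, Φ.side₁ w = w
  /-- on the other side bundle, `[φ, ψ]` is sent to the linear function `[ζ a, ζ b] ↦ (ψ - φ)(b) - (ψ - φ)(a)` -/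
  side₂ : ∀ (φ ψ : S.Sharp) (X : S.sharpRed.Model) (a b : A) (w : S.red.Model) ha hb ha' hb' hw,
    S.sharpRed.IsVec (S.toSharpRed φ) (S.toSharpRed ψ) X → S.red.IsVec (S.ζ a) (S.ζ b) w →
    (Φ.side₂ X).1.fn w hw = (ψ.1.fn b hb' - φ.1.fn b hb) - (ψ.1.fn a ha' - φ.1.fn a ha)
  /-- for `P = [[d_{x₁} σ₁, d_{x₁} σ₁'], [d_{x₂} σ₂, d_{x₂} σ₂']]`, `fᵢ = σᵢ' - σᵢ`, and smooth curves `γ₁`, `γ₂`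
  in `A̲` through `x₁`, `x₂` with the same projection to `M`,
  `⟨Φ(P), d/dt [γ₁, γ₂]⟩ = d/dt f₂(γ₂) - d/dt f₁(γ₁)` at `t = 0` -/
  pairing : ∀ (P : S.phaseDouble.VV) (X₁ X₂ : S.phaseAff₁.Model) (θ₁ θ₁' θ₂ θ₂' : S.Phase)
    (x₁ x₂ : S.Red) (σ₁ σ₁' σ₂ σ₂' : S.Red → A) (f₁ f₂ : S.Red → ℝ) (O₁ O₂ : Set S.Red),
    S.IsAffDifferential x₁ σ₁ θ₁ → S.IsAffDifferential x₁ σ₁' θ₁' →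
    S.IsAffDifferential x₂ σ₂ θ₂ → S.IsAffDifferential x₂ σ₂' θ₂' →
    S.phaseAff₁.IsVec θ₁ θ₁' X₁ → S.phaseAff₁.IsVec θ₂ θ₂' X₂ →
    S.phaseDouble.modelAff.IsVec X₁ X₂ P →
    DOpen O₁ → x₁ ∈ O₁ → S.IsDifference σ₁' σ₁ f₁ O₁ →
    DOpen O₂ → x₂ ∈ O₂ → S.IsDifference σ₂' σ₂ f₂ O₂ →
    ∀ (γ₁ γ₂ : ℝ → S.Red) (γ : ℝ → S.red.Model) (r₁ r₂ : ℝ), DSmooth γ₁ → DSmooth γ₂ →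
      γ₁ 0 = x₁ → γ₂ 0 = x₂ → (∀ t, S.red.IsVec (γ₁ t) (γ₂ t) (γ t)) →
      HasDerivAt (fun t => f₁ (γ₁ t)) r₁ 0 → HasDerivAt (fun t => f₂ (γ₂ t)) r₂ 0 →
      (Φ.toEquiv P).HasPairing γ (r₂ - r₁)

end SpecialAffineBundle

end DAff

end

set_option linter.unusedSectionVars false
noncomputable section

namespace DAff

open Diffeology

/-! ## Plots and smooth maps -/

section Basic

variable {X Y Z : Type*} [DiffeologicalSpace X] [DiffeologicalSpace Y] [DiffeologicalSpace Z]

/-! The assertion is local over `M`, and in suitable coordinates it is an identity of linear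
algebra. Write `B = ℝᵈ` and `E = ℝʳ`. Since `v_A` vanishes nowhere, `A` is locally `B × E × ℝ` with
`v_A` the constant vector `(0, -1)` (`exists_adapted`, `exists_adapted_chart`). Then `A̲` is `B ×
E`, a section of `ζ` is the graph of a function `h`, and `σ' - σ` is `h' - h` (`shift_height`). So
`d_x σ` is given by the point `(b, y)` and the derivative of `h`, split into a vertical part `q ∈
E*` and a horizontal part `p ∈ B*`. A special affine function on a fibre has the form `q y - z +
const`, so `q` is also the image of `d_x σ` in `A^# / ⟨1_A⟩`.

In the coordinates `(y, q, p)` over `b`, the structure over `A̲` fixes `y` and is affine in `(q,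
p)`; the structure over `A^# / ⟨1_A⟩` fixes `q` and is affine in `(y, p)`, because the horizontal
derivative of a function affine in `y` is again affine in `y` (`phaseAff₂_comb_iff`). For any bundle
with such coordinates the axioms of a double bundle are formal, and passing to the model turns
coordinates into differences: `P` gets the coordinates `(y₂ - y₁, q, p)` with `q = q₁' - q₁ = q₂' -
q₂` and `p = (p₂' - p₂) - (p₁' - p₁)`. A covector on `F` has coordinates `(w, q, p)` of the same
kind, with the same two structures (`VecTriv.cotangentDouble`).

If `γ₁`, `γ₂` have velocities `(u, w₁)`, `(u, w₂)`, the right side of the pairing formula is `p u +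
q (w₂ - w₁)` (`modelTotal_pairing`), the value of the covector with components `(q, p)` on the
velocity `(u, w₂ - w₁)` of `[γ₁, γ₂]`. Hence the formula says exactly that `Φ P` and `P` have the
same coordinates (`pairingRel_iff`). The formula itself does not mention coordinates, so the local
solutions agree on overlaps without any computation of transition functions, and they glue to an
isomorphism (`exists_iso`). Uniqueness follows because every velocity in `F` arises from such a pair
of curves. -/

theorem isPlot_prod {n : ℕ} {p : Euc n → X × Y} :
    IsPlot p ↔ IsPlot (fun u => (p u).1) ∧ IsPlot (fun u => (p u).2) :=
  DiffeologicalSpace.isPlot_inf_iff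

theorem _root_.Diffeology.IsPlot.prodMk {n : ℕ} {p : Euc n → X} {q : Euc n → Y} (hp : IsPlot p) (hq : IsPlot q) :
    IsPlot (fun u => (p u, q u)) :=
  isPlot_prod.2 ⟨hp, hq⟩

theorem isPlot_subtype {P : X → Prop} {n : ℕ} {p : Euc n → {x // P x}} :
    IsPlot p ↔ IsPlot (fun u => (p u).1) :=
  Iff.rfl

theorem dSmooth_quotMk {r : X → X → Prop} : DSmooth (Quot.mk r) := fun n p hp =>
  DiffeologicalSpace.isPlot_generatedFrom_of_mem (n := n) ⟨p, hp, rfl⟩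

theorem dSmooth_fst : DSmooth (Prod.fst : X × Y → X) := fun _ _ hp => (isPlot_prod.1 hp).1

theorem dSmooth_snd : DSmooth (Prod.snd : X × Y → Y) := fun _ _ hp => (isPlot_prod.1 hp).2

theorem dSmooth_val {P : X → Prop} : DSmooth (Subtype.val : {x // P x} → X) := fun _ _ hp => hp

theorem dSmoothOn_univ {f : X → Y} : DSmoothOn f Set.univ ↔ DSmooth f :=
  ⟨fun h n p hp => h n p hp fun _ => trivial, fun h n p hp _ => h n p hp⟩

theorem _root_.Diffeology.DSmooth.dSmoothOn {f : X → Y} (h : DSmooth f) (U : Set X) : DSmoothOn f U :=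
  fun n p hp _ => h n p hp

theorem DSmoothOn.mono {f : X → Y} {U V : Set X} (h : DSmoothOn f V) (hUV : U ⊆ V) :
    DSmoothOn f U :=
  fun n p hp hU => h n p hp fun u => hUV (hU u)

theorem DSmoothOn.congr {f g : X → Y} {U : Set X} (h : DSmoothOn f U) (hfg : ∀ x ∈ U, g x = f x) :
    DSmoothOn g U := fun n p hp hU => by
  rw [show g ∘ p = f ∘ p from funext fun u => hfg _ (hU u)]
  exact h n p hp hU

theorem DSmoothOn.comp {g : Y → Z} {f : X → Y} {V : Set Y} {U : Set X} (hg : DSmoothOn g V)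
    (hf : DSmoothOn f U) (h : ∀ x ∈ U, f x ∈ V) : DSmoothOn (fun x => g (f x)) U :=
  fun n p hp hU => hg n _ (hf n p hp hU) fun u => h _ (hU u)

theorem _root_.Diffeology.DSmooth.comp_dSmoothOn {g : Y → Z} {f : X → Y} {U : Set X} (hg : DSmooth g)
    (hf : DSmoothOn f U) : DSmoothOn (fun x => g (f x)) U :=
  fun n p hp hU => hg n _ (hf n p hp hU)

theorem DSmoothOn.prodMk {f : X → Y} {g : X → Z} {U : Set X} (hf : DSmoothOn f U)
    (hg : DSmoothOn g U) : DSmoothOn (fun x => (f x, g x)) U :=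
  fun n p hp hU => IsPlot.prodMk (hf n p hp hU) (hg n p hp hU)

theorem DSmoothOn.fst {f : X → Y × Z} {U : Set X} (hf : DSmoothOn f U) :
    DSmoothOn (fun x => (f x).1) U := dSmooth_fst.comp_dSmoothOn hf

theorem DSmoothOn.snd {f : X → Y × Z} {U : Set X} (hf : DSmoothOn f U) :
    DSmoothOn (fun x => (f x).2) U := dSmooth_snd.comp_dSmoothOn hf

/-- Smoothness of maps out of a space with a generated diffeology. -/
theorem dSmoothOn_generateFrom {X : Type*} {g : Set ((n : ℕ) × (Euc n → X))} {F : X → Y}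
    {W : Set X}
    (h : ∀ (n : ℕ) (q : Euc n → X), ⟨n, q⟩ ∈ g → ∀ (k : ℕ) (f : Euc k → Euc n),
      ContDiff ℝ ∞ f → (∀ u, q (f u) ∈ W) → IsPlot (fun u => F (q (f u)))) :
    @DSmoothOn X Y (.generateFrom g) _ F W := by
  -- The maps that `F` takes to plots, after every smooth reparametrization that stays over `W`,
  -- form a diffeology. It contains the generators, hence every plot of the generated diffeology.
  let d' : DiffeologicalSpace X :=
    { plots := fun n => {p | ∀ (k : ℕ) (f : Euc k → Euc n), ContDiff ℝ ∞ f →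
        (∀ u, p (f u) ∈ W) → IsPlot (fun u => F (p (f u)))}
      constant_plots := fun x k f _ _ => isPlot_const
      plot_reparam := fun hp hf k f' hf' hW => hp k _ (hf.comp hf') hW
      locality := fun {n p} hp k f hf hW => DiffeologicalSpace.locality fun x => by
        obtain ⟨u, hu, hx, hu'⟩ := hp (f x)
        refine ⟨f ⁻¹' u, hu.preimage hf.continuous, hx, fun {m f'} hf'u hf' => ?_⟩
        exact hu' (f := f ∘ f') hf'u (hf.comp hf') m id contDiff_id fun v => hW _ }
  intro n p hp hW
  exact hp d' (fun q hq k f hf hW => h q.1 q.2 hq k f hf hW) n id contDiff_id hW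

theorem dSmooth_generateFrom {X : Type*} {g : Set ((n : ℕ) × (Euc n → X))} {F : X → Y}
    (h : ∀ (n : ℕ) (q : Euc n → X), ⟨n, q⟩ ∈ g → IsPlot (fun u => F (q u))) :
    @DSmooth X Y (.generateFrom g) _ F := by
  let _ : DiffeologicalSpace X := .generateFrom g
  exact dSmoothOn_univ.1 (dSmoothOn_generateFrom fun n q hq k f hf _ =>
    isPlot_reparam (h n q hq) hf)

/-- The quotient diffeology is generated by projections of plots, so only plots that lift need
testing; locality takes care of the others. -/
theorem dSmoothOn_quot {r : X → X → Prop} {F : Quot r → Y} {W : Set (Quot r)}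
    (h : DSmoothOn (fun x => F (Quot.mk r x)) {x | Quot.mk r x ∈ W}) : DSmoothOn F W := by
  refine dSmoothOn_generateFrom ?_
  intro n q hq k f hf hW
  obtain ⟨p, hp, rfl⟩ : ∃ p : Euc n → X, IsPlot p ∧ q = Quot.mk r ∘ p := hq
  exact h k _ (isPlot_reparam hp hf) hW

theorem dSmooth_quot {r : X → X → Prop} {F : Quot r → Y}
    (h : DSmooth (fun x => F (Quot.mk r x))) : DSmooth F :=
  dSmoothOn_univ.1 (dSmoothOn_quot (h.dSmoothOn _))

/-! ### The D-topology -/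

theorem dOpen_iff {U : Set X} : DOpen U ↔ ∀ (n : ℕ) (p : Euc n → X), IsPlot p → IsOpen (p ⁻¹' U) :=
  isOpen_iff_preimages_plots

theorem DOpen.preimage {U : Set Y} (hU : DOpen U) {f : X → Y} (hf : DSmooth f) :
    DOpen (f ⁻¹' U) :=
  dOpen_iff.2 fun n p hp => dOpen_iff.1 hU n _ (hf n p hp)

theorem DOpen.inter {U V : Set X} (hU : DOpen U) (hV : DOpen V) : DOpen (U ∩ V) :=
  dOpen_iff.2 fun n p hp => (dOpen_iff.1 hU n p hp).inter (dOpen_iff.1 hV n p hp)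

theorem dOpen_univ : DOpen (Set.univ : Set X) := dOpen_iff.2 fun _ _ _ => isOpen_univ

theorem dSmooth_of_local {f : X → Y} (h : ∀ x, ∃ O : Set X, DOpen O ∧ x ∈ O ∧ DSmoothOn f O) :
    DSmooth f := fun n p hp => DiffeologicalSpace.locality fun u => by
  obtain ⟨O, hO, hx, hf⟩ := h (p u)
  exact ⟨p ⁻¹' O, dOpen_iff.1 hO n p hp, hx, fun hfu hf' =>
    hf _ _ (isPlot_reparam hp hf') hfu⟩

end Basic

/-! ### Finite-dimensional vector spaces -/

section Vector

variable {X : Type*} [DiffeologicalSpace X]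
  {E : Type*} [NormedAddCommGroup E] [NormedSpace ℝ E]
  [DiffeologicalSpace E] [IsContDiffCompatible E]
  {F : Type*} [NormedAddCommGroup F] [NormedSpace ℝ F]
  [DiffeologicalSpace F] [IsContDiffCompatible F]

instance : IsContDiffCompatible (E × F) where
  isPlot_iff := by
    intro n p
    rw [isPlot_prod, isPlot_iff_contDiff, isPlot_iff_contDiff]
    exact ⟨fun h => h.1.prodMk h.2, fun h => ⟨contDiff_fst.comp h, contDiff_snd.comp h⟩⟩

instance [FiniteDimensional ℝ E] [FiniteDimensional ℝ F] : DiffeologicalSpace (E →L[ℝ] F) :=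
  NormedSpace.toDiffeology _

instance [FiniteDimensional ℝ E] [FiniteDimensional ℝ F] : IsContDiffCompatible (E →L[ℝ] F) :=
  ⟨Iff.rfl⟩

theorem DSmoothOn.add {f g : X → E} {U : Set X} (hf : DSmoothOn f U) (hg : DSmoothOn g U) :
    DSmoothOn (fun x => f x + g x) U :=
  fun n p hp hU => ((hf n p hp hU).contDiff.add (hg n p hp hU).contDiff).isPlot

theorem DSmoothOn.sub {f g : X → E} {U : Set X} (hf : DSmoothOn f U) (hg : DSmoothOn g U) :
    DSmoothOn (fun x => f x - g x) U :=
  fun n p hp hU => ((hf n p hp hU).contDiff.sub (hg n p hp hU).contDiff).isPlot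

theorem DSmoothOn.clm_apply [FiniteDimensional ℝ E] [FiniteDimensional ℝ F] {f : X → E →L[ℝ] F}
    {g : X → E} {U : Set X} (hf : DSmoothOn f U)
    (hg : DSmoothOn g U) : DSmoothOn (fun x => f x (g x)) U :=
  fun n p hp hU => ((hf n p hp hU).contDiff.clm_apply (hg n p hp hU).contDiff).isPlot

theorem _root_.ContinuousLinearMap.dSmooth (L : E →L[ℝ] F) : DSmooth L := L.contDiff.dSmooth

theorem dSmoothOn_const {Y : Type*} [DiffeologicalSpace Y] (y : Y) (U : Set X) :
    DSmoothOn (fun _ => y) U :=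
  fun _ _ _ _ => isPlot_const

/-- A map that is smooth on an open set is smooth in the usual sense along smooth families of
points. -/
theorem DSmoothOn.contDiffOn_comp [FiniteDimensional ℝ E] {f : X → F} {O : Set X}
    (hf : DSmoothOn f O) (hO : DOpen O) {γ : E → X} (hγ : DSmooth γ) :
    IsOpen (γ ⁻¹' O) ∧ ContDiffOn ℝ ∞ (fun e => f (γ e)) (γ ⁻¹' O) := by
  let T := toEuclidean (E := E)
  have hp : IsPlot (γ ∘ T.symm) := hγ _ _ T.symm.contDiff.isPlot
  have ho : IsOpen ((γ ∘ T.symm) ⁻¹' O) := dOpen_iff.1 hO _ _ hp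
  have hpre : γ ⁻¹' O = T ⁻¹' ((γ ∘ T.symm) ⁻¹' O) := by ext; simp
  refine ⟨hpre ▸ ho.preimage T.continuous, ?_⟩
  have key : ContDiffOn ℝ ∞ (fun u => f ((γ ∘ T.symm) u)) ((γ ∘ T.symm) ⁻¹' O) := by
    intro u hu
    obtain ⟨ε, hε, hb⟩ := Metric.isOpen_iff.1 ho u hu
    -- Smoothness on `O` is tested only by plots defined on a whole `ℝⁿ` with all values in `O`. A
    -- small ball that is mapped into `O` is therefore first parametrized by all of space.
    have h1 : IsPlot (fun w => f ((γ ∘ T.symm) (OpenPartialHomeomorph.univBall u ε w))) := by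
      refine hf _ _ (isPlot_reparam hp OpenPartialHomeomorph.contDiff_univBall) fun w => hb ?_
      have := (OpenPartialHomeomorph.univBall u ε).map_source (x := w)
      rw [OpenPartialHomeomorph.univBall_target u hε] at this
      exact this (by simp)
    have h2 := h1.contDiff.contDiffOn.comp
      (OpenPartialHomeomorph.contDiffOn_univBall_symm (c := u) (r := ε))
      (Set.mapsTo_univ _ _)
    have hmem : Metric.ball u ε ∈ 𝓝 u := Metric.ball_mem_nhds _ hε
    refine ContDiffAt.contDiffWithinAt ?_
    refine (h2.contDiffAt hmem).congr_of_eventuallyEq ?_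
    filter_upwards [hmem] with w hw
    have : OpenPartialHomeomorph.univBall u ε ((OpenPartialHomeomorph.univBall u ε).symm w) = w :=
      (OpenPartialHomeomorph.univBall u ε).right_inv
        (by rwa [OpenPartialHomeomorph.univBall_target u hε])
    simp [Function.comp, this]
  rw [hpre]
  have := key.comp T.contDiff.contDiffOn (Set.mapsTo_preimage T _)
  exact this.congr fun e _ => by simp

theorem DSmoothOn.contDiffAt_comp [FiniteDimensional ℝ E] {f : X → F} {O : Set X}
    (hf : DSmoothOn f O) (hO : DOpen O) {γ : E → X} (hγ : DSmooth γ) {e : E} (he : γ e ∈ O) :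
    ContDiffAt ℝ ∞ (fun e => f (γ e)) e :=
  (hf.contDiffOn_comp hO hγ).2.contDiffAt ((hf.contDiffOn_comp hO hγ).1.mem_nhds he)

theorem DOpen.eventually_mem [FiniteDimensional ℝ E] {O : Set X} (hO : DOpen O) {γ : E → X}
    (hγ : DSmooth γ) {e : E} (he : γ e ∈ O) : ∀ᶠ e' in 𝓝 e, γ e' ∈ O :=
  -- The constant function only serves to extract the openness of the preimage.
  ((dSmoothOn_const (X := X) (0 : ℝ) O).contDiffOn_comp hO hγ).1.mem_nhds he

/-- Along a plot `p` the map `f ∘ p` is continuous on the open set `p ⁻¹' U`, which is all that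
D-openness of the intersection asks for. -/
theorem DOpen.inter_preimage {U : Set X} (hU : DOpen U) {f : X → F} (hf : DSmoothOn f U) {O : Set F}
    (hO : IsOpen O) : DOpen {x | x ∈ U ∧ f x ∈ O} := by
  refine dOpen_iff.2 fun n p hp => ?_
  have h := hf.contDiffOn_comp hU hp.dSmooth
  exact h.2.continuousOn.isOpen_inter_preimage h.1 hO

end Vector

/-! ## Trivializations with values in a vector space -/

/-- A trivialization over an open set `U` with fibre `E`. -/
structure Triv {A B : Type*} [DiffeologicalSpace A] [DiffeologicalSpace B] (proj : A → B)
    (U : Set B) (E : Type*) [DiffeologicalSpace E] where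
  φ : A → E
  ψ : B → E → A
  dOpen : DOpen U
  proj_inv : ∀ b ∈ U, ∀ x, proj (ψ b x) = b
  right_inv : ∀ b ∈ U, ∀ x, φ (ψ b x) = x
  left_inv : ∀ a, proj a ∈ U → ψ (proj a) (φ a) = a
  smooth : DSmoothOn φ {a | proj a ∈ U}
  smooth_inv : DSmoothOn (fun q : B × E => ψ q.1 q.2) {q | q.1 ∈ U}

/-- A trivialization of an affine bundle that is affine on the fibres. -/
structure AffTriv {A B : Type*} [DiffeologicalSpace A] [DiffeologicalSpace B] (S : AffData A B)
    (U : Set B) (E : Type*) [NormedAddCommGroup E] [NormedSpace ℝ E] [DiffeologicalSpace E]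
    extends Triv S.proj U E where
  comb_iff : ∀ t a b c, S.proj a ∈ U → S.proj b = S.proj a → S.proj c = S.proj a →
    (S.comb t a b c ↔ φ c = t • φ a + (1 - t) • φ b)

/-- A trivialization of a vector bundle that is linear on the fibres. -/
structure VecTriv {D B : Type*} [DiffeologicalSpace D] [DiffeologicalSpace B] (S : VecData D B)
    (U : Set B) (E : Type*) [NormedAddCommGroup E] [NormedSpace ℝ E] [DiffeologicalSpace E]
    extends Triv S.proj U E where
  add_iff : ∀ x y z, S.proj x ∈ U → S.proj y = S.proj x → S.proj z = S.proj x →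
    (S.add x y z ↔ φ z = φ x + φ y)
  smul_iff : ∀ t x y, S.proj x ∈ U → S.proj y = S.proj x → (S.smul t x y ↔ φ y = t • φ x)

namespace Triv

variable {A B X E : Type*} [DiffeologicalSpace A] [DiffeologicalSpace B]
  [DiffeologicalSpace X] [DiffeologicalSpace E] {proj : A → B} {U : Set B}

theorem ext_iff (T : Triv proj U E) {a a' : A} (ha : proj a ∈ U) :
    a = a' ↔ proj a' = proj a ∧ T.φ a' = T.φ a := by
  refine ⟨fun h => h ▸ ⟨rfl, rfl⟩, fun ⟨h, h'⟩ => ?_⟩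
  rw [← T.left_inv a ha, ← T.left_inv a' (h ▸ ha), h, h']

/-- A map into a bundle is smooth if its base point and its fibre coordinate are. -/
theorem dSmoothOn_of (T : Triv proj U E) {f : X → A} {O : Set X} (hO : ∀ x ∈ O, proj (f x) ∈ U)
    (h₁ : DSmoothOn (fun x => proj (f x)) O) (h₂ : DSmoothOn (fun x => T.φ (f x)) O) :
    DSmoothOn f O :=
  (T.smooth_inv.comp (h₁.prodMk h₂) hO).congr fun x hx => (T.left_inv _ (hO x hx)).symm

end Triv

section

variable {A B D X : Type*} [DiffeologicalSpace A] [DiffeologicalSpace B] [DiffeologicalSpace D]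
  [DiffeologicalSpace X]
  {E : Type*} [NormedAddCommGroup E] [NormedSpace ℝ E] [DiffeologicalSpace E]

namespace Triv

variable {proj : A → B} {U : Set B}

variable [FiniteDimensional ℝ E] [IsContDiffCompatible E]

/-- The definition of a bundle asks for fibres `ℝᵏ`, whereas the natural coordinates lie in products
and dual spaces. A linear identification of the fibre with `ℝᵏ` bridges the two. -/
theorem isTrivialization (T : Triv proj U E) :
    IsTrivialization proj U (fun a => toEuclidean (T.φ a))
      (fun q : B × Euc (Module.finrank ℝ E) => T.ψ q.1 (toEuclidean.symm q.2)) where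
  proj_inv b hb x := T.proj_inv b hb _
  right_inv b hb x := by rw [T.right_inv b hb, toEuclidean.apply_symm_apply]
  left_inv a ha := by rw [toEuclidean.symm_apply_apply, T.left_inv a ha]
  smooth := (toEuclidean (E := E)).contDiff.dSmooth.comp_dSmoothOn T.smooth
  smooth_inv := T.smooth_inv.comp ((dSmooth_fst.dSmoothOn _).prodMk
    ((toEuclidean (E := E)).symm.contDiff.dSmooth.comp_dSmoothOn (dSmooth_snd.dSmoothOn _)))
    fun _ h => h

end Triv

variable [FiniteDimensional ℝ E] [IsContDiffCompatible E]

theorem AffData.isAffineBundle_of {S : AffData A B} (h : DSmooth S.proj)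
    (hc : ∀ t a b c, S.comb t a b c → S.proj a = S.proj b ∧ S.proj c = S.proj a)
    (hT : ∀ b, ∃ U, b ∈ U ∧ Nonempty (AffTriv S U E)) : S.IsAffineBundle where
  smooth_proj := h
  comb_proj := hc
  locally_trivial := by
    refine ⟨Module.finrank ℝ E, fun b => ?_⟩
    obtain ⟨U, hb, ⟨T⟩⟩ := hT b
    refine ⟨U, _, _, T.dOpen, hb, T.isTrivialization, fun t a₁ a₂ a₃ h₁ h₂ h₃ => ?_⟩
    rw [T.comb_iff t a₁ a₂ a₃ h₁ h₂ h₃, ← map_smul, ← map_smul, ← map_add,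
      toEuclidean.injective.eq_iff]

theorem VecData.isVectorBundle_of {S : VecData D B} (h : DSmooth S.proj)
    (ha : ∀ x y z, S.add x y z → S.proj x = S.proj y ∧ S.proj z = S.proj x)
    (hs : ∀ t x y, S.smul t x y → S.proj y = S.proj x)
    (hT : ∀ b, ∃ U, b ∈ U ∧ Nonempty (VecTriv S U E)) : S.IsVectorBundle where
  smooth_proj := h
  add_proj := ha
  smul_proj := hs
  locally_trivial := by
    refine ⟨Module.finrank ℝ E, fun b => ?_⟩
    obtain ⟨U, hb, ⟨T⟩⟩ := hT b
    refine ⟨U, _, _, T.dOpen, hb, T.isTrivialization, fun x y z h₁ h₂ h₃ => ?_,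
      fun t x y h₁ h₂ => ?_⟩
    · rw [T.add_iff x y z h₁ h₂ h₃, ← map_add, toEuclidean.injective.eq_iff]
    · rw [T.smul_iff t x y h₁ h₂, ← map_smul, toEuclidean.injective.eq_iff]

end

/-! ### The model vector bundle -/

section Model

variable {A B : Type*}

namespace AffData

variable {S : AffData A B}

theorem IsVec.proj {a b : A} {X : S.Model} (h : S.IsVec a b X) :
    S.proj a = S.proj b ∧ S.model.proj X = S.proj a := by
  obtain ⟨h, rfl⟩ := h
  exact ⟨h, rfl⟩

theorem exists_isVec (X : S.Model) : ∃ a b, S.IsVec a b X := by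
  obtain ⟨⟨⟨a, b⟩, h⟩, rfl⟩ := Quot.exists_rep X
  exact ⟨a, b, h, rfl⟩

theorem isVec_out (X : S.Model) : S.IsVec (Quot.out X).1.1 (Quot.out X).1.2 X :=
  ⟨(Quot.out X).2, (Quot.out_eq X).symm⟩

theorem model_add_proj (x y z : S.Model) (h : S.model.add x y z) :
    S.model.proj x = S.model.proj y ∧ S.model.proj z = S.model.proj x := by
  obtain ⟨a, b, c, d, e, hx, hy, -, -, hz⟩ := h
  exact ⟨hx.proj.2.trans hy.proj.2.symm, hz.proj.2.trans hx.proj.2.symm⟩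

theorem model_smul_proj (t : ℝ) (x y : S.Model) (h : S.model.smul t x y) :
    S.model.proj y = S.model.proj x := by
  obtain ⟨a, b, c, hx, -, hy⟩ := h
  exact hy.proj.2.trans hx.proj.2.symm

variable [DiffeologicalSpace A] [DiffeologicalSpace B]

theorem dSmooth_model_proj (h : DSmooth S.proj) : DSmooth S.model.proj :=
  dSmooth_quot (r := S.parallel) (fun n _ hp => h n _ (isPlot_prod.1 hp).1)

end AffData

variable [DiffeologicalSpace A] [DiffeologicalSpace B] {S : AffData A B} {U : Set B}
  {E : Type*} [NormedAddCommGroup E] [NormedSpace ℝ E] [DiffeologicalSpace E]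

namespace AffTriv

/-- The midpoints of `a, b'` and of `b, a'` coincide iff `φ a + φ b' = φ b + φ a'`. Conversely the
common midpoint exists because `ψ` realizes every coordinate. -/
theorem parallel_iff (T : AffTriv S U E)
    (hS : ∀ t a b c, S.comb t a b c → S.proj a = S.proj b ∧ S.proj c = S.proj a)
    {p q : S.Pair} (hp : S.proj p.1.1 ∈ U) (hpq : S.proj p.1.1 = S.proj q.1.1) :
    S.parallel p q ↔ T.φ p.1.2 - T.φ p.1.1 = T.φ q.1.2 - T.φ q.1.1 := by
  obtain ⟨⟨a, b⟩, hab⟩ := p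
  obtain ⟨⟨a', b'⟩, hab'⟩ := q
  simp only at hab hab' hp hpq ⊢
  have e : ∀ x y x' y' z : E, z = (1 / 2 : ℝ) • x + (1 - 1 / 2 : ℝ) • y' →
      (z = (1 / 2 : ℝ) • y + (1 - 1 / 2 : ℝ) • x' ↔ y - x = y' - x') := by
    rintro x y x' y' z rfl
    rw [sub_eq_sub_iff_add_eq_add]
    norm_num
    rw [← smul_add, ← smul_add, smul_right_inj (by norm_num), eq_comm, add_comm y']
  constructor
  · rintro ⟨-, c, h, h'⟩
    have hc := (hS _ _ _ _ h).2
    simp only at h h' hc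
    rw [T.comb_iff _ _ _ _ hp (by rw [hpq, hab']) hc] at h
    rw [T.comb_iff _ _ _ _ (hab ▸ hp) (by rw [← hab, hpq]) (by rw [hc, hab])] at h'
    exact (e _ _ _ _ _ h).1 h'
  · intro h
    have hc : S.proj (T.ψ (S.proj a) ((1 / 2 : ℝ) • T.φ a + (1 - 1 / 2 : ℝ) • T.φ b')) = S.proj a :=
      T.proj_inv _ hp _
    have hc' := T.right_inv _ hp ((1 / 2 : ℝ) • T.φ a + (1 - 1 / 2 : ℝ) • T.φ b')
    refine ⟨hpq, _, (T.comb_iff _ _ _ _ hp (by simp only; rw [hpq, hab']) hc).2 hc', ?_⟩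
    exact (T.comb_iff _ _ _ _ (hab ▸ hp) (by simp only; rw [← hab, hpq])
      (by simp only; rw [hc, hab])).2 ((e _ _ _ _ _ hc').2 h)

open Classical in
/-- The fibre coordinate of the model vector bundle: `[a, b] ↦ φ b - φ a`. -/
def modelφ (T : AffTriv S U E)
    (hS : ∀ t a b c, S.comb t a b c → S.proj a = S.proj b ∧ S.proj c = S.proj a) : S.Model → E :=
  -- The value `0` off `U` only makes the coordinate a total function; the case distinction is
  -- compatible with `parallel` since parallel pairs lie in one fibre.
  Quot.lift (fun p => if S.proj p.1.1 ∈ U then T.φ p.1.2 - T.φ p.1.1 else 0) fun p q h => by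
    by_cases hp : S.proj p.1.1 ∈ U
    · rw [if_pos hp, if_pos (h.1 ▸ hp)]
      exact (T.parallel_iff hS hp h.1).1 h
    · rw [if_neg hp, if_neg (h.1 ▸ hp)]

theorem modelφ_eq (T : AffTriv S U E)
    (hS : ∀ t a b c, S.comb t a b c → S.proj a = S.proj b ∧ S.proj c = S.proj a) {a b : A}
    {X : S.Model} (h : S.IsVec a b X) (ha : S.proj a ∈ U) : T.modelφ hS X = T.φ b - T.φ a := by
  obtain ⟨h, rfl⟩ := h
  exact if_pos ha

/-- A vector over `U` is determined by its base point and its coordinate, so any pair of points with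
the right difference represents it. This reduces claims about classes to subtractions. -/
theorem isVec_iff_modelφ (T : AffTriv S U E)
    (hS : ∀ t a b c, S.comb t a b c → S.proj a = S.proj b ∧ S.proj c = S.proj a) {a b : A}
    {X : S.Model} (ha : S.proj a ∈ U) (hab : S.proj a = S.proj b)
    (hX : S.model.proj X = S.proj a) : S.IsVec a b X ↔ T.modelφ hS X = T.φ b - T.φ a := by
  refine ⟨fun h => T.modelφ_eq hS h ha, fun h => ?_⟩
  obtain ⟨a', b', h'⟩ := S.exists_isVec X
  have e := h'.proj
  have h2 := T.modelφ_eq hS h' (by rw [← e.2, hX]; exact ha)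
  refine ⟨hab, ?_⟩
  obtain ⟨hab', rfl⟩ := h'
  refine Quot.sound ((T.parallel_iff hS ?_ ?_).2 ?_)
  · rw [← e.2, hX]; exact ha
  · rw [← e.2, hX]
  · rw [← h2, h]

variable [IsContDiffCompatible E]

/-- The trivialization of the model vector bundle. -/
def model (T : AffTriv S U E)
    (hS : ∀ t a b c, S.comb t a b c → S.proj a = S.proj b ∧ S.proj c = S.proj a) :
    VecTriv S.model U E where
  φ := T.modelφ hS
  -- Vectors are drawn from the origin `T.ψ b 0` of the fibre, so their coordinate is that of the
  -- end point.
  ψ b x := open Classical in if h : b ∈ U then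
      S.vec (T.ψ b 0) (T.ψ b x) (by rw [T.proj_inv b h, T.proj_inv b h])
    else S.vec (T.ψ b 0) (T.ψ b 0) rfl
  dOpen := T.dOpen
  proj_inv b hb x := by
    rw [dif_pos hb]
    exact T.proj_inv b hb 0
  right_inv b hb x := by
    rw [dif_pos hb, T.modelφ_eq hS ⟨_, rfl⟩ (by rwa [T.proj_inv b hb]), T.right_inv b hb,
      T.right_inv b hb, sub_zero]
  left_inv X hX := by
    rw [dif_pos hX]
    have h0 := T.proj_inv _ hX
    exact (((T.isVec_iff_modelφ hS (by rwa [h0]) (by rw [h0, h0]) (by rw [h0])).2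
      (by rw [T.right_inv _ hX, T.right_inv _ hX, sub_zero])).2).symm
  smooth := by
    refine dSmoothOn_quot (r := S.parallel) ?_
    intro n p hp hU
    have h2 := isPlot_prod.1 hp
    have h3 : IsPlot (fun u => T.φ (p u).1.2) := T.smooth _ _ h2.2 fun u => by
      change S.proj _ ∈ U
      rw [← (p u).2]; exact hU u
    have h4 : IsPlot (fun u => T.φ (p u).1.1) := T.smooth _ _ h2.1 fun u => hU u
    convert! (h3.contDiff.sub h4.contDiff).isPlot using 2 with u
    exact if_pos (hU u)
  smooth_inv := by
    intro n p hp hU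
    have h1 := (isPlot_prod.1 hp).1
    have h2 : IsPlot (fun u => T.ψ (p u).1 0) := T.smooth_inv _ _ (h1.prodMk isPlot_const) hU
    have h3 : IsPlot (fun u => T.ψ (p u).1 (p u).2) := T.smooth_inv _ _ hp hU
    have h4 : IsPlot (fun u => (⟨(T.ψ (p u).1 0, T.ψ (p u).1 (p u).2), by
      rw [T.proj_inv _ (hU u), T.proj_inv _ (hU u)]⟩ : S.Pair)) := isPlot_subtype.2 (h2.prodMk h3)
    have h5 : IsPlot (fun u => S.vec (T.ψ (p u).1 0) (T.ψ (p u).1 (p u).2) (by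
      rw [T.proj_inv _ (hU u), T.proj_inv _ (hU u)])) := dSmooth_quotMk (r := S.parallel) _ _ h4
    convert! h5 using 1
    exact funext fun u => dif_pos (hU u)
  add_iff X Y Z hX hY hZ := by
    constructor
    · rintro ⟨a, b, c, d, e, h1, h2, h3, h4, h5⟩
      have e1 := h1.proj
      have e2 := h2.proj
      have e3 := hS _ _ _ _ h3
      have e4 := hS _ _ _ _ h4
      have ha : S.proj a ∈ U := e1.2 ▸ hX
      rw [T.modelφ_eq hS h1 ha, T.modelφ_eq hS h2 ha, T.modelφ_eq hS h5 ha]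
      rw [T.comb_iff _ _ _ _ (e1.1 ▸ ha) e3.1.symm e3.2] at h3
      rw [T.comb_iff _ _ _ _ (e4.1 ▸ ha) e4.1.symm e4.2, h3] at h4
      rw [h4]
      module
    · intro h
      set m := S.model.proj X with hm
      have hp := T.proj_inv m hX
      have hr := T.right_inv m hX
      -- All arrows start at the origin of the fibre. The midpoint of the ends of `X` and `Y`,
      -- stretched from the origin by the factor `2`, is the end of the sum.
      refine ⟨T.ψ m 0, T.ψ m (T.modelφ hS X), T.ψ m (T.modelφ hS Y),
        T.ψ m ((1 / 2 : ℝ) • T.modelφ hS X + (1 - 1 / 2 : ℝ) • T.modelφ hS Y),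
        T.ψ m (T.modelφ hS Z), ?_, ?_, ?_, ?_, ?_⟩
      · rw [T.isVec_iff_modelφ hS] <;> simp only [hp, hr, hX, sub_zero, ← hm]
      · rw [T.isVec_iff_modelφ hS] <;> simp only [hp, hr, hX, sub_zero, hY]
      · rw [T.comb_iff] <;> simp only [hp, hr, hX]
      · rw [T.comb_iff] <;> simp only [hp, hr, hX, h]
        module
      · rw [T.isVec_iff_modelφ hS] <;> simp only [hp, hr, hX, sub_zero, hZ]
  smul_iff t X Y hX hY := by
    constructor
    · rintro ⟨a, b, c, h1, h2, h3⟩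
      have e1 := h1.proj
      have e2 := hS _ _ _ _ h2
      have ha : S.proj a ∈ U := e1.2 ▸ hX
      rw [T.modelφ_eq hS h1 ha, T.modelφ_eq hS h3 ha]
      rw [T.comb_iff _ _ _ _ (e1.1 ▸ ha) e2.1.symm e2.2] at h2
      rw [h2]
      module
    · intro h
      set m := S.model.proj X with hm
      have hp := T.proj_inv m hX
      have hr := T.right_inv m hX
      refine ⟨T.ψ m 0, T.ψ m (T.modelφ hS X), T.ψ m (T.modelφ hS Y), ?_, ?_, ?_⟩
      · rw [T.isVec_iff_modelφ hS] <;> simp only [hp, hr, hX, sub_zero, ← hm]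
      · rw [T.comb_iff] <;> simp only [hp, hr, hX, h, smul_zero, add_zero]
      · rw [T.isVec_iff_modelφ hS] <;> simp only [hp, hr, hX, sub_zero, hY]

theorem isVec_iff (T : AffTriv S U E)
    (hS : ∀ t a b c, S.comb t a b c → S.proj a = S.proj b ∧ S.proj c = S.proj a) {a b : A}
    {X : S.Model} (ha : S.proj a ∈ U) (hab : S.proj a = S.proj b)
    (hX : S.model.proj X = S.proj a) : S.IsVec a b X ↔ (T.model hS).φ X = T.φ b - T.φ a :=
  T.isVec_iff_modelφ hS ha hab hX

theorem model_φ_eq (T : AffTriv S U E)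
    (hS : ∀ t a b c, S.comb t a b c → S.proj a = S.proj b ∧ S.proj c = S.proj a) {a b : A}
    {X : S.Model} (h : S.IsVec a b X) (ha : S.proj a ∈ U) :
    (T.model hS).φ X = T.φ b - T.φ a :=
  T.modelφ_eq hS h ha

end AffTriv

end Model

/-! ## Trivializations of double bundles -/

namespace Triv

variable {X A A₁ A₂ M : Type*} [DiffeologicalSpace X] [DiffeologicalSpace A]
  [DiffeologicalSpace A₁] [DiffeologicalSpace A₂] [DiffeologicalSpace M] {U : Set M}
  {E₁ E₂ E₃ F : Type*} [DiffeologicalSpace E₁] [DiffeologicalSpace E₂] [DiffeologicalSpace E₃]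
  [DiffeologicalSpace F]

/-- The trivialization of `π₁ : A → A₁` obtained from trivializations of `A` and `A₁` over `M`. -/
def side₁ {π₁ : A → A₁} {ρ : A₁ → M} (t₁ : Triv ρ U E₁)
    (t : Triv (fun a => ρ (π₁ a)) U (E₁ × F)) (hρ : DSmooth ρ)
    (fst : ∀ a, ρ (π₁ a) ∈ U → t₁.φ (π₁ a) = (t.φ a).1) : Triv π₁ {a₁ | ρ a₁ ∈ U} F where
  φ a := (t.φ a).2
  ψ a₁ e := t.ψ (ρ a₁) (t₁.φ a₁, e)
  dOpen := t.dOpen.preimage hρ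
  proj_inv a₁ h e := by
    have h1 := t.proj_inv _ h (t₁.φ a₁, e)
    have h2 : ρ (π₁ (t.ψ (ρ a₁) (t₁.φ a₁, e))) ∈ U := by rw [h1]; exact h
    rw [t₁.ext_iff h2, fst _ h2, t.right_inv _ h, h1]
    exact ⟨rfl, rfl⟩
  right_inv a₁ h e := by rw [t.right_inv _ h]
  left_inv a h := by
    rw [fst a h]
    exact t.left_inv a h
  smooth := t.smooth.snd
  smooth_inv := by
    refine t.smooth_inv.comp (f := fun q : A₁ × F => (ρ q.1, (t₁.φ q.1, q.2)))
      (((hρ.comp dSmooth_fst).dSmoothOn _).prodMk (DSmoothOn.prodMk ?_ (dSmooth_snd.dSmoothOn _)))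
      fun _ h => h
    exact t₁.smooth.comp (dSmooth_fst.dSmoothOn _) fun _ h => h

/-- The trivialization of a composite of two bundle projections. -/
def total {π₁ : A → A₁} {ρ : A₁ → M} (t₁ : Triv ρ U E₁) (s : Triv π₁ {a₁ | ρ a₁ ∈ U} F)
    (hπ : DSmooth π₁) : Triv (fun a => ρ (π₁ a)) U (E₁ × F) where
  φ a := (t₁.φ (π₁ a), s.φ a)
  ψ m e := s.ψ (t₁.ψ m e.1) e.2
  dOpen := t₁.dOpen
  proj_inv m h e := by
    have h1 := t₁.proj_inv m h e.1
    rw [s.proj_inv _ (by rw [Set.mem_ofPred_eq, h1]; exact h), h1]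
  right_inv m h e := by
    have h1 := t₁.proj_inv m h e.1
    rw [s.proj_inv _ (by rw [Set.mem_ofPred_eq, h1]; exact h), t₁.right_inv m h,
      s.right_inv _ (by rw [Set.mem_ofPred_eq, h1]; exact h)]
  left_inv a h := by
    rw [t₁.left_inv _ h, s.left_inv _ h]
  smooth := (t₁.smooth.comp (hπ.dSmoothOn _) fun _ h => h).prodMk s.smooth
  smooth_inv := by
    refine s.smooth_inv.comp (f := fun q : M × (E₁ × F) => (t₁.ψ q.1 q.2.1, q.2.2)) ?_ ?_
    · exact (t₁.smooth_inv.comp ((dSmooth_fst.dSmoothOn _).prodMk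
        ((dSmooth_fst.comp dSmooth_snd).dSmoothOn _)) fun _ h => h).prodMk
        ((dSmooth_snd.comp dSmooth_snd).dSmoothOn _)
    · intro q h
      change ρ _ ∈ U
      rw [t₁.proj_inv _ h]
      exact h

/-- Change of the fibre along a diffeomorphism. -/
def map {ρ ρ' : A → M} (t : Triv ρ U F) (e : F ≃ E₁) (he : DSmooth e) (he' : DSmooth e.symm)
    (hρ : ∀ a, ρ' a = ρ a) : Triv ρ' U E₁ where
  φ a := e (t.φ a)
  ψ m x := t.ψ m (e.symm x)
  dOpen := t.dOpen
  proj_inv m h x := by rw [hρ, t.proj_inv m h]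
  right_inv m h x := by rw [t.right_inv m h, e.apply_symm_apply]
  left_inv a h := by rw [e.symm_apply_apply, hρ, t.left_inv _ (hρ a ▸ h)]
  smooth := by
    simp only [hρ]
    exact he.comp_dSmoothOn t.smooth
  smooth_inv := t.smooth_inv.comp ((dSmooth_fst.dSmoothOn _).prodMk
    ((he'.comp dSmooth_snd).dSmoothOn _)) fun _ h => h

theorem dSmooth_swap : DSmooth (fun e : E₁ × E₂ × E₃ => (e.2.1, e.1, e.2.2)) := by
  refine dSmoothOn_univ.1 (DSmoothOn.prodMk ?_ (DSmoothOn.prodMk ?_ ?_))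
  · exact (dSmooth_fst.comp dSmooth_snd).dSmoothOn _
  · exact dSmooth_fst.dSmoothOn _
  · exact (dSmooth_snd.comp dSmooth_snd).dSmoothOn _

/-- Exchange of the first two factors. -/
def swap : E₁ × E₂ × E₃ ≃ E₂ × E₁ × E₃ where
  toFun e := (e.2.1, e.1, e.2.2)
  invFun e := (e.2.1, e.1, e.2.2)

/-- The trivialization of `π₂ : A → A₂` obtained from trivializations of `A` and `A₂` over `M`. -/
def side₂ {π₂ : A → A₂} {ρ : A → M} {ρ' : A₂ → M} (t₂ : Triv ρ' U E₂)
    (t : Triv ρ U (E₁ × E₂ × E₃)) (hρ : DSmooth ρ')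
    (comm : ∀ a, ρ' (π₂ a) = ρ a)
    (snd : ∀ a, ρ a ∈ U → t₂.φ (π₂ a) = (t.φ a).2.1) : Triv π₂ {a₂ | ρ' a₂ ∈ U} (E₁ × E₃) :=
  side₁ t₂ (t.map swap dSmooth_swap dSmooth_swap comm) hρ fun a h => snd a (comm a ▸ h)

end Triv

section

variable {E₁ : Type*} [NormedAddCommGroup E₁] [NormedSpace ℝ E₁]
  [DiffeologicalSpace E₁] [IsContDiffCompatible E₁]
  {E₂ : Type*} [NormedAddCommGroup E₂] [NormedSpace ℝ E₂]
  [DiffeologicalSpace E₂] [IsContDiffCompatible E₂]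
  {E₃ : Type*} [NormedAddCommGroup E₃] [NormedSpace ℝ E₃]
  [DiffeologicalSpace E₃] [IsContDiffCompatible E₃]
  {A A₁ A₂ M : Type*} [DiffeologicalSpace A]
  [DiffeologicalSpace A₁] [DiffeologicalSpace A₂] [DiffeologicalSpace M]

namespace DoubleAffData

/-- The projection of the total space onto `M`. -/
def base (S : DoubleAffData A A₁ A₂ M) (a : A) : M := S.base₂.proj (S.str₁.proj a)

end DoubleAffData

namespace DoubleVecData

/-- The projection of the total space onto `M`. -/
def base (S : DoubleVecData A A₁ A₂ M) (a : A) : M := S.base₂.proj (S.str₁.proj a)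

end DoubleVecData

/-- Compatible trivializations over `U ⊆ M` of all spaces of a double affine bundle. -/
structure DoubleAffTriv (S : DoubleAffData A A₁ A₂ M) (U : Set M) (E₁ E₂ E₃ : Type*)
    [NormedAddCommGroup E₁] [NormedSpace ℝ E₁] [DiffeologicalSpace E₁]
    [NormedAddCommGroup E₂] [NormedSpace ℝ E₂] [DiffeologicalSpace E₂]
    [NormedAddCommGroup E₃] [NormedSpace ℝ E₃] [DiffeologicalSpace E₃] where
  t₁ : AffTriv S.base₂ U E₁
  t₂ : AffTriv S.base₁ U E₂
  t : Triv S.base U (E₁ × E₂ × E₃)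
  fst : ∀ a, S.base a ∈ U → t₁.φ (S.str₁.proj a) = (t.φ a).1
  snd : ∀ a, S.base a ∈ U → t₂.φ (S.str₂.proj a) = (t.φ a).2.1
  comb₁_iff : ∀ s a b c, S.base a ∈ U → S.str₁.proj b = S.str₁.proj a →
    S.str₁.proj c = S.str₁.proj a → (S.str₁.comb s a b c ↔
      (t.φ c).2.1 = s • (t.φ a).2.1 + (1 - s) • (t.φ b).2.1 ∧
      (t.φ c).2.2 = s • (t.φ a).2.2 + (1 - s) • (t.φ b).2.2)
  comb₂_iff : ∀ s a b c, S.base a ∈ U → S.str₂.proj b = S.str₂.proj a →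
    S.str₂.proj c = S.str₂.proj a → (S.str₂.comb s a b c ↔
      (t.φ c).1 = s • (t.φ a).1 + (1 - s) • (t.φ b).1 ∧
      (t.φ c).2.2 = s • (t.φ a).2.2 + (1 - s) • (t.φ b).2.2)

/-- Compatible trivializations over `U ⊆ M` of all spaces of a double vector bundle. -/
structure DoubleVecTriv (S : DoubleVecData A A₁ A₂ M) (U : Set M) (E₁ E₂ E₃ : Type*)
    [NormedAddCommGroup E₁] [NormedSpace ℝ E₁] [DiffeologicalSpace E₁]
    [NormedAddCommGroup E₂] [NormedSpace ℝ E₂] [DiffeologicalSpace E₂]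
    [NormedAddCommGroup E₃] [NormedSpace ℝ E₃] [DiffeologicalSpace E₃] where
  t₁ : VecTriv S.base₂ U E₁
  t₂ : VecTriv S.base₁ U E₂
  t : Triv S.base U (E₁ × E₂ × E₃)
  fst : ∀ a, S.base a ∈ U → t₁.φ (S.str₁.proj a) = (t.φ a).1
  snd : ∀ a, S.base a ∈ U → t₂.φ (S.str₂.proj a) = (t.φ a).2.1
  add₁_iff : ∀ a b c, S.base a ∈ U → S.str₁.proj b = S.str₁.proj a →
    S.str₁.proj c = S.str₁.proj a → (S.str₁.add a b c ↔
      (t.φ c).2.1 = (t.φ a).2.1 + (t.φ b).2.1 ∧ (t.φ c).2.2 = (t.φ a).2.2 + (t.φ b).2.2)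
  smul₁_iff : ∀ s a b, S.base a ∈ U → S.str₁.proj b = S.str₁.proj a → (S.str₁.smul s a b ↔
      (t.φ b).2.1 = s • (t.φ a).2.1 ∧ (t.φ b).2.2 = s • (t.φ a).2.2)
  add₂_iff : ∀ a b c, S.base a ∈ U → S.str₂.proj b = S.str₂.proj a →
    S.str₂.proj c = S.str₂.proj a → (S.str₂.add a b c ↔
      (t.φ c).1 = (t.φ a).1 + (t.φ b).1 ∧ (t.φ c).2.2 = (t.φ a).2.2 + (t.φ b).2.2)
  smul₂_iff : ∀ s a b, S.base a ∈ U → S.str₂.proj b = S.str₂.proj a → (S.str₂.smul s a b ↔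
      (t.φ b).1 = s • (t.φ a).1 ∧ (t.φ b).2.2 = s • (t.φ a).2.2)

/-- Double affine data that are trivial locally over `M`. -/
structure DoubleAffData.LocallyTrivial (S : DoubleAffData A A₁ A₂ M) (E₁ E₂ E₃ : Type*)
    [NormedAddCommGroup E₁] [NormedSpace ℝ E₁] [DiffeologicalSpace E₁]
    [NormedAddCommGroup E₂] [NormedSpace ℝ E₂] [DiffeologicalSpace E₂]
    [NormedAddCommGroup E₃] [NormedSpace ℝ E₃] [DiffeologicalSpace E₃] : Prop where
  smooth_str₁ : DSmooth S.str₁.proj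
  smooth_base₁ : DSmooth S.base₁.proj
  smooth_base₂ : DSmooth S.base₂.proj
  comb_str₁ : ∀ t a b c, S.str₁.comb t a b c →
    S.str₁.proj a = S.str₁.proj b ∧ S.str₁.proj c = S.str₁.proj a
  comb_str₂ : ∀ t a b c, S.str₂.comb t a b c →
    S.str₂.proj a = S.str₂.proj b ∧ S.str₂.proj c = S.str₂.proj a
  comb_base₁ : ∀ t a b c, S.base₁.comb t a b c →
    S.base₁.proj a = S.base₁.proj b ∧ S.base₁.proj c = S.base₁.proj a
  comb_base₂ : ∀ t a b c, S.base₂.comb t a b c →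
    S.base₂.proj a = S.base₂.proj b ∧ S.base₂.proj c = S.base₂.proj a
  exists_triv : ∀ m, ∃ U, m ∈ U ∧ Nonempty (DoubleAffTriv S U E₁ E₂ E₃)

/-- Double vector bundle data that are trivial locally over `M`. -/
structure DoubleVecData.LocallyTrivial (S : DoubleVecData A A₁ A₂ M) (E₁ E₂ E₃ : Type*)
    [NormedAddCommGroup E₁] [NormedSpace ℝ E₁] [DiffeologicalSpace E₁]
    [NormedAddCommGroup E₂] [NormedSpace ℝ E₂] [DiffeologicalSpace E₂]
    [NormedAddCommGroup E₃] [NormedSpace ℝ E₃] [DiffeologicalSpace E₃] : Prop where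
  comm : ∀ a, S.base₁.proj (S.str₂.proj a) = S.base₂.proj (S.str₁.proj a)
  smooth_str₁ : DSmooth S.str₁.proj
  smooth_base₁ : DSmooth S.base₁.proj
  smooth_base₂ : DSmooth S.base₂.proj
  add_str₁ : ∀ a b c, S.str₁.add a b c →
    S.str₁.proj a = S.str₁.proj b ∧ S.str₁.proj c = S.str₁.proj a
  add_str₂ : ∀ a b c, S.str₂.add a b c →
    S.str₂.proj a = S.str₂.proj b ∧ S.str₂.proj c = S.str₂.proj a
  add_base₁ : ∀ a b c, S.base₁.add a b c →
    S.base₁.proj a = S.base₁.proj b ∧ S.base₁.proj c = S.base₁.proj a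
  add_base₂ : ∀ a b c, S.base₂.add a b c →
    S.base₂.proj a = S.base₂.proj b ∧ S.base₂.proj c = S.base₂.proj a
  smul_str₁ : ∀ t a b, S.str₁.smul t a b → S.str₁.proj b = S.str₁.proj a
  smul_str₂ : ∀ t a b, S.str₂.smul t a b → S.str₂.proj b = S.str₂.proj a
  smul_base₁ : ∀ t a b, S.base₁.smul t a b → S.base₁.proj b = S.base₁.proj a
  smul_base₂ : ∀ t a b, S.base₂.smul t a b → S.base₂.proj b = S.base₂.proj a
  exists_triv : ∀ m, ∃ U, m ∈ U ∧ Nonempty (DoubleVecTriv S U E₁ E₂ E₃)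


/-! ### Double affine bundles -/

namespace DoubleAffTriv

variable {S : DoubleAffData A A₁ A₂ M} {U : Set M} (T : DoubleAffTriv S U E₁ E₂ E₃)

theorem proj₁_eq_iff {a b : A} (ha : S.base a ∈ U) :
    S.str₁.proj b = S.str₁.proj a ↔ S.base b = S.base a ∧ (T.t.φ b).1 = (T.t.φ a).1 := by
  rw [eq_comm, T.t₁.ext_iff (show S.base₂.proj (S.str₁.proj a) ∈ U from ha)]
  refine and_congr_right fun h => ?_
  rw [T.fst a ha, T.fst b (show S.base₂.proj (S.str₁.proj b) ∈ U from h ▸ ha)]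

theorem proj₂_eq_iff {a b : A} (ha : S.base a ∈ U) :
    S.str₂.proj b = S.str₂.proj a ↔ S.base b = S.base a ∧ (T.t.φ b).2.1 = (T.t.φ a).2.1 := by
  have hc : ∀ a, S.base₁.proj (S.str₂.proj a) = S.base a := S.comm
  rw [eq_comm, T.t₂.ext_iff (by rwa [hc]), hc, hc]
  refine and_congr_right fun h => ?_
  rw [T.snd a ha, T.snd b (h ▸ ha)]

variable (L : S.LocallyTrivial E₁ E₂ E₃)
include L

/-- The side conditions of `comb₁_iff` are absorbed into the coordinates, so that the axioms of a
double affine bundle turn into equations between coordinates. -/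
theorem comb₁_iff_coord (s : ℝ) {a b c : A} (ha : S.base a ∈ U) :
    S.str₁.comb s a b c ↔ S.base b = S.base a ∧ S.base c = S.base a ∧
      (T.t.φ b).1 = (T.t.φ a).1 ∧ (T.t.φ c).1 = (T.t.φ a).1 ∧
      (T.t.φ c).2.1 = s • (T.t.φ a).2.1 + (1 - s) • (T.t.φ b).2.1 ∧
      (T.t.φ c).2.2 = s • (T.t.φ a).2.2 + (1 - s) • (T.t.φ b).2.2 := by
  constructor
  · intro h
    have h1 := L.comb_str₁ _ _ _ _ h
    rw [T.comb₁_iff s a b c ha h1.1.symm h1.2] at h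
    have h2 := (T.proj₁_eq_iff ha).1 h1.1.symm
    have h3 := (T.proj₁_eq_iff ha).1 h1.2
    exact ⟨h2.1, h3.1, h2.2, h3.2, h⟩
  · rintro ⟨h1, h2, h3, h4, h5⟩
    exact (T.comb₁_iff s a b c ha ((T.proj₁_eq_iff ha).2 ⟨h1, h3⟩)
      ((T.proj₁_eq_iff ha).2 ⟨h2, h4⟩)).2 h5

theorem comb₂_iff_coord (s : ℝ) {a b c : A} (ha : S.base a ∈ U) :
    S.str₂.comb s a b c ↔ S.base b = S.base a ∧ S.base c = S.base a ∧
      (T.t.φ b).2.1 = (T.t.φ a).2.1 ∧ (T.t.φ c).2.1 = (T.t.φ a).2.1 ∧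
      (T.t.φ c).1 = s • (T.t.φ a).1 + (1 - s) • (T.t.φ b).1 ∧
      (T.t.φ c).2.2 = s • (T.t.φ a).2.2 + (1 - s) • (T.t.φ b).2.2 := by
  constructor
  · intro h
    have h1 := L.comb_str₂ _ _ _ _ h
    rw [T.comb₂_iff s a b c ha h1.1.symm h1.2] at h
    have h2 := (T.proj₂_eq_iff ha).1 h1.1.symm
    have h3 := (T.proj₂_eq_iff ha).1 h1.2
    exact ⟨h2.1, h3.1, h2.2, h3.2, h⟩
  · rintro ⟨h1, h2, h3, h4, h5⟩
    exact (T.comb₂_iff s a b c ha ((T.proj₂_eq_iff ha).2 ⟨h1, h3⟩)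
      ((T.proj₂_eq_iff ha).2 ⟨h2, h4⟩)).2 h5

/-- The trivialization of the first structure. -/
def str₁ : AffTriv S.str₁ {a₁ | S.base₂.proj a₁ ∈ U} (E₂ × E₃) where
  __ := Triv.side₁ T.t₁.toTriv T.t L.smooth_base₂ T.fst
  comb_iff s a b c ha hb hc := by
    have e := T.comb₁_iff s a b c ha hb hc
    exact ⟨fun h => Prod.ext (e.1 h).1 (e.1 h).2,
      fun h => e.2 ⟨congrArg Prod.fst h, congrArg Prod.snd h⟩⟩

/-- The trivialization of the second structure. -/
def str₂ : AffTriv S.str₂ {a₂ | S.base₁.proj a₂ ∈ U} (E₁ × E₃) where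
  __ := Triv.side₂ T.t₂.toTriv T.t L.smooth_base₁ S.comm T.snd
  comb_iff s a b c ha hb hc := by
    have e := T.comb₂_iff s a b c
      (show S.base₂.proj (S.str₁.proj a) ∈ U from S.comm a ▸ ha) hb hc
    exact ⟨fun h => Prod.ext (e.1 h).1 (e.1 h).2,
      fun h => e.2 ⟨congrArg Prod.fst h, congrArg Prod.snd h⟩⟩

end DoubleAffTriv

/-- The smoothness of the second projection is not among the data: locally it is read off from its
base point and from the coordinate in `E₂`. -/
theorem DoubleAffData.LocallyTrivial.smooth_str₂ {S : DoubleAffData A A₁ A₂ M}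
    (L : S.LocallyTrivial E₁ E₂ E₃) : DSmooth S.str₂.proj := by
  refine dSmooth_of_local fun a => ?_
  obtain ⟨U, hU, ⟨T⟩⟩ := L.exists_triv (S.base a)
  have hb : DSmooth S.base := L.smooth_base₂.comp L.smooth_str₁
  refine ⟨S.base ⁻¹' U, T.t.dOpen.preimage hb, hU, T.t₂.dSmoothOn_of ?_ ?_ ?_⟩
  · intro x hx
    rw [S.comm]
    exact hx
  · simp only [S.comm]
    exact hb.dSmoothOn _
  · exact T.t.smooth.snd.fst.congr fun x hx => T.snd x hx

/-- In coordinates the first structure is affine in `E₂ × E₃` with the `E₁` part fixed, the second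
in `E₁ × E₃` with the `E₂` part fixed. Each axiom is then checked in a single trivialization, as all
points involved lie over one point of `M`. -/
theorem DoubleAffData.LocallyTrivial.isDoubleAffineBundle [FiniteDimensional ℝ E₁]
    [FiniteDimensional ℝ E₂] [FiniteDimensional ℝ E₃] {S : DoubleAffData A A₁ A₂ M}
    (L : S.LocallyTrivial E₁ E₂ E₃) : S.IsDoubleAffineBundle where
  str₁ := AffData.isAffineBundle_of (E := E₂ × E₃) L.smooth_str₁ L.comb_str₁ fun a₁ => by
    obtain ⟨U, hU, ⟨T⟩⟩ := L.exists_triv (S.base₂.proj a₁)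
    exact ⟨_, hU, ⟨T.str₁ L⟩⟩
  str₂ := AffData.isAffineBundle_of (E := E₁ × E₃) L.smooth_str₂ L.comb_str₂ fun a₂ => by
    obtain ⟨U, hU, ⟨T⟩⟩ := L.exists_triv (S.base₁.proj a₂)
    exact ⟨_, hU, ⟨T.str₂ L⟩⟩
  base₁ := AffData.isAffineBundle_of (E := E₂) L.smooth_base₁ L.comb_base₁ fun m => by
    obtain ⟨U, hU, ⟨T⟩⟩ := L.exists_triv m
    exact ⟨_, hU, ⟨T.t₂⟩⟩
  base₂ := AffData.isAffineBundle_of (E := E₁) L.smooth_base₂ L.comb_base₂ fun m => by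
    obtain ⟨U, hU, ⟨T⟩⟩ := L.exists_triv m
    exact ⟨_, hU, ⟨T.t₁⟩⟩
  map₁ s a b c h := by
    obtain ⟨U, hU, ⟨T⟩⟩ := L.exists_triv (S.base a)
    obtain ⟨h1, h2, -, -, h3, -⟩ := (T.comb₂_iff_coord L s hU).1 h
    rw [T.t₁.comb_iff s _ _ _ hU h1 h2, T.fst a hU, T.fst b (h1 ▸ hU), T.fst c (h2 ▸ hU), h3]
  map₂ s a b c h := by
    obtain ⟨U, hU, ⟨T⟩⟩ := L.exists_triv (S.base a)
    obtain ⟨h1, h2, -, -, h3, -⟩ := (T.comb₁_iff_coord L s hU).1 h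
    have hc : ∀ a, S.base₁.proj (S.str₂.proj a) = S.base a := S.comm
    rw [T.t₂.comb_iff s _ _ _ (by rwa [hc]) (by rw [hc, hc, h1]) (by rw [hc, hc, h2]),
      T.snd a hU, T.snd b (h1 ▸ hU), T.snd c (h2 ▸ hU), h3]
  surj a₁ a₂ h := by
    obtain ⟨U, hU, ⟨T⟩⟩ := L.exists_triv (S.base₂.proj a₁)
    -- Any third coordinate would do, since only the two projections are prescribed.
    have hb := T.t.proj_inv _ hU (T.t₁.φ a₁, T.t₂.φ a₂, 0)
    have hr := T.t.right_inv _ hU (T.t₁.φ a₁, T.t₂.φ a₂, 0)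
    have hbU : S.base (T.t.ψ (S.base₂.proj a₁) (T.t₁.φ a₁, T.t₂.φ a₂, 0)) ∈ U := hb.symm ▸ hU
    refine ⟨_, ((T.t₁.ext_iff hU).2 ⟨hb, ?_⟩).symm, ((T.t₂.ext_iff (h ▸ hU)).2 ⟨?_, ?_⟩).symm⟩
    · rw [T.fst _ hbU, hr]
    · rw [S.comm, ← h]
      exact hb
    · rw [T.snd _ hbU, hr]
  interchange s t x₁ x₂ x y₁ y₂ y z₁ z₂ z hx hy hz₁ hz₂ := by
    obtain ⟨U, hU, ⟨T⟩⟩ := L.exists_triv (S.base x₁)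
    obtain ⟨a1, a2, a3, a4, a5, a6⟩ := (T.comb₁_iff_coord L s hU).1 hx
    obtain ⟨c1, c2, c3, c4, c5, c6⟩ := (T.comb₂_iff_coord L t hU).1 hz₁
    obtain ⟨b1, b2, b3, b4, b5, b6⟩ := (T.comb₁_iff_coord L s (c1 ▸ hU)).1 hy
    obtain ⟨d1, d2, d3, d4, d5, d6⟩ := (T.comb₂_iff_coord L t (a1 ▸ hU)).1 hz₂
    rw [T.comb₂_iff_coord L t (a2 ▸ hU), T.comb₁_iff_coord L s (c2 ▸ hU)]
    simp only [a1, a2, a3, a4, a5, a6, b2, b3, b4, b5, b6, c1, c2, c3, c4, c5, c6, d2,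
      d3, d4, d5, d6, true_and]
    -- The `E₁` and `E₂` equations merely trade places. Only the `E₃` component sees both `s` and
    -- `t`, and there the two iterated affine combinations have the same coefficients.
    refine and_congr_right fun _ => ⟨?_, ?_⟩
    · rintro ⟨h2, h3, h4⟩
      refine ⟨h3, h2, ?_⟩
      rw [h4]
      module
    · rintro ⟨h2, h3, h4⟩
      refine ⟨h3, h2, ?_⟩
      rw [h4]
      module

/-! ### Double vector bundles -/

namespace DoubleVecTriv

variable {S : DoubleVecData A A₁ A₂ M} {U : Set M} (T : DoubleVecTriv S U E₁ E₂ E₃)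

theorem proj₁_eq_iff {a b : A} (ha : S.base a ∈ U) :
    S.str₁.proj b = S.str₁.proj a ↔ S.base b = S.base a ∧ (T.t.φ b).1 = (T.t.φ a).1 := by
  rw [eq_comm, T.t₁.ext_iff (show S.base₂.proj (S.str₁.proj a) ∈ U from ha)]
  refine and_congr_right fun h => ?_
  rw [T.fst a ha, T.fst b (show S.base₂.proj (S.str₁.proj b) ∈ U from h ▸ ha)]

variable (L : S.LocallyTrivial E₁ E₂ E₃)
include L

theorem proj₂_eq_iff {a b : A} (ha : S.base a ∈ U) :
    S.str₂.proj b = S.str₂.proj a ↔ S.base b = S.base a ∧ (T.t.φ b).2.1 = (T.t.φ a).2.1 := by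
  have hc : ∀ a, S.base₁.proj (S.str₂.proj a) = S.base a := L.comm
  rw [eq_comm, T.t₂.ext_iff (by rwa [hc]), hc, hc]
  refine and_congr_right fun h => ?_
  rw [T.snd a ha, T.snd b (h ▸ ha)]

theorem add₁_iff_coord {a b c : A} (ha : S.base a ∈ U) :
    S.str₁.add a b c ↔ S.base b = S.base a ∧ S.base c = S.base a ∧
      (T.t.φ b).1 = (T.t.φ a).1 ∧ (T.t.φ c).1 = (T.t.φ a).1 ∧
      (T.t.φ c).2.1 = (T.t.φ a).2.1 + (T.t.φ b).2.1 ∧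
      (T.t.φ c).2.2 = (T.t.φ a).2.2 + (T.t.φ b).2.2 := by
  constructor
  · intro h
    have h1 := L.add_str₁ _ _ _ h
    rw [T.add₁_iff a b c ha h1.1.symm h1.2] at h
    have h2 := (T.proj₁_eq_iff ha).1 h1.1.symm
    have h3 := (T.proj₁_eq_iff ha).1 h1.2
    exact ⟨h2.1, h3.1, h2.2, h3.2, h⟩
  · rintro ⟨h1, h2, h3, h4, h5⟩
    exact (T.add₁_iff a b c ha ((T.proj₁_eq_iff ha).2 ⟨h1, h3⟩)
      ((T.proj₁_eq_iff ha).2 ⟨h2, h4⟩)).2 h5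

theorem add₂_iff_coord {a b c : A} (ha : S.base a ∈ U) :
    S.str₂.add a b c ↔ S.base b = S.base a ∧ S.base c = S.base a ∧
      (T.t.φ b).2.1 = (T.t.φ a).2.1 ∧ (T.t.φ c).2.1 = (T.t.φ a).2.1 ∧
      (T.t.φ c).1 = (T.t.φ a).1 + (T.t.φ b).1 ∧
      (T.t.φ c).2.2 = (T.t.φ a).2.2 + (T.t.φ b).2.2 := by
  constructor
  · intro h
    have h1 := L.add_str₂ _ _ _ h
    rw [T.add₂_iff a b c ha h1.1.symm h1.2] at h
    have h2 := (T.proj₂_eq_iff L ha).1 h1.1.symm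
    have h3 := (T.proj₂_eq_iff L ha).1 h1.2
    exact ⟨h2.1, h3.1, h2.2, h3.2, h⟩
  · rintro ⟨h1, h2, h3, h4, h5⟩
    exact (T.add₂_iff a b c ha ((T.proj₂_eq_iff L ha).2 ⟨h1, h3⟩)
      ((T.proj₂_eq_iff L ha).2 ⟨h2, h4⟩)).2 h5

theorem smul₁_iff_coord (s : ℝ) {a b : A} (ha : S.base a ∈ U) :
    S.str₁.smul s a b ↔ S.base b = S.base a ∧ (T.t.φ b).1 = (T.t.φ a).1 ∧
      (T.t.φ b).2.1 = s • (T.t.φ a).2.1 ∧ (T.t.φ b).2.2 = s • (T.t.φ a).2.2 := by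
  constructor
  · intro h
    have h1 := L.smul_str₁ _ _ _ h
    rw [T.smul₁_iff s a b ha h1] at h
    have h2 := (T.proj₁_eq_iff ha).1 h1
    exact ⟨h2.1, h2.2, h⟩
  · rintro ⟨h1, h3, h5⟩
    exact (T.smul₁_iff s a b ha ((T.proj₁_eq_iff ha).2 ⟨h1, h3⟩)).2 h5

theorem smul₂_iff_coord (s : ℝ) {a b : A} (ha : S.base a ∈ U) :
    S.str₂.smul s a b ↔ S.base b = S.base a ∧ (T.t.φ b).2.1 = (T.t.φ a).2.1 ∧
      (T.t.φ b).1 = s • (T.t.φ a).1 ∧ (T.t.φ b).2.2 = s • (T.t.φ a).2.2 := by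
  constructor
  · intro h
    have h1 := L.smul_str₂ _ _ _ h
    rw [T.smul₂_iff s a b ha h1] at h
    have h2 := (T.proj₂_eq_iff L ha).1 h1
    exact ⟨h2.1, h2.2, h⟩
  · rintro ⟨h1, h3, h5⟩
    exact (T.smul₂_iff s a b ha ((T.proj₂_eq_iff L ha).2 ⟨h1, h3⟩)).2 h5

/-- The trivialization of the first structure. -/
def str₁ : VecTriv S.str₁ {a₁ | S.base₂.proj a₁ ∈ U} (E₂ × E₃) where
  __ := Triv.side₁ T.t₁.toTriv T.t L.smooth_base₂ T.fst
  add_iff a b c ha hb hc := by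
    have e := T.add₁_iff a b c ha hb hc
    exact ⟨fun h => Prod.ext (e.1 h).1 (e.1 h).2,
      fun h => e.2 ⟨congrArg Prod.fst h, congrArg Prod.snd h⟩⟩
  smul_iff s a b ha hb := by
    have e := T.smul₁_iff s a b ha hb
    exact ⟨fun h => Prod.ext (e.1 h).1 (e.1 h).2,
      fun h => e.2 ⟨congrArg Prod.fst h, congrArg Prod.snd h⟩⟩

/-- The trivialization of the second structure. -/
def str₂ : VecTriv S.str₂ {a₂ | S.base₁.proj a₂ ∈ U} (E₁ × E₃) where
  __ := Triv.side₂ T.t₂.toTriv T.t L.smooth_base₁ L.comm T.snd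
  add_iff a b c ha hb hc := by
    have e := T.add₂_iff a b c
      (show S.base₂.proj (S.str₁.proj a) ∈ U from L.comm a ▸ ha) hb hc
    exact ⟨fun h => Prod.ext (e.1 h).1 (e.1 h).2,
      fun h => e.2 ⟨congrArg Prod.fst h, congrArg Prod.snd h⟩⟩
  smul_iff s a b ha hb := by
    have e := T.smul₂_iff s a b
      (show S.base₂.proj (S.str₁.proj a) ∈ U from L.comm a ▸ ha) hb
    exact ⟨fun h => Prod.ext (e.1 h).1 (e.1 h).2,
      fun h => e.2 ⟨congrArg Prod.fst h, congrArg Prod.snd h⟩⟩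

end DoubleVecTriv

theorem DoubleVecData.LocallyTrivial.smooth_str₂ {S : DoubleVecData A A₁ A₂ M}
    (L : S.LocallyTrivial E₁ E₂ E₃) : DSmooth S.str₂.proj := by
  refine dSmooth_of_local fun a => ?_
  obtain ⟨U, hU, ⟨T⟩⟩ := L.exists_triv (S.base a)
  have hb : DSmooth S.base := L.smooth_base₂.comp L.smooth_str₁
  refine ⟨S.base ⁻¹' U, T.t.dOpen.preimage hb, hU, T.t₂.dSmoothOn_of ?_ ?_ ?_⟩
  · intro x hx
    rw [L.comm]
    exact hx
  · simp only [L.comm]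
    exact hb.dSmoothOn _
  · exact T.t.smooth.snd.fst.congr fun x hx => T.snd x hx

/-- The linear counterpart of the affine case: both structures act linearly on the common factor
`E₃`, so the interchange laws are commutativity and distributivity there. -/
theorem DoubleVecData.LocallyTrivial.isDoubleVectorBundle [FiniteDimensional ℝ E₁]
    [FiniteDimensional ℝ E₂] [FiniteDimensional ℝ E₃] {S : DoubleVecData A A₁ A₂ M}
    (L : S.LocallyTrivial E₁ E₂ E₃) : S.IsDoubleVectorBundle where
  str₁ := VecData.isVectorBundle_of (E := E₂ × E₃) L.smooth_str₁ L.add_str₁ L.smul_str₁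
    fun a₁ => by
    obtain ⟨U, hU, ⟨T⟩⟩ := L.exists_triv (S.base₂.proj a₁)
    exact ⟨_, hU, ⟨T.str₁ L⟩⟩
  str₂ := VecData.isVectorBundle_of (E := E₁ × E₃) L.smooth_str₂ L.add_str₂ L.smul_str₂
    fun a₂ => by
    obtain ⟨U, hU, ⟨T⟩⟩ := L.exists_triv (S.base₁.proj a₂)
    exact ⟨_, hU, ⟨T.str₂ L⟩⟩
  base₁ := VecData.isVectorBundle_of (E := E₂) L.smooth_base₁ L.add_base₁ L.smul_base₁ fun m => by
    obtain ⟨U, hU, ⟨T⟩⟩ := L.exists_triv m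
    exact ⟨_, hU, ⟨T.t₂⟩⟩
  base₂ := VecData.isVectorBundle_of (E := E₁) L.smooth_base₂ L.add_base₂ L.smul_base₂ fun m => by
    obtain ⟨U, hU, ⟨T⟩⟩ := L.exists_triv m
    exact ⟨_, hU, ⟨T.t₁⟩⟩
  comm := L.comm
  map_add₁ a b c h := by
    obtain ⟨U, hU, ⟨T⟩⟩ := L.exists_triv (S.base a)
    obtain ⟨h1, h2, -, -, h3, -⟩ := (T.add₂_iff_coord L hU).1 h
    rw [T.t₁.add_iff _ _ _ hU h1 h2, T.fst a hU, T.fst b (h1 ▸ hU), T.fst c (h2 ▸ hU), h3]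
  map_add₂ a b c h := by
    obtain ⟨U, hU, ⟨T⟩⟩ := L.exists_triv (S.base a)
    obtain ⟨h1, h2, -, -, h3, -⟩ := (T.add₁_iff_coord L hU).1 h
    have hc : ∀ a, S.base₁.proj (S.str₂.proj a) = S.base a := L.comm
    rw [T.t₂.add_iff _ _ _ (by rwa [hc]) (by rw [hc, hc, h1]) (by rw [hc, hc, h2]),
      T.snd a hU, T.snd b (h1 ▸ hU), T.snd c (h2 ▸ hU), h3]
  map_smul₁ s a b h := by
    obtain ⟨U, hU, ⟨T⟩⟩ := L.exists_triv (S.base a)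
    obtain ⟨h1, -, h3, -⟩ := (T.smul₂_iff_coord L s hU).1 h
    rw [T.t₁.smul_iff s _ _ hU h1, T.fst a hU, T.fst b (h1 ▸ hU), h3]
  map_smul₂ s a b h := by
    obtain ⟨U, hU, ⟨T⟩⟩ := L.exists_triv (S.base a)
    obtain ⟨h1, -, h3, -⟩ := (T.smul₁_iff_coord L s hU).1 h
    have hc : ∀ a, S.base₁.proj (S.str₂.proj a) = S.base a := L.comm
    rw [T.t₂.smul_iff s _ _ (by rwa [hc]) (by rw [hc, hc, h1]),
      T.snd a hU, T.snd b (h1 ▸ hU), h3]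
  surj a₁ a₂ h := by
    obtain ⟨U, hU, ⟨T⟩⟩ := L.exists_triv (S.base₂.proj a₁)
    have hb := T.t.proj_inv _ hU (T.t₁.φ a₁, T.t₂.φ a₂, 0)
    have hr := T.t.right_inv _ hU (T.t₁.φ a₁, T.t₂.φ a₂, 0)
    have hbU : S.base (T.t.ψ (S.base₂.proj a₁) (T.t₁.φ a₁, T.t₂.φ a₂, 0)) ∈ U := hb.symm ▸ hU
    refine ⟨_, ((T.t₁.ext_iff hU).2 ⟨hb, ?_⟩).symm, ((T.t₂.ext_iff (h ▸ hU)).2 ⟨?_, ?_⟩).symm⟩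
    · rw [T.fst _ hbU, hr]
    · rw [L.comm, ← h]
      exact hb
    · rw [T.snd _ hbU, hr]
  add_add x₁ x₂ x y₁ y₂ y z₁ z₂ z hx hy hz₁ hz₂ := by
    obtain ⟨U, hU, ⟨T⟩⟩ := L.exists_triv (S.base x₁)
    obtain ⟨a1, a2, a3, a4, a5, a6⟩ := (T.add₁_iff_coord L hU).1 hx
    obtain ⟨c1, c2, c3, c4, c5, c6⟩ := (T.add₂_iff_coord L hU).1 hz₁
    obtain ⟨b1, b2, b3, b4, b5, b6⟩ := (T.add₁_iff_coord L (c1 ▸ hU)).1 hy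
    obtain ⟨d1, d2, d3, d4, d5, d6⟩ := (T.add₂_iff_coord L (a1 ▸ hU)).1 hz₂
    rw [T.add₂_iff_coord L (a2 ▸ hU), T.add₁_iff_coord L (c2 ▸ hU)]
    simp only [a1, a2, a3, a4, a5, a6, b2, b3, b4, b5, b6, c1, c2, c3, c4, c5, c6, d2,
      d3, d4, d5, d6, true_and]
    rw [add_add_add_comm]
    tauto
  smul_add₁ t x y z x' y' z' hx hy hz := by
    obtain ⟨U, hU, ⟨T⟩⟩ := L.exists_triv (S.base x)
    obtain ⟨a1, a2, a3, a4⟩ := (T.smul₁_iff_coord L t hU).1 hx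
    obtain ⟨c1, c2, c3, c4, c5, c6⟩ := (T.add₂_iff_coord L hU).1 hz
    obtain ⟨b1, b2, b3, b4⟩ := (T.smul₁_iff_coord L t (c1 ▸ hU)).1 hy
    rw [T.add₂_iff_coord L (a1 ▸ hU), T.smul₁_iff_coord L t (c2 ▸ hU)]
    simp only [a1, a2, a3, a4, b1, b2, b3, b4, c1, c2, c3, c4, c5, c6, true_and, smul_add]
    tauto
  smul_add₂ t x y z x' y' z' hx hy hz := by
    obtain ⟨U, hU, ⟨T⟩⟩ := L.exists_triv (S.base x)
    obtain ⟨a1, a2, a3, a4⟩ := (T.smul₂_iff_coord L t hU).1 hx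
    obtain ⟨c1, c2, c3, c4, c5, c6⟩ := (T.add₁_iff_coord L hU).1 hz
    obtain ⟨b1, b2, b3, b4⟩ := (T.smul₂_iff_coord L t (c1 ▸ hU)).1 hy
    rw [T.add₁_iff_coord L (a1 ▸ hU), T.smul₂_iff_coord L t (c2 ▸ hU)]
    simp only [a1, a2, a3, a4, b1, b2, b3, b4, c1, c2, c3, c4, c5, c6, true_and, smul_add]
    tauto
  smul_smul s t x y z w hy hz := by
    obtain ⟨U, hU, ⟨T⟩⟩ := L.exists_triv (S.base x)
    obtain ⟨a1, a2, a3, a4⟩ := (T.smul₁_iff_coord L s hU).1 hy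
    obtain ⟨b1, b2, b3, b4⟩ := (T.smul₂_iff_coord L t hU).1 hz
    rw [T.smul₂_iff_coord L t (a1 ▸ hU), T.smul₁_iff_coord L s (b1 ▸ hU)]
    simp only [a1, a2, a3, a4, b1, b2, b3, b4, smul_comm t s]
    tauto

end

/-! ## The model double vector bundle of a locally trivial double affine bundle -/

section

variable {E₁ : Type*} [NormedAddCommGroup E₁] [NormedSpace ℝ E₁]
  [DiffeologicalSpace E₁] [IsContDiffCompatible E₁]
  {E₂ : Type*} [NormedAddCommGroup E₂] [NormedSpace ℝ E₂]
  [DiffeologicalSpace E₂] [IsContDiffCompatible E₂]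
  {E₃ : Type*} [NormedAddCommGroup E₃] [NormedSpace ℝ E₃]
  [DiffeologicalSpace E₃] [IsContDiffCompatible E₃]
  {A A₁ A₂ M : Type*} [DiffeologicalSpace A]
  [DiffeologicalSpace A₁] [DiffeologicalSpace A₂] [DiffeologicalSpace M]
  {S : DoubleAffData A A₁ A₂ M} {U : Set M}

/-! ### Coordinates on the first model bundle `𝒱₁(A)` -/

namespace DoubleAffData

variable (S)

/-- The projection `𝒱₁(A) → M`. -/
def baseModel₁ (X : S.str₁.Model) : M := S.base₂.proj (S.str₁.model.proj X)

variable {S}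

theorem base_proj_linearPart₂' (X : S.str₁.Model) :
    S.base₁.model.proj (S.linearPart₂ X) = S.baseModel₁ X := S.base_proj_linearPart₂ X

theorem isVec_baseModel₁ {a b : A} {X : S.str₁.Model} (h : S.str₁.IsVec a b X) :
    S.base b = S.base a ∧ S.baseModel₁ X = S.base a :=
  ⟨congrArg S.base₂.proj h.proj.1.symm, congrArg S.base₂.proj h.proj.2⟩

theorem modelDouble_comm (P : S.VV) :
    S.modelDouble.base₁.proj (S.modelDouble.str₂.proj P) =
      S.modelDouble.base₂.proj (S.modelDouble.str₁.proj P) := by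
  have h := (AffData.isVec_out (S := S.modelAff) P).proj
  change S.base₁.model.proj (S.modelAff.model.proj P) = S.baseModel₁ (Quot.out P).1.1
  rw [h.2]
  exact S.base_proj_linearPart₂ _

end DoubleAffData

namespace DoubleAffTriv

variable (T : DoubleAffTriv S U E₁ E₂ E₃) (L : S.LocallyTrivial E₁ E₂ E₃)

/-- The trivialization of `𝒱(A₂) → M`. -/
def modelBase₁ : VecTriv S.base₁.model U E₂ := T.t₂.model L.comb_base₁

/-- The trivialization of `𝒱(A₁) → M`. -/
def modelBase₂ : VecTriv S.base₂.model U E₁ := T.t₁.model L.comb_base₂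

/-- The trivialization of `𝒱₁(A) → A₁`. -/
def modelStr₁ : VecTriv S.str₁.model {a₁ | S.base₂.proj a₁ ∈ U} (E₂ × E₃) :=
  (T.str₁ L).model L.comb_str₁

/-- The trivialization of `𝒱₁(A) → M`. -/
def modelTotal₁ : Triv S.baseModel₁ U (E₁ × E₂ × E₃) :=
  Triv.total (π₁ := S.str₁.model.proj) (ρ := S.base₂.proj) T.t₁.toTriv (T.modelStr₁ L).toTriv (AffData.dSmooth_model_proj L.smooth_str₁)

/-- The first model bundle keeps the `E₁` coordinate, which is the same at both ends, and subtracts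
the other two. With this, representatives can be chosen and compared freely. -/
theorem isVec₁_iff {a b : A} {X : S.str₁.Model} (ha : S.base a ∈ U) :
    S.str₁.IsVec a b X ↔ S.base b = S.base a ∧ S.baseModel₁ X = S.base a ∧
      (T.t.φ b).1 = (T.t.φ a).1 ∧ ((T.modelTotal₁ L).φ X).1 = (T.t.φ a).1 ∧
      ((T.modelTotal₁ L).φ X).2.1 = (T.t.φ b).2.1 - (T.t.φ a).2.1 ∧
      ((T.modelTotal₁ L).φ X).2.2 = (T.t.φ b).2.2 - (T.t.φ a).2.2 := by
  have key : ∀ h1 : S.str₁.proj a = S.str₁.proj b, ∀ h2 : S.str₁.model.proj X = S.str₁.proj a,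
      (S.str₁.IsVec a b X ↔ ((T.modelTotal₁ L).φ X).2.1 = (T.t.φ b).2.1 - (T.t.φ a).2.1 ∧
      ((T.modelTotal₁ L).φ X).2.2 = (T.t.φ b).2.2 - (T.t.φ a).2.2) := by
    intro h1 h2
    rw [(T.str₁ L).isVec_iff L.comb_str₁ ha h1 h2]
    exact ⟨fun h => ⟨congrArg Prod.fst h, congrArg Prod.snd h⟩, fun h => Prod.ext h.1 h.2⟩
  have hX : ((T.modelTotal₁ L).φ X).1 = T.t₁.φ (S.str₁.model.proj X) := rfl
  constructor
  · intro h
    obtain ⟨h1, h2⟩ := h.proj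
    have h3 := (T.proj₁_eq_iff ha).1 h1.symm
    refine ⟨h3.1, congrArg S.base₂.proj h2, h3.2, ?_, (key h1 h2).1 h⟩
    rw [hX, h2]
    exact T.fst a ha
  · rintro ⟨h1, h2, h3, h4, h5⟩
    refine (key ((T.proj₁_eq_iff ha).2 ⟨h1, h3⟩).symm ?_).2 h5
    refine ((T.t₁.ext_iff ha).2 ⟨h2, ?_⟩).symm
    rw [← hX, h4]
    exact (T.fst a ha).symm

/-- `linearPart₂` is defined through a chosen representative; its coordinate is a difference that
depends on the class alone. This settles the independence of the choice. -/
theorem modelBase₁_φ (X : S.str₁.Model) (hX : S.baseModel₁ X ∈ U) :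
    (T.modelBase₁ L).φ (S.linearPart₂ X) = ((T.modelTotal₁ L).φ X).2.1 := by
  have h := AffData.isVec_out X
  obtain ⟨h1, h2⟩ := S.isVec_baseModel₁ h
  have ha : S.base (Quot.out X).1.1 ∈ U := h2 ▸ hX
  have hc : ∀ a, S.base₁.proj (S.str₂.proj a) = S.base a := S.comm
  rw [((T.isVec₁_iff L ha).1 h).2.2.2.2.1, ← T.snd _ ha, ← T.snd _ (h1 ▸ ha)]
  exact T.t₂.model_φ_eq L.comb_base₁ ⟨_, rfl⟩ (by rwa [hc])

theorem modelProj₁_eq_iff {X Y : S.str₁.Model} (hX : S.baseModel₁ X ∈ U) :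
    S.str₁.model.proj Y = S.str₁.model.proj X ↔ S.baseModel₁ Y = S.baseModel₁ X ∧
      ((T.modelTotal₁ L).φ Y).1 = ((T.modelTotal₁ L).φ X).1 := by
  rw [eq_comm]
  exact T.t₁.ext_iff hX

theorem linearPart₂_eq_iff {X Y : S.str₁.Model} (hX : S.baseModel₁ X ∈ U) :
    S.linearPart₂ Y = S.linearPart₂ X ↔ S.baseModel₁ Y = S.baseModel₁ X ∧
      ((T.modelTotal₁ L).φ Y).2.1 = ((T.modelTotal₁ L).φ X).2.1 := by
  have hc := S.base_proj_linearPart₂'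
  rw [eq_comm, (T.modelBase₁ L).ext_iff (by rwa [hc]), hc, hc]
  refine and_congr_right fun h => ?_
  rw [T.modelBase₁_φ L X hX, T.modelBase₁_φ L Y (h ▸ hX)]

theorem modelAdd₁_iff {X Y Z : S.str₁.Model} (hX : S.baseModel₁ X ∈ U) :
    S.str₁.model.add X Y Z ↔ S.baseModel₁ Y = S.baseModel₁ X ∧ S.baseModel₁ Z = S.baseModel₁ X ∧
      ((T.modelTotal₁ L).φ Y).1 = ((T.modelTotal₁ L).φ X).1 ∧
      ((T.modelTotal₁ L).φ Z).1 = ((T.modelTotal₁ L).φ X).1 ∧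
      ((T.modelTotal₁ L).φ Z).2 = ((T.modelTotal₁ L).φ X).2 + ((T.modelTotal₁ L).φ Y).2 := by
  constructor
  · intro h
    obtain ⟨h1, h2⟩ := AffData.model_add_proj _ _ _ h
    have h3 := (T.modelProj₁_eq_iff L hX).1 h1.symm
    have h4 := (T.modelProj₁_eq_iff L hX).1 h2
    exact ⟨h3.1, h4.1, h3.2, h4.2, ((T.modelStr₁ L).add_iff _ _ _ hX h1.symm h2).1 h⟩
  · rintro ⟨h1, h2, h3, h4, h5⟩
    exact ((T.modelStr₁ L).add_iff _ _ _ hX ((T.modelProj₁_eq_iff L hX).2 ⟨h1, h3⟩)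
      ((T.modelProj₁_eq_iff L hX).2 ⟨h2, h4⟩)).2 h5

theorem modelSmul₁_iff (t : ℝ) {X Y : S.str₁.Model} (hX : S.baseModel₁ X ∈ U) :
    S.str₁.model.smul t X Y ↔ S.baseModel₁ Y = S.baseModel₁ X ∧
      ((T.modelTotal₁ L).φ Y).1 = ((T.modelTotal₁ L).φ X).1 ∧
      ((T.modelTotal₁ L).φ Y).2 = t • ((T.modelTotal₁ L).φ X).2 := by
  constructor
  · intro h
    have h1 := AffData.model_smul_proj _ _ _ h
    have h3 := (T.modelProj₁_eq_iff L hX).1 h1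
    exact ⟨h3.1, h3.2, ((T.modelStr₁ L).smul_iff _ _ _ hX h1).1 h⟩
  · rintro ⟨h1, h3, h5⟩
    exact ((T.modelStr₁ L).smul_iff _ _ _ hX ((T.modelProj₁_eq_iff L hX).2 ⟨h1, h3⟩)).2 h5

end DoubleAffTriv

namespace DoubleAffData.LocallyTrivial

theorem smooth_baseModel₁ (L : S.LocallyTrivial E₁ E₂ E₃) : DSmooth S.baseModel₁ :=
  L.smooth_base₂.comp (AffData.dSmooth_model_proj L.smooth_str₁)

theorem smooth_linearPart₂ (L : S.LocallyTrivial E₁ E₂ E₃) : DSmooth S.linearPart₂ := by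
  refine dSmooth_of_local fun X => ?_
  obtain ⟨U, hU, ⟨T⟩⟩ := L.exists_triv (S.baseModel₁ X)
  refine ⟨S.baseModel₁ ⁻¹' U, T.t.dOpen.preimage L.smooth_baseModel₁, hU,
    (T.modelBase₁ L).dSmoothOn_of ?_ ?_ ?_⟩
  · intro x hx
    rw [S.base_proj_linearPart₂']
    exact hx
  · simp only [S.base_proj_linearPart₂']
    exact L.smooth_baseModel₁.dSmoothOn _
  · exact (T.modelTotal₁ L).smooth.snd.fst.congr fun x hx => T.modelBase₁_φ L x hx

/-- The definition of `modelAff.comb` prescribes no fibre directly. The ends of the representatives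
have equal images in `A₂`, so the `E₂` differences agree. This is what is needed to form the model
bundle of `modelAff` in coordinates. -/
theorem comb_modelAff (L : S.LocallyTrivial E₁ E₂ E₃) (t : ℝ) (X Y Z : S.str₁.Model)
    (h : S.modelAff.comb t X Y Z) :
    S.modelAff.proj X = S.modelAff.proj Y ∧ S.modelAff.proj Z = S.modelAff.proj X := by
  obtain ⟨a, b, a', b', c, d, hX, hY, ha, hb, hc, hd, hZ⟩ := h
  obtain ⟨U, hU, ⟨T⟩⟩ := L.exists_triv (S.base a)
  have e1 := (T.proj₂_eq_iff hU).1 ha.symm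
  have e2 := (T.proj₂_eq_iff hU).1 (L.comb_str₂ _ _ _ _ hc).2
  have hbU : S.base b ∈ U := (S.isVec_baseModel₁ hX).1 ▸ hU
  have e3 := (T.proj₂_eq_iff hbU).1 hb.symm
  have e4 := (T.proj₂_eq_iff hbU).1 (L.comb_str₂ _ _ _ _ hd).2
  have f1 := (T.isVec₁_iff L hU).1 hX
  have f2 := (T.isVec₁_iff L (e1.1 ▸ hU)).1 hY
  have f3 := (T.isVec₁_iff L (e2.1 ▸ hU)).1 hZ
  have hXU : S.baseModel₁ X ∈ U := f1.2.1 ▸ hU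
  constructor
  · refine ((T.linearPart₂_eq_iff L hXU).2 ⟨?_, ?_⟩).symm
    · rw [f1.2.1, f2.2.1, e1.1]
    · rw [f1.2.2.2.2.1, f2.2.2.2.2.1, e1.2, e3.2]
  · refine (T.linearPart₂_eq_iff L hXU).2 ⟨?_, ?_⟩
    · rw [f1.2.1, f3.2.1, e2.1]
    · rw [f1.2.2.2.2.1, f3.2.2.2.2.1, e2.2, e4.2]

end DoubleAffData.LocallyTrivial

namespace DoubleAffTriv

variable (T : DoubleAffTriv S U E₁ E₂ E₃) (L : S.LocallyTrivial E₁ E₂ E₃)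

/-- The trivialization of the affine bundle `𝒱₁(A) → 𝒱(A₂)`. -/
def modelAff : AffTriv S.modelAff {Y | S.base₁.model.proj Y ∈ U} (E₁ × E₃) where
  __ := Triv.side₂ (T.modelBase₁ L).toTriv (T.modelTotal₁ L)
    (AffData.dSmooth_model_proj L.smooth_base₁) S.base_proj_linearPart₂' (T.modelBase₁_φ L)
  comb_iff t X Y Z hX hY hZ := by
    change ((S.modelAff.comb t X Y Z) ↔ (((T.modelTotal₁ L).φ Z).1, ((T.modelTotal₁ L).φ Z).2.2) =
      t • (((T.modelTotal₁ L).φ X).1, ((T.modelTotal₁ L).φ X).2.2) +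
      (1 - t) • (((T.modelTotal₁ L).φ Y).1, ((T.modelTotal₁ L).φ Y).2.2))
    replace hX : S.baseModel₁ X ∈ U := S.base_proj_linearPart₂' X ▸ hX
    obtain ⟨g1, g2⟩ := (T.linearPart₂_eq_iff L hX).1 hY
    obtain ⟨g3, g4⟩ := (T.linearPart₂_eq_iff L hX).1 hZ
    constructor
    · rintro ⟨a, b, a', b', c, d, hXa, hYa, ha, hb, hc, hd, hZa⟩
      have hU : S.base a ∈ U := (S.isVec_baseModel₁ hXa).2 ▸ hX
      have hbU : S.base b ∈ U := (S.isVec_baseModel₁ hXa).1 ▸ hU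
      have e1 := (T.proj₂_eq_iff hU).1 ha.symm
      have e2 := (T.comb₂_iff_coord L t hU).1 hc
      have e4 := (T.comb₂_iff_coord L t hbU).1 hd
      have f1 := (T.isVec₁_iff L hU).1 hXa
      have f2 := (T.isVec₁_iff L (e1.1 ▸ hU)).1 hYa
      have f3 := (T.isVec₁_iff L (e2.2.1 ▸ hU)).1 hZa
      refine Prod.ext ?_ ?_
      · change _ = t • _ + (1 - t) • _
        dsimp only
        rw [f1.2.2.2.1, f2.2.2.2.1, f3.2.2.2.1, e2.2.2.2.2.1]
      · change _ = t • _ + (1 - t) • _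
        dsimp only
        rw [f1.2.2.2.2.2, f2.2.2.2.2.2, f3.2.2.2.2.2, e2.2.2.2.2.2, e4.2.2.2.2.2]
        module
    · intro h
      have h1 : ((T.modelTotal₁ L).φ Z).1 = t • ((T.modelTotal₁ L).φ X).1 +
        (1 - t) • ((T.modelTotal₁ L).φ Y).1 := congrArg Prod.fst h
      have h2 : ((T.modelTotal₁ L).φ Z).2.2 = t • ((T.modelTotal₁ L).φ X).2.2 +
        (1 - t) • ((T.modelTotal₁ L).φ Y).2.2 := congrArg Prod.snd h
      have hp := T.t.proj_inv _ hX
      have hr := T.t.right_inv _ hX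
      -- Each class is drawn from the point with vanishing `E₂` and `E₃` coordinates, so that its
      -- end has the coordinates of the class itself. The starting points share the `E₂` coordinate
      -- `0`, the ends share that of `X`, as the second structure requires.
      refine ⟨T.t.ψ (S.baseModel₁ X) (((T.modelTotal₁ L).φ X).1, 0, 0),
        T.t.ψ (S.baseModel₁ X) ((T.modelTotal₁ L).φ X),
        T.t.ψ (S.baseModel₁ X) (((T.modelTotal₁ L).φ Y).1, 0, 0),
        T.t.ψ (S.baseModel₁ X) ((T.modelTotal₁ L).φ Y),
        T.t.ψ (S.baseModel₁ X) (((T.modelTotal₁ L).φ Z).1, 0, 0),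
        T.t.ψ (S.baseModel₁ X) ((T.modelTotal₁ L).φ Z), ?_, ?_, ?_, ?_, ?_, ?_, ?_⟩
      · rw [T.isVec₁_iff L (by rwa [hp])]
        simp [hp, hr]
      · rw [T.isVec₁_iff L (by rwa [hp])]
        simp [hp, hr, g1]
      · rw [T.proj₂_eq_iff (by rwa [hp])]
        simp [hp, hr]
      · rw [T.proj₂_eq_iff (by rwa [hp])]
        simp [hp, hr, g2]
      · rw [T.comb₂_iff_coord L t (by rwa [hp])]
        simp [hp, hr, h1]
      · rw [T.comb₂_iff_coord L t (by rwa [hp])]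
        simp [hp, hr, h1, h2, g2, g4]
      · rw [T.isVec₁_iff L (by rwa [hp])]
        simp [hp, hr, g3]

/-- The trivialization of `𝒱₂𝒱₁(A) → M`. -/
def modelTotal : Triv S.modelDouble.base U (E₁ × E₂ × E₃) :=
  -- The iterated trivialization goes through `𝒱(A₂)` and lists the `E₂` coordinate first; the
  -- exchange restores the order `E₁ × E₂ × E₃`.
  (Triv.total (π₁ := S.modelAff.model.proj) (ρ := S.base₁.model.proj) (T.modelBase₁ L).toTriv ((T.modelAff L).model L.comb_modelAff).toTriv
    (AffData.dSmooth_model_proj L.smooth_linearPart₂)).map Triv.swap Triv.dSmooth_swap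
    Triv.dSmooth_swap fun P => (S.modelDouble_comm P).symm

/-- The second model step keeps the `E₂` coordinate and subtracts the other two. Together with
`isVec₁_iff` the `E₃` coordinate becomes a double difference, while `E₁` and `E₂` carry single
differences. -/
theorem isVec₂_iff {X Y : S.str₁.Model} {P : S.VV} (hX : S.baseModel₁ X ∈ U) :
    S.modelAff.IsVec X Y P ↔ S.baseModel₁ Y = S.baseModel₁ X ∧
      S.modelDouble.base P = S.baseModel₁ X ∧
      ((T.modelTotal₁ L).φ Y).2.1 = ((T.modelTotal₁ L).φ X).2.1 ∧
      ((T.modelTotal L).φ P).2.1 = ((T.modelTotal₁ L).φ X).2.1 ∧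
      ((T.modelTotal L).φ P).1 = ((T.modelTotal₁ L).φ Y).1 - ((T.modelTotal₁ L).φ X).1 ∧
      ((T.modelTotal L).φ P).2.2 =
        ((T.modelTotal₁ L).φ Y).2.2 - ((T.modelTotal₁ L).φ X).2.2 := by
  have hXU : S.base₁.model.proj (S.linearPart₂ X) ∈ U := (S.base_proj_linearPart₂' X).symm ▸ hX
  have hP : S.base₁.model.proj (S.modelAff.model.proj P) = S.modelDouble.base P :=
    S.modelDouble_comm P
  have hP2 : ((T.modelTotal L).φ P).2.1 = (T.modelBase₁ L).φ (S.modelAff.model.proj P) := rfl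
  have key : ∀ h1 : S.linearPart₂ X = S.linearPart₂ Y,
      ∀ h2 : S.modelAff.model.proj P = S.linearPart₂ X,
      (S.modelAff.IsVec X Y P ↔
      ((T.modelTotal L).φ P).1 = ((T.modelTotal₁ L).φ Y).1 - ((T.modelTotal₁ L).φ X).1 ∧
      ((T.modelTotal L).φ P).2.2 =
        ((T.modelTotal₁ L).φ Y).2.2 - ((T.modelTotal₁ L).φ X).2.2) := by
    intro h1 h2
    rw [(T.modelAff L).isVec_iff L.comb_modelAff hXU h1 h2]
    exact ⟨fun h => ⟨congrArg Prod.fst h, congrArg Prod.snd h⟩, fun h => Prod.ext h.1 h.2⟩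
  constructor
  · intro h
    obtain ⟨h1, h2⟩ := h.proj
    have h3 := (T.linearPart₂_eq_iff L hX).1 h1.symm
    refine ⟨h3.1, ?_, h3.2, ?_, (key h1 h2).1 h⟩
    · rw [← hP, h2]
      exact S.base_proj_linearPart₂' X
    · rw [hP2, h2]
      exact T.modelBase₁_φ L X hX
  · rintro ⟨h1, h2, h3, h4, h5⟩
    refine (key ((T.linearPart₂_eq_iff L hX).2 ⟨h1, h3⟩).symm ?_).2 h5
    refine (((T.modelBase₁ L).ext_iff hXU).2 ⟨?_, ?_⟩).symm
    · rw [hP, h2, S.base_proj_linearPart₂']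
    · rw [← hP2, h4, T.modelBase₁_φ L X hX]

theorem modelBase₂_φ (P : S.VV) (hP : S.modelDouble.base P ∈ U) :
    (T.modelBase₂ L).φ (S.linearPart₁ P) = ((T.modelTotal L).φ P).1 := by
  have h := AffData.isVec_out (S := S.modelAff) P
  have ha : S.baseModel₁ (Quot.out P).1.1 ∈ U := hP
  rw [((T.isVec₂_iff L ha).1 h).2.2.2.2.1]
  exact T.t₁.model_φ_eq L.comb_base₂ ⟨_, rfl⟩ ha

end DoubleAffTriv

namespace DoubleAffData.LocallyTrivial

/-- The `E₁` coordinate of `P` is the difference of those of any two representatives, so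
`linearPart₁`, defined by a choice, can be computed from every representative. -/
theorem isVec_linearPart₁ (L : S.LocallyTrivial E₁ E₂ E₃) {X Y : S.str₁.Model} {P : S.VV}
    (h : S.modelAff.IsVec X Y P) :
    S.base₂.IsVec (S.str₁.model.proj X) (S.str₁.model.proj Y) (S.linearPart₁ P) := by
  obtain ⟨U, hU, ⟨T⟩⟩ := L.exists_triv (S.baseModel₁ X)
  have e := (T.isVec₂_iff L hU).1 h
  refine (T.t₁.isVec_iff L.comb_base₂ hU e.1.symm e.2.1).2 ?_
  exact (T.modelBase₂_φ L P (e.2.1 ▸ hU)).trans e.2.2.2.2.1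

theorem smooth_modelDouble_base (L : S.LocallyTrivial E₁ E₂ E₃) : DSmooth S.modelDouble.base := by
  have : S.modelDouble.base =
      fun P => S.modelDouble.base₁.proj (S.modelDouble.str₂.proj P) :=
    funext fun P => (S.modelDouble_comm P).symm
  rw [this]
  exact (AffData.dSmooth_model_proj L.smooth_base₁).comp
    (AffData.dSmooth_model_proj L.smooth_linearPart₂)

theorem smooth_linearPart₁ (L : S.LocallyTrivial E₁ E₂ E₃) : DSmooth S.linearPart₁ := by
  refine dSmooth_of_local fun P => ?_
  obtain ⟨U, hU, ⟨T⟩⟩ := L.exists_triv (S.modelDouble.base P)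
  refine ⟨S.modelDouble.base ⁻¹' U, T.t.dOpen.preimage L.smooth_modelDouble_base, hU,
    (T.modelBase₂ L).dSmoothOn_of (fun x hx => hx) (L.smooth_modelDouble_base.dSmoothOn _) ?_⟩
  exact (T.modelTotal L).smooth.fst.congr fun x hx => T.modelBase₂_φ L x hx

end DoubleAffData.LocallyTrivial

/-- The trivialization of the model double vector bundle. -/
def DoubleAffTriv.modelDouble (T : DoubleAffTriv S U E₁ E₂ E₃) (L : S.LocallyTrivial E₁ E₂ E₃) :
    DoubleVecTriv S.modelDouble U E₁ E₂ E₃ where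
  t₁ := T.modelBase₂ L
  t₂ := T.modelBase₁ L
  t := T.modelTotal L
  fst := T.modelBase₂_φ L
  snd _ _ := rfl
  add₁_iff P Q R hP hQ hR := by
    have bQ : S.modelDouble.base Q = S.modelDouble.base P := congrArg S.base₂.model.proj hQ
    have bR : S.modelDouble.base R = S.modelDouble.base P := congrArg S.base₂.model.proj hR
    have eQ : ((T.modelTotal L).φ Q).1 = ((T.modelTotal L).φ P).1 := by
      rw [← T.modelBase₂_φ L P hP, ← T.modelBase₂_φ L Q (bQ ▸ hP)]
      exact congrArg _ hQ
    have eR : ((T.modelTotal L).φ R).1 = ((T.modelTotal L).φ P).1 := by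
      rw [← T.modelBase₂_φ L P hP, ← T.modelBase₂_φ L R (bR ▸ hP)]
      exact congrArg _ hR
    constructor
    · rintro ⟨X, Y, X', Y', X'', Y'', hXY, hXY', hX, hY, hXY''⟩
      have hU : S.baseModel₁ X ∈ U := by
        rw [← S.base_proj_linearPart₂', show S.linearPart₂ X = S.modelAff.proj X from rfl,
          ← hXY.proj.2]
        exact (S.modelDouble_comm P).symm ▸ hP
      have f1 := (T.isVec₂_iff L hU).1 hXY
      have e1 := (T.modelAdd₁_iff L hU).1 hX
      have e2 := (T.modelAdd₁_iff L (f1.1 ▸ hU)).1 hY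
      have f2 := (T.isVec₂_iff L (e1.1 ▸ hU)).1 hXY'
      have f3 := (T.isVec₂_iff L (e1.2.1 ▸ hU)).1 hXY''
      refine ⟨?_, ?_⟩
      · rw [f1.2.2.2.1, f2.2.2.2.1, f3.2.2.2.1, e1.2.2.2.2]
        rfl
      · rw [f1.2.2.2.2.2, f2.2.2.2.2.2, f3.2.2.2.2.2, e1.2.2.2.2, e2.2.2.2.2, Prod.snd_add,
          Prod.snd_add]
        abel
    · rintro ⟨h1, h2⟩
      set m := S.modelDouble.base P with hm
      have hp := (T.modelTotal₁ L).proj_inv m hP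
      have hr := (T.modelTotal₁ L).right_inv m hP
      -- Each class starts at the element with vanishing `E₁` and `E₃` coordinates and the same `E₂`
      -- coordinate; the end then has exactly the coordinates of the class.
      refine ⟨(T.modelTotal₁ L).ψ m (0, ((T.modelTotal L).φ P).2.1, 0),
        (T.modelTotal₁ L).ψ m ((T.modelTotal L).φ P),
        (T.modelTotal₁ L).ψ m (0, ((T.modelTotal L).φ Q).2.1, 0),
        (T.modelTotal₁ L).ψ m ((T.modelTotal L).φ Q),
        (T.modelTotal₁ L).ψ m (0, ((T.modelTotal L).φ R).2.1, 0),
        (T.modelTotal₁ L).ψ m ((T.modelTotal L).φ R), ?_, ?_, ?_, ?_, ?_⟩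
      · rw [T.isVec₂_iff L (by rwa [hp])]
        simp [hp, hr, ← hm]
      · rw [T.isVec₂_iff L (by rwa [hp])]
        simp [hp, hr, bQ]
      · rw [T.modelAdd₁_iff L (by rwa [hp])]
        simp [hp, hr, h1]
      · rw [T.modelAdd₁_iff L (by rwa [hp])]
        simp [hp, hr, eQ, eR, Prod.ext_iff, h1, h2]
      · rw [T.isVec₂_iff L (by rwa [hp])]
        simp [hp, hr, bR]
  smul₁_iff t P Q hP hQ := by
    have bQ : S.modelDouble.base Q = S.modelDouble.base P := congrArg S.base₂.model.proj hQ
    have eQ : ((T.modelTotal L).φ Q).1 = ((T.modelTotal L).φ P).1 := by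
      rw [← T.modelBase₂_φ L P hP, ← T.modelBase₂_φ L Q (bQ ▸ hP)]
      exact congrArg _ hQ
    constructor
    · rintro ⟨X, Y, X', Y', hXY, hX, hY, hXY'⟩
      have hU : S.baseModel₁ X ∈ U := by
        rw [← S.base_proj_linearPart₂', show S.linearPart₂ X = S.modelAff.proj X from rfl,
          ← hXY.proj.2]
        exact (S.modelDouble_comm P).symm ▸ hP
      have f1 := (T.isVec₂_iff L hU).1 hXY
      have e1 := (T.modelSmul₁_iff L t hU).1 hX
      have e2 := (T.modelSmul₁_iff L t (f1.1 ▸ hU)).1 hY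
      have f2 := (T.isVec₂_iff L (e1.1 ▸ hU)).1 hXY'
      refine ⟨?_, ?_⟩
      · rw [f1.2.2.2.1, f2.2.2.2.1, e1.2.2]
        rfl
      · rw [f1.2.2.2.2.2, f2.2.2.2.2.2, e1.2.2, e2.2.2, Prod.smul_snd, Prod.smul_snd, smul_sub]
    · rintro ⟨h1, h2⟩
      set m := S.modelDouble.base P with hm
      have hp := (T.modelTotal₁ L).proj_inv m hP
      have hr := (T.modelTotal₁ L).right_inv m hP
      refine ⟨(T.modelTotal₁ L).ψ m (0, ((T.modelTotal L).φ P).2.1, 0),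
        (T.modelTotal₁ L).ψ m ((T.modelTotal L).φ P),
        (T.modelTotal₁ L).ψ m (0, ((T.modelTotal L).φ Q).2.1, 0),
        (T.modelTotal₁ L).ψ m ((T.modelTotal L).φ Q), ?_, ?_, ?_, ?_⟩
      · rw [T.isVec₂_iff L (by rwa [hp])]
        simp [hp, hr, ← hm]
      · rw [T.modelSmul₁_iff L t (by rwa [hp])]
        simp [hp, hr, h1]
      · rw [T.modelSmul₁_iff L t (by rwa [hp])]
        simp [hp, hr, eQ, Prod.ext_iff, h1, h2]
      · rw [T.isVec₂_iff L (by rwa [hp])]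
        simp [hp, hr, bQ]
  add₂_iff P Q R hP hQ hR := by
    have hU : S.base₁.model.proj (S.modelAff.model.proj P) ∈ U := (S.modelDouble_comm P).symm ▸ hP
    have e := ((T.modelAff L).model L.comb_modelAff).add_iff P Q R hU hQ hR
    exact e.trans ⟨fun h => ⟨congrArg Prod.fst h, congrArg Prod.snd h⟩,
      fun h => Prod.ext h.1 h.2⟩
  smul₂_iff t P Q hP hQ := by
    have hU : S.base₁.model.proj (S.modelAff.model.proj P) ∈ U := (S.modelDouble_comm P).symm ▸ hP
    have e := ((T.modelAff L).model L.comb_modelAff).smul_iff t P Q hU hQ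
    exact e.trans ⟨fun h => ⟨congrArg Prod.fst h, congrArg Prod.snd h⟩,
      fun h => Prod.ext h.1 h.2⟩

/-- Differences of coordinates trivialize the model over the same sets and with the same fibres, so
the model inherits local triviality and hence all axioms of a double vector bundle. -/
theorem DoubleAffData.LocallyTrivial.modelDouble (L : S.LocallyTrivial E₁ E₂ E₃) :
    S.modelDouble.LocallyTrivial E₁ E₂ E₃ where
  comm := S.modelDouble_comm
  smooth_str₁ := L.smooth_linearPart₁
  smooth_base₁ := AffData.dSmooth_model_proj L.smooth_base₁
  smooth_base₂ := AffData.dSmooth_model_proj L.smooth_base₂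
  add_str₁ P Q R := by
    rintro ⟨X, Y, X', Y', X'', Y'', hXY, hXY', hX, hY, hXY''⟩
    obtain ⟨a1, a2⟩ := AffData.model_add_proj _ _ _ hX
    obtain ⟨b1, b2⟩ := AffData.model_add_proj _ _ _ hY
    obtain ⟨_, h⟩ := L.isVec_linearPart₁ hXY
    have h' := L.isVec_linearPart₁ hXY'
    have h'' := L.isVec_linearPart₁ hXY''
    rw [← a1, ← b1] at h'
    rw [a2, b2] at h''
    exact ⟨h.trans h'.2.symm, h''.2.trans h.symm⟩
  add_str₂ := AffData.model_add_proj
  add_base₁ := AffData.model_add_proj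
  add_base₂ := AffData.model_add_proj
  smul_str₁ t P Q := by
    rintro ⟨X, Y, X', Y', hXY, hX, hY, hXY'⟩
    have h := L.isVec_linearPart₁ hXY
    have h' := L.isVec_linearPart₁ hXY'
    rw [AffData.model_smul_proj _ _ _ hX, AffData.model_smul_proj _ _ _ hY] at h'
    exact h'.2.trans h.2.symm
  smul_str₂ := AffData.model_smul_proj
  smul_base₁ := AffData.model_smul_proj
  smul_base₂ := AffData.model_smul_proj
  exists_triv m := by
    obtain ⟨U, hU, ⟨T⟩⟩ := L.exists_triv m
    exact ⟨U, hU, ⟨T.modelDouble L⟩⟩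

end

/-! ## Charts and the cotangent bundle -/

/-- A diffeomorphism of an open subset of `X` with the vector space `E`. -/
structure DChart (X E : Type*) [DiffeologicalSpace X] [DiffeologicalSpace E] where
  source : Set X
  κ : X → E
  ψ : E → X
  dOpen : DOpen source
  mem_source : ∀ e, ψ e ∈ source
  right_inv : ∀ e, κ (ψ e) = e
  left_inv : ∀ x ∈ source, ψ (κ x) = x
  smooth : DSmoothOn κ source
  smooth_inv : DSmooth ψ

/-- The chart on the total space of a bundle over the domain of a chart. -/
def DChart.ofTriv {A M V E : Type*} [DiffeologicalSpace A] [DiffeologicalSpace M]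
    [DiffeologicalSpace V] [DiffeologicalSpace E] (c : DChart M V) {proj : A → M}
    (T : Triv proj c.source E) (h : DSmooth proj) : DChart A (V × E) where
  source := {a | proj a ∈ c.source}
  κ a := (c.κ (proj a), T.φ a)
  ψ e := T.ψ (c.ψ e.1) e.2
  dOpen := c.dOpen.preimage h
  mem_source e := by
    change proj _ ∈ c.source
    rw [T.proj_inv _ (c.mem_source _)]
    exact c.mem_source _
  right_inv e := by
    rw [T.proj_inv _ (c.mem_source _), T.right_inv _ (c.mem_source _), c.right_inv]
  left_inv a ha := by
    rw [c.left_inv _ ha, T.left_inv a ha]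
  smooth := (c.smooth.comp (h.dSmoothOn _) fun _ ha => ha).prodMk T.smooth
  smooth_inv := dSmoothOn_univ.1 (T.smooth_inv.comp
    ((dSmoothOn_univ.2 (c.smooth_inv.comp dSmooth_fst)).prodMk (dSmooth_snd.dSmoothOn _))
    fun _ _ => c.mem_source _)

/-! ### Differentials and covectors in a chart -/

section

variable {X : Type*} [DiffeologicalSpace X] {E : Type*} [NormedAddCommGroup E] [NormedSpace ℝ E]
  [DiffeologicalSpace E] [IsContDiffCompatible E] [FiniteDimensional ℝ E]

namespace DChart

variable (c : DChart X E)

theorem contDiffAt {f : X → ℝ} {O : Set X} (hO : DOpen O) (hf : DSmoothOn f O) {x : X}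
    (hx : x ∈ O) (hxs : x ∈ c.source) : ContDiffAt ℝ ∞ (fun e => f (c.ψ e)) (c.κ x) :=
  hf.contDiffAt_comp hO c.smooth_inv (by rwa [c.left_inv x hxs])

theorem differentiableAt {f : X → ℝ} {O : Set X} (hO : DOpen O) (hf : DSmoothOn f O) {x : X}
    (hx : x ∈ O) (hxs : x ∈ c.source) : DifferentiableAt ℝ (fun e => f (c.ψ e)) (c.κ x) :=
  (c.contDiffAt hO hf hx hxs).differentiableAt (by simp)

theorem eventually_mem {O : Set X} (hO : DOpen O) {x : X}
    (hx : x ∈ O) (hxs : x ∈ c.source) : ∀ᶠ e in 𝓝 (c.κ x), c.ψ e ∈ O :=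
  hO.eventually_mem c.smooth_inv (by rwa [c.left_inv x hxs])

theorem hasDerivAt_comp {γ : ℝ → X} {t : ℝ}
    (hs : ∀ᶠ t' in 𝓝 t, γ t' ∈ c.source) {v : E} (hv : HasDerivAt (fun t => c.κ (γ t)) v t)
    {f : X → ℝ} (hf : DifferentiableAt ℝ (fun e => f (c.ψ e)) (c.κ (γ t))) :
    HasDerivAt (fun t => f (γ t)) (fderiv ℝ (fun e => f (c.ψ e)) (c.κ (γ t)) v) t := by
  refine (hf.hasFDerivAt.comp_hasDerivAt t hv).congr_of_eventuallyEq ?_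
  filter_upwards [hs] with t' ht'
  simp only [Function.comp]
  rw [c.left_inv _ ht']

theorem hasDerivAt_of_dSmooth {γ : ℝ → X} (hγ : DSmooth γ) {t : ℝ} (h : γ t ∈ c.source) :
    HasDerivAt (fun t => c.κ (γ t)) (deriv (fun t => c.κ (γ t)) t) t :=
  ((c.smooth.contDiffAt_comp c.dOpen hγ h).differentiableAt (by simp)).hasDerivAt

/-- The line through `x` in the direction `v`. -/
def line (x : X) (v : E) (t : ℝ) : X := c.ψ (c.κ x + t • v)

theorem dSmooth_line (x : X) (v : E) : DSmooth (c.line x v) :=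
  c.smooth_inv.comp (ContDiff.dSmooth (by fun_prop))

theorem line_zero {x : X} (hx : x ∈ c.source) (v : E) : c.line x v 0 = x := by
  rw [line, zero_smul, add_zero, c.left_inv x hx]

theorem κ_line (x : X) (v : E) (t : ℝ) : c.κ (c.line x v t) = c.κ x + t • v := c.right_inv _

theorem hasDerivAt_line (x : X) (v : E) : HasDerivAt (fun t => c.κ (c.line x v t)) v 0 := by
  simp only [c.κ_line]
  simpa using ((hasDerivAt_id (0 : ℝ)).smul_const v).const_add (c.κ x)

/-- The coordinate lines through `x` realize every direction, which gives one implication; the chain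
rule gives the other. It translates the equivalence of germs into equality of derivatives. -/
theorem hasZeroDifferential_iff {f : X → ℝ} {x : X} (hx : x ∈ c.source)
    (hf : DifferentiableAt ℝ (fun e => f (c.ψ e)) (c.κ x)) :
    HasZeroDifferential f x ↔ fderiv ℝ (fun e => f (c.ψ e)) (c.κ x) = 0 := by
  constructor
  · intro h
    ext v
    have h1 := h _ (c.dSmooth_line x v) (c.line_zero hx v)
    have h2 := c.hasDerivAt_comp (f := f) (γ := c.line x v) (Filter.Eventually.of_forall fun t => c.mem_source _)
      (c.hasDerivAt_line x v) (by rwa [c.line_zero hx])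
    rw [c.line_zero hx] at h2
    exact h2.unique h1
  · intro h γ hγ hγ0
    have h0 : γ 0 ∈ c.source := hγ0 ▸ hx
    have h2 := c.hasDerivAt_comp (f := f) (γ := γ) (c.dOpen.eventually_mem hγ h0)
      (c.hasDerivAt_of_dSmooth hγ h0) (by rwa [hγ0])
    rw [hγ0, h] at h2
    exact h2

/-- The derivative in the second variable of a jointly smooth function depends smoothly on the
parameter and the point. The smoothness of the fibre coordinates of both `T*X` and `P A` rests on
this. -/
theorem contDiff_fderiv {k : ℕ} {F : Euc k × X → ℝ} {W : Set (Euc k × X)} (hW : DOpen W)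
    (hF : DSmoothOn F W) {x : Euc k → X} (hx : IsPlot x) (hxs : ∀ w, x w ∈ c.source)
    (hm : ∀ w, (w, x w) ∈ W) :
    ContDiff ℝ ∞ (fun w => fderiv ℝ (fun e => F (w, c.ψ e)) (c.κ (x w))) := by
  refine contDiff_iff_contDiffAt.2 fun w => ?_
  have hγ : DSmooth (fun q : Euc k × E => (q.1, c.ψ q.2)) := dSmoothOn_univ.1
    ((dSmooth_fst.dSmoothOn _).prodMk ((c.smooth_inv.comp dSmooth_snd).dSmoothOn _))
  have h1 := hF.contDiffAt_comp hW hγ (e := (w, c.κ (x w)))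
    (by rw [c.left_inv _ (hxs w)]; exact hm w)
  have h2 : ContDiff ℝ ∞ (fun w => c.κ (x w)) := (c.smooth _ _ hx hxs).contDiff
  exact ContDiffAt.fderiv (f := fun w e => F (w, c.ψ e)) (g := fun w => c.κ (x w)) h1
    h2.contDiffAt (by simp)

/-- The differential of a germ. -/
def _root_.DAff.FunGerm.differential (g : FunGerm X) : Cotangent X := Quot.mk _ g

/-- The function with constant differential `L` in the chart. -/
def linFun (L : E →L[ℝ] ℝ) (y : X) : ℝ := L (c.κ y)

theorem dSmoothOn_linFun (L : E →L[ℝ] ℝ) : DSmoothOn (c.linFun L) c.source :=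
  L.dSmooth.comp_dSmoothOn c.smooth

theorem linFun_ψ (L : E →L[ℝ] ℝ) : (fun e => c.linFun L (c.ψ e)) = L :=
  funext fun e => congrArg L (c.right_inv e)

open Classical in
/-- The covector in the chart. -/
def covec : Cotangent X → (E →L[ℝ] ℝ) :=
  Quot.lift (fun g => if g.pt ∈ c.source then fderiv ℝ (fun e => g.fn (c.ψ e)) (c.κ g.pt) else 0)
    fun g g' h => by
    obtain ⟨hpt, hz⟩ := h
    by_cases hg : g.pt ∈ c.source
    · obtain ⟨O, hO, hx, hs⟩ := g.smooth
      obtain ⟨O', hO', hx', hs'⟩ := g'.smooth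
      have d := c.differentiableAt hO hs hx hg
      have d' := c.differentiableAt hO' hs' hx' (hpt ▸ hg)
      rw [← hpt] at d'
      rw [if_pos hg, if_pos (hpt ▸ hg), ← hpt, ← sub_eq_zero, ← fderiv_fun_sub d d']
      exact (c.hasZeroDifferential_iff hg (d.sub d')).1 hz
    · rw [if_neg hg, if_neg (hpt ▸ hg)]

variable {c}

theorem _root_.DAff.IsDifferential.covec {x : X} {f : X → ℝ} {θ : Cotangent X}
    (h : IsDifferential x f θ) (hx : x ∈ c.source) :
    θ.pt = x ∧ DifferentiableAt ℝ (fun e => f (c.ψ e)) (c.κ x) ∧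
      c.covec θ = fderiv ℝ (fun e => f (c.ψ e)) (c.κ x) := by
  obtain ⟨g, rfl, rfl, rfl⟩ := h
  obtain ⟨O, hO, hx', hs⟩ := g.smooth
  exact ⟨rfl, c.differentiableAt hO hs hx' hx, if_pos hx⟩

theorem _root_.DAff.Cotangent.exists_isDifferential (θ : Cotangent X) :
    ∃ f, IsDifferential θ.pt f θ := by
  obtain ⟨g, rfl⟩ := Quot.exists_rep θ
  exact ⟨g.fn, g, rfl, rfl, rfl⟩

/-- A covector is the differential of every locally smooth function with the right derivative.
Representatives may therefore be taken linear in the chart. -/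
theorem isDifferential_of {θ : Cotangent X} {f : X → ℝ} (hx : θ.pt ∈ c.source) {O : Set X}
    (hO : DOpen O) (hxO : θ.pt ∈ O) (hf : DSmoothOn f O)
    (h : c.covec θ = fderiv ℝ (fun e => f (c.ψ e)) (c.κ θ.pt)) : IsDifferential θ.pt f θ := by
  obtain ⟨f', hf'⟩ := θ.exists_isDifferential
  obtain ⟨-, d', h'⟩ := hf'.covec hx
  obtain ⟨g, hg, rfl, hθ⟩ := hf'
  have d := c.differentiableAt hO hf hxO hx
  refine ⟨⟨θ.pt, f, O, hO, hxO, hf⟩, rfl, rfl, ?_⟩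
  refine hθ.trans (Quot.sound ⟨hg, ?_⟩)
  simp only
  rw [hg]
  refine (c.hasZeroDifferential_iff hx (d'.sub d)).2 ?_
  rw [fderiv_fun_sub d' d, ← h, ← h', sub_self]

theorem isDifferential_linFun {θ : Cotangent X} (hx : θ.pt ∈ c.source) {L : E →L[ℝ] ℝ}
    (h : c.covec θ = L) : IsDifferential θ.pt (c.linFun L) θ :=
  isDifferential_of hx c.dOpen hx (c.dSmoothOn_linFun L) (by rw [h, linFun_ψ, L.fderiv])

/-- By the chain rule only the velocity of the coordinate expression at `0` matters; apart from
staying near the chart domain, the curve itself need not be known to be smooth. -/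
theorem hasPairing_covec {θ : Cotangent X} {γ : ℝ → X} (h : θ.pt = γ 0)
    (hs : ∀ᶠ t in 𝓝 0, γ t ∈ c.source) {v : E} (hv : HasDerivAt (fun t => c.κ (γ t)) v 0) :
    θ.HasPairing γ (c.covec θ v) := by
  refine ⟨h, fun f hf => ?_⟩
  obtain ⟨-, d, h'⟩ := hf.covec (c := c) hs.self_of_nhds
  rw [h']
  exact c.hasDerivAt_comp hs hv d

theorem _root_.DAff.Cotangent.HasPairing.unique {θ : Cotangent X} {γ : ℝ → X} {r r' : ℝ}
    (h : θ.HasPairing γ r) (h' : θ.HasPairing γ r') : r = r' := by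
  obtain ⟨f, hf⟩ := θ.exists_isDifferential
  rw [h.1] at hf
  exact (h.2 f hf).unique (h'.2 f hf)

theorem _root_.DAff.Cotangent.dSmooth_pt : DSmooth (Cotangent.pt : Cotangent X → X) := by
  refine dSmooth_generateFrom ?_
  rintro n q ⟨x, f, W, hx, -, -, -, h⟩
  convert! hx using 1
  funext u
  obtain ⟨g, hg, -, hθ⟩ := h u
  simp only [] at hθ
  rw [hθ]
  exact hg

variable (c)

open Classical in
/-- The trivialization of the cotangent bundle over the domain of a chart. -/
def cotangent : VecTriv (cotangentVec X) c.source (E →L[ℝ] ℝ) where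
  φ := c.covec
  ψ x L := if h : x ∈ c.source then
      FunGerm.differential ⟨x, c.linFun L, c.source, c.dOpen, h, c.dSmoothOn_linFun L⟩
    else FunGerm.differential
      ⟨x, fun _ => 0, Set.univ, dOpen_univ, trivial, dSmoothOn_const _ _⟩
  dOpen := c.dOpen
  proj_inv x h L := by
    rw [dif_pos h]
    rfl
  right_inv x h L := by
    rw [dif_pos h]
    refine (if_pos h).trans ?_
    change fderiv ℝ (fun e => c.linFun L (c.ψ e)) _ = L
    rw [linFun_ψ, L.fderiv]
  left_inv θ h := by
    rw [dif_pos h]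
    obtain ⟨g, hg, hg', hθ⟩ := isDifferential_linFun h rfl
    refine Eq.trans (congrArg FunGerm.differential ?_) hθ.symm
    obtain ⟨pt, fn, hs⟩ := g
    subst hg hg'
    rfl
  smooth := by
    refine dSmoothOn_generateFrom ?_
    rintro n q ⟨x, f, W, hx, hW, hxW, hf, h⟩ k g hg hs
    have hpt : ∀ u, (q u).pt = x u := fun u => by
      obtain ⟨g, hg, -, hθ⟩ := h u
      simp only [] at hθ
      rw [hθ]
      exact hg
    have hs' : ∀ w, x (g w) ∈ c.source := fun w => hpt (g w) ▸ hs w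
    -- The generating family is pulled back along `g`, since only the parameters that land over the
    -- chart domain are tested.
    have hG : DSmooth (fun r : Euc k × X => (g r.1, r.2)) := dSmoothOn_univ.1
      (((hg.dSmooth.comp dSmooth_fst).dSmoothOn _).prodMk (dSmooth_snd.dSmoothOn _))
    have key := c.contDiff_fderiv (F := fun r : Euc k × X => f (g r.1, r.2)) (hW.preimage hG)
      (hf.comp (hG.dSmoothOn _) fun _ h => h) (isPlot_reparam hx hg) hs' fun w => hxW (g w)
    convert! key.isPlot using 1
    funext w
    exact ((h (g w)).covec (hs' w)).2.2
  smooth_inv := by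
    intro n p hp hU
    have h1 := isPlot_prod.1 hp
    -- The generating family consists of the functions that are linear in the chart, with smoothly
    -- varying coefficients.
    refine DiffeologicalSpace.isPlot_generatedFrom_of_mem
      ⟨fun u => (p u).1, fun r => c.linFun (p r.1).2 r.2, {r | r.2 ∈ c.source}, h1.1,
        c.dOpen.preimage dSmooth_snd, hU, ?_, fun u => ?_⟩
    · exact ((dSmooth_snd.comp (hp.dSmooth.comp dSmooth_fst)).dSmoothOn _).clm_apply
        (c.smooth.comp (dSmooth_snd.dSmoothOn _) fun _ h => h)
    · exact ⟨⟨(p u).1, c.linFun (p u).2, c.source, c.dOpen, hU u, c.dSmoothOn_linFun _⟩, rfl, rfl,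
        dif_pos (hU u)⟩
  add_iff θ₁ θ₂ θ₃ h₁ h₂ h₃ := by
    change θ₂.pt = θ₁.pt at h₂
    change θ₃.pt = θ₁.pt at h₃
    change θ₁.pt ∈ c.source at h₁
    constructor
    · rintro ⟨x, f, g, hf, hg, hfg⟩
      obtain rfl : θ₁.pt = x := by
        obtain ⟨g, rfl, -, rfl⟩ := hf
        rfl
      obtain ⟨-, d, e⟩ := hf.covec h₁
      obtain ⟨-, d', e'⟩ := hg.covec h₁
      rw [(hfg.covec h₁).2.2, e, e', fderiv_fun_add d d']
    · intro h
      refine ⟨θ₁.pt, c.linFun (c.covec θ₁), c.linFun (c.covec θ₂), isDifferential_linFun h₁ rfl, ?_,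
        ?_⟩
      · rw [← h₂]
        exact isDifferential_linFun (h₂ ▸ h₁) rfl
      · rw [← h₃]
        exact isDifferential_linFun (h₃ ▸ h₁) h
  smul_iff t θ₁ θ₂ h₁ h₂ := by
    change θ₂.pt = θ₁.pt at h₂
    change θ₁.pt ∈ c.source at h₁
    constructor
    · rintro ⟨x, f, hf, hg⟩
      obtain rfl : θ₁.pt = x := by
        obtain ⟨g, rfl, -, rfl⟩ := hf
        rfl
      obtain ⟨-, d, e⟩ := hf.covec h₁
      rw [(hg.covec h₁).2.2, e]
      exact fderiv_const_mul d t
    · intro h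
      refine ⟨θ₁.pt, c.linFun (c.covec θ₁), isDifferential_linFun h₁ rfl, ?_⟩
      rw [← h₂]
      exact isDifferential_linFun (h₂ ▸ h₁) h

end DChart

end

/-! ## Charts of a manifold -/

section Manifold

variable {d : ℕ} {M : Type*} [TopologicalSpace M] [ChartedSpace (Euc d) M]
  [DiffeologicalSpace M] [IsContMDiffCompatible d M]

theorem dOpen_of_isOpen (d : ℕ) [ChartedSpace (Euc d) M] [IsContMDiffCompatible d M] {U : Set M}
    (hU : IsOpen U) : DOpen U :=
  dOpen_iff.2 fun _ _ hp => hU.preimage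
    ((IsContMDiffCompatible.isPlot_iff (d := d)).1 hp).continuous

theorem dSmoothOn_of_contDiffOn {E F : Type*} [NormedAddCommGroup E] [NormedSpace ℝ E]
    [DiffeologicalSpace E] [IsContDiffCompatible E] [NormedAddCommGroup F] [NormedSpace ℝ F]
    [DiffeologicalSpace F] [IsContDiffCompatible F] {f : E → F} {s : Set E}
    (hf : ContDiffOn ℝ ∞ f s) : DSmoothOn f s :=
  fun _ _ hp hs => (hf.comp_contDiff hp.contDiff hs).isPlot

theorem univBall_mem {E : Type*} [NormedAddCommGroup E] [NormedSpace ℝ E]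
    (x : E) {ε : ℝ} (hε : 0 < ε) (e : E) :
    OpenPartialHomeomorph.univBall x ε e ∈ Metric.ball x ε := by
  have := (OpenPartialHomeomorph.univBall x ε).map_source (x := e)
  rw [OpenPartialHomeomorph.univBall_target x hε] at this
  exact this (by simp)

/-- A ball in the image of an ordinary chart is stretched diffeomorphically onto the whole of `ℝᵈ`.
Charts onto all of space keep coordinate lines inside the domain for every time. -/
theorem exists_dChart [IsManifold (𝓡 d) ∞ M] (m : M) : ∃ c : DChart M (Euc d), m ∈ c.source := by
  let e := chartAt (Euc d) m
  have hm : m ∈ e.source := mem_chart_source _ m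
  obtain ⟨ε, hε, hb⟩ := Metric.isOpen_iff.1 e.open_target _ (e.map_source hm)
  let B := OpenPartialHomeomorph.univBall (e m) ε
  have hB : ∀ x ∈ Metric.ball (e m) ε, B (B.symm x) = x := fun x hx =>
    B.right_inv (by rwa [OpenPartialHomeomorph.univBall_target _ hε])
  have hB' : ∀ x, B.symm (B x) = x := fun x => B.left_inv (by simp [B])
  have hmem : ∀ x, B x ∈ Metric.ball (e m) ε := univBall_mem _ hε
  refine ⟨{ source := e.source ∩ e ⁻¹' Metric.ball (e m) ε
            κ := fun x => B.symm (e x)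
            ψ := fun x => e.symm (B x)
            dOpen := dOpen_of_isOpen d (e.isOpen_inter_preimage Metric.isOpen_ball)
            mem_source := fun x => ⟨e.map_target (hb (hmem x)), ?_⟩
            right_inv := fun x => ?_
            left_inv := fun x hx => ?_
            smooth := ?_
            smooth_inv := ?_ }, hm, Metric.mem_ball_self hε⟩
  · change e (e.symm (B x)) ∈ Metric.ball (e m) ε
    rw [e.right_inv (hb (hmem x))]
    exact hmem x
  · rw [e.right_inv (hb (hmem x)), hB']
  · rw [hB _ hx.2, e.left_inv hx.1]
  · intro n p hp hs
    have h1 : ContMDiff (𝓡 n) (𝓡 d) ∞ (fun u => e (p u)) :=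
      (contMDiffOn_chart (I := 𝓡 d) (n := ∞) (x := m)).comp_contMDiff
        (IsContMDiffCompatible.isPlot_iff.1 hp) fun u => (hs u).1
    have h2 : ContDiff ℝ ∞ (fun u => e (p u)) := h1.contDiff
    exact (OpenPartialHomeomorph.contDiffOn_univBall_symm.comp_contDiff h2
      fun u => (hs u).2).isPlot
  · intro n p hp
    refine (IsContMDiffCompatible.isPlot_iff (d := d)).2 ?_
    have h1 : ContDiff ℝ ∞ (fun u => B (p u)) :=
      OpenPartialHomeomorph.contDiff_univBall.comp hp.contDiff
    exact (contMDiffOn_chart_symm (I := 𝓡 d) (n := ∞) (x := m)).comp_contMDiff h1.contMDiff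
      fun u => hb (hmem _)

/-- The restriction of a chart to a ball. -/
def DChart.ball {X E : Type*} [DiffeologicalSpace X] [NormedAddCommGroup E]
    [InnerProductSpace ℝ E] [DiffeologicalSpace E] [IsContDiffCompatible E] [FiniteDimensional ℝ E]
    (c : DChart X E) (e : E) {ε : ℝ} (hε : 0 < ε) : DChart X E where
  source := {x | x ∈ c.source ∧ c.κ x ∈ Metric.ball e ε}
  κ x := (OpenPartialHomeomorph.univBall e ε).symm (c.κ x)
  ψ x := c.ψ (OpenPartialHomeomorph.univBall e ε x)
  dOpen := c.dOpen.inter_preimage c.smooth Metric.isOpen_ball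
  mem_source x := ⟨c.mem_source _, by
    rw [c.right_inv]
    exact univBall_mem e hε x⟩
  right_inv x := by
    rw [c.right_inv]
    exact (OpenPartialHomeomorph.univBall e ε).left_inv (by simp)
  left_inv x hx := by
    rw [(OpenPartialHomeomorph.univBall e ε).right_inv, c.left_inv x hx.1]
    rw [OpenPartialHomeomorph.univBall_target e hε]
    exact hx.2
  smooth := (dSmoothOn_of_contDiffOn OpenPartialHomeomorph.contDiffOn_univBall_symm).comp
    (c.smooth.mono fun _ h => h.1) fun _ h => h.2
  smooth_inv := c.smooth_inv.comp OpenPartialHomeomorph.contDiff_univBall.dSmooth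

theorem exists_dChart_subset [IsManifold (𝓡 d) ∞ M] {m : M} {O : Set M} (hO : DOpen O)
    (hm : m ∈ O) : ∃ c : DChart M (Euc d), m ∈ c.source ∧ c.source ⊆ O := by
  obtain ⟨c, hc⟩ := exists_dChart (d := d) m
  have h1 := c.eventually_mem hO hm hc
  obtain ⟨ε, hε, hb⟩ := Metric.eventually_nhds_iff_ball.1 h1
  refine ⟨c.ball (c.κ m) hε, ⟨hc, Metric.mem_ball_self hε⟩, fun x hx => ?_⟩
  rw [← c.left_inv x hx.1]
  exact hb _ hx.2

end Manifold

/-! ## Affine functions and functions on fibres -/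

section LinPart

variable {E : Type*} [NormedAddCommGroup E] [NormedSpace ℝ E] [FiniteDimensional ℝ E]

/-- The linear part of an affine function on a vector space. -/
def linPart (f : E → ℝ) : E →L[ℝ] ℝ :=
  ∑ i, (f (Module.finBasis ℝ E i) - f 0) •
    LinearMap.toContinuousLinearMap ((Module.finBasis ℝ E).coord i)

/-- `linPart` is built from finitely many values of `f`, which makes its dependence on parameters
visibly smooth; for an affine `f` those values determine `f - f 0`. -/
theorem linPart_apply {f : E → ℝ}
    (hf : ∀ (t : ℝ) (y z : E), f (t • y + (1 - t) • z) = t * f y + (1 - t) * f z) (x : E) :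
    linPart f x = f x - f 0 := by
  have hsmul : ∀ (t : ℝ) y, f (t • y) - f 0 = t * (f y - f 0) := fun t y => by
    have := hf t y 0
    rw [smul_zero, add_zero] at this
    rw [this]
    ring
  let g : E →ₗ[ℝ] ℝ :=
    { toFun := fun x => f x - f 0
      map_add' := fun x y => by
        -- Additivity comes from affinity at the midpoint followed by homogeneity with factor `2`.
        have h1 := hf (1 / 2) x y
        have h2 := hsmul 2 ((1 / 2 : ℝ) • x + (1 - 1 / 2 : ℝ) • y)
        have h3 : (2 : ℝ) • ((1 / 2 : ℝ) • x + (1 - 1 / 2 : ℝ) • y) = x + y := by module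
        rw [h1, h3] at h2
        linarith
      map_smul' := fun t x => hsmul t x }
  have : (linPart f : E →ₗ[ℝ] ℝ) = g := by
    refine (Module.finBasis ℝ E).ext fun i => ?_
    simp [linPart, g, Finsupp.single_apply]
  exact congrArg (fun L : E →ₗ[ℝ] ℝ => L x) this

theorem hasFDerivAt_of_affine {f : E → ℝ}
    (hf : ∀ (t : ℝ) (y z : E), f (t • y + (1 - t) • z) = t * f y + (1 - t) * f z) (x : E) :
    HasFDerivAt f (linPart f) x := by
  have : f = fun x => linPart f x + f 0 := funext fun x => by rw [linPart_apply hf]; ring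
  have h2 := (linPart f).hasFDerivAt (x := x)
  conv =>
    arg 1
    rw [this]
  exact h2.add_const _

/-- Only the values at `0` and at the basis vectors enter, so smoothness for each fixed argument
suffices. -/
theorem isPlot_linPart {n : ℕ} {f : Euc n → E → ℝ} (h : ∀ e, IsPlot (fun u => f u e)) :
    IsPlot (fun u => linPart (f u)) := by
  refine ContDiff.isPlot (ContDiff.sum fun i _ => ?_)
  exact ((h _).contDiff.sub (h _).contDiff).smul contDiff_const

end LinPart

namespace FibreFun

variable {X M : Type*} {proj : X → M}

open Classical in
/-- The value of a function on a fibre, extended by zero. -/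
def eval (φ : FibreFun proj) (x : X) : ℝ := if h : proj x = φ.base then φ.fn x h else 0

theorem eval_eq (φ : FibreFun proj) {x : X} (h : proj x = φ.base) : φ.eval x = φ.fn x h :=
  dif_pos h

theorem ext_eval {φ ψ : FibreFun proj} (h : φ.base = ψ.base)
    (hf : ∀ x, proj x = φ.base → φ.eval x = ψ.eval x) : φ = ψ := by
  obtain ⟨m, f⟩ := φ
  obtain ⟨m', f'⟩ := ψ
  obtain rfl : m = m' := h
  congr 1
  funext x hx
  have := hf x hx
  rwa [eval_eq _ hx, eval_eq _ hx] at this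

variable [DiffeologicalSpace X] [DiffeologicalSpace M]

theorem dSmooth_base : DSmooth (FibreFun.base : FibreFun proj → M) :=
  dSmooth_generateFrom fun _ _ h => h.1

/-- A family of functions on fibres may be tested on the arguments cut out by a section. Evaluating
along the sections with constant fibre coordinate then gives smooth coordinates on duals. -/
theorem dSmoothOn_eval {s : M → X} {U : Set M} (hs : DSmoothOn s U) (h : ∀ m ∈ U, proj (s m) = m) :
    DSmoothOn (fun φ : FibreFun proj => φ.eval (s φ.base)) {φ | φ.base ∈ U} := by
  refine dSmoothOn_generateFrom ?_
  intro n q hq k f hf hU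
  obtain ⟨hq1, hq2⟩ := hq
  have h1 := hq2 k f (fun w => s (q (f w)).base) (fun w => h _ (hU w)) hf
    (hs _ _ (isPlot_reparam hq1 hf) hU)
  convert! h1.isPlot using 1
  funext w
  exact eval_eq _ (h _ (hU w))

theorem isPlot_of {n : ℕ} {q : Euc n → FibreFun proj} (h : IsPlot (fun u => (q u).base))
    (hq : ∀ (k : ℕ) (f : Euc k → Euc n) (a : Euc k → X), (∀ w, proj (a w) = (q (f w)).base) →
      ContDiff ℝ ∞ f → IsPlot a → ContDiff ℝ ∞ fun w => (q (f w)).eval (a w)) : IsPlot q := by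
  refine DiffeologicalSpace.isPlot_generatedFrom_of_mem ⟨h, fun k f a ha hf hp => ?_⟩
  have := hq k f a ha hf hp
  simpa only [eval_eq _ (ha _)] using this

end FibreFun

/-! ## The dual of a vector bundle -/

namespace VecTriv

variable {D M : Type*} [DiffeologicalSpace D] [DiffeologicalSpace M] {S : VecData D M} {U : Set M}
  {E : Type*} [NormedAddCommGroup E] [NormedSpace ℝ E] [DiffeologicalSpace E]
  [IsContDiffCompatible E] [FiniteDimensional ℝ E]

theorem dual_affine (T : VecTriv S U E) {θ : S.Dual} (h : θ.1.base ∈ U) :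
    θ.1.eval (T.ψ θ.1.base 0) = 0 ∧ ∀ (t : ℝ) (y z : E),
      θ.1.eval (T.ψ θ.1.base (t • y + (1 - t) • z)) =
        t * θ.1.eval (T.ψ θ.1.base y) + (1 - t) * θ.1.eval (T.ψ θ.1.base z) := by
  have hp := T.proj_inv _ h
  have hr := T.right_inv _ h
  have hs : ∀ (t : ℝ) (y : E),
      θ.1.eval (T.ψ θ.1.base (t • y)) = t * θ.1.eval (T.ψ θ.1.base y) := by
    intro t y
    rw [FibreFun.eval_eq _ (hp _), FibreFun.eval_eq _ (hp _)]
    refine θ.2.2 _ _ _ _ _ ((T.smul_iff _ _ _ (by rwa [hp]) (by rw [hp, hp])).2 ?_)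
    rw [hr, hr]
  constructor
  · have := hs 0 0
    rwa [zero_smul, zero_mul] at this
  · intro t y z
    rw [← hs, ← hs]
    rw [FibreFun.eval_eq _ (hp _), FibreFun.eval_eq _ (hp _), FibreFun.eval_eq _ (hp _)]
    refine θ.2.1 _ _ _ _ _ _ ((T.add_iff _ _ _ (by rwa [hp]) (by rw [hp, hp])
      (by rw [hp, hp])).2 ?_)
    rw [hr, hr, hr]

/-- The coordinate of a linear function on a fibre. -/
def dualφ (T : VecTriv S U E) (θ : S.Dual) : E →L[ℝ] ℝ :=
  linPart fun e => θ.1.eval (T.ψ θ.1.base e)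

theorem dualφ_apply (T : VecTriv S U E) {θ : S.Dual} (h : θ.1.base ∈ U) (x : D)
    (hx : S.proj x = θ.1.base) : T.dualφ θ (T.φ x) = θ.1.fn x hx := by
  have e := T.dual_affine h
  rw [dualφ, linPart_apply e.2, e.1, sub_zero, ← hx, T.left_inv x (hx.symm ▸ h),
    FibreFun.eval_eq _ hx]

theorem eq_dualφ (T : VecTriv S U E) {θ : S.Dual} (h : θ.1.base ∈ U) {L : E →L[ℝ] ℝ}
    (hL : ∀ x hx, θ.1.fn x hx = L (T.φ x)) : T.dualφ θ = L := by
  ext e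
  have hp := T.proj_inv _ h e
  rw [← T.right_inv _ h e, T.dualφ_apply h _ hp, hL]

open Classical in
/-- The linear function on a fibre with given coordinate. -/
def dualψ (T : VecTriv S U E)
    (m : M) (L : E →L[ℝ] ℝ) : S.Dual :=
  if h : m ∈ U then
    ⟨⟨m, fun x _ => L (T.φ x)⟩, fun x y z hx hy hz hxyz => by
      simp only at hx hy hz ⊢
      rw [(T.add_iff x y z (hx ▸ h) (hy.trans hx.symm) (hz.trans hx.symm)).1 hxyz, map_add],
      fun t x y hx hy hxy => by
      simp only at hx hy ⊢
      rw [(T.smul_iff t x y (hx ▸ h) (hy.trans hx.symm)).1 hxy, map_smul, smul_eq_mul]⟩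
  else (S.dualZero m).1

variable (T : VecTriv S U E)

theorem dualψ_spec {m : M} (hm : m ∈ U) (L : E →L[ℝ] ℝ) :
    (T.dualψ m L).1.base = m ∧
      ∀ x hx, (T.dualψ m L).1.fn x hx = L (T.φ x) := by
  unfold dualψ
  rw [dif_pos hm]
  exact ⟨rfl, fun _ _ => rfl⟩

theorem dual_ext {θ θ' : S.Dual} (h : θ.1.base ∈ U) (hb : θ'.1.base = θ.1.base)
    (he : T.dualφ θ' = T.dualφ θ) : θ' = θ := by
  refine Subtype.ext (FibreFun.ext_eval hb fun x hx => ?_)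
  rw [FibreFun.eval_eq _ hx, FibreFun.eval_eq _ (hx.trans hb),
    ← T.dualφ_apply (hb ▸ h), ← T.dualφ_apply h, he]

/-- The trivialization of the dual bundle. -/
def dual : VecTriv S.dual U (E →L[ℝ] ℝ) where
  φ := T.dualφ
  ψ := T.dualψ
  dOpen := T.dOpen
  proj_inv m hm L := (T.dualψ_spec hm L).1
  right_inv m hm L := T.eq_dualφ (by rwa [(T.dualψ_spec hm L).1])
    (T.dualψ_spec hm L).2
  left_inv θ h := by
    have e := T.dualψ_spec h (T.dualφ θ)
    exact T.dual_ext h e.1 (T.eq_dualφ (by rwa [e.1]) e.2)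
  smooth := by
    intro n p hp hb
    refine isPlot_linPart (f := fun u e => (p u).1.eval (T.ψ (p u).1.base e)) fun e => ?_
    have h1 : DSmoothOn (fun m => T.ψ m e) U :=
      T.smooth_inv.comp ((dSmooth_id.dSmoothOn _).prodMk (dSmoothOn_const e _)) fun _ h => h
    exact FibreFun.dSmoothOn_eval h1 (fun m hm => T.proj_inv m hm e) n (fun u => (p u).1) hp hb
  smooth_inv := by
    intro n p hp hb
    have e := fun u => T.dualψ_spec (hb u) (p u).2
    have h1 := isPlot_prod.1 hp
    refine isPlot_subtype.2 (FibreFun.isPlot_of ?_ fun k f a hpa hf hpl => ?_)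
    · convert! h1.1 using 1
      exact funext fun u => (e u).1
    · have h2 : ∀ w, S.proj (a w) ∈ U := fun w => by
        rw [hpa w]
        exact (e (f w)).1.symm ▸ hb (f w)
      have h3 := (T.smooth _ _ hpl h2).contDiff
      have h4 := (isPlot_reparam h1.2 hf).contDiff
      convert! h4.clm_apply h3 using 1
      funext w
      rw [FibreFun.eval_eq _ (hpa w)]
      exact (e (f w)).2 _ _
  add_iff x y z hx hy hz := by
    change y.1.base = x.1.base at hy
    change z.1.base = x.1.base at hz
    change x.1.base ∈ U at hx
    constructor
    · rintro ⟨-, -, h⟩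
      refine T.eq_dualφ (hz ▸ hx) fun w hw => ?_
      rw [h w (hw.trans hz) (hw.trans (hz.trans hy.symm)), ← T.dualφ_apply hx,
        ← T.dualφ_apply (hy ▸ hx)]
      rfl
    · intro h
      refine ⟨hy.symm, hz, fun w h1 h2 h3 => ?_⟩
      rw [← T.dualφ_apply hx, ← T.dualφ_apply (θ := y) (hy ▸ hx),
        ← T.dualφ_apply (θ := z) (hz ▸ hx), h]
      rfl
  smul_iff t x y hx hy := by
    change y.1.base = x.1.base at hy
    change x.1.base ∈ U at hx
    constructor
    · rintro ⟨-, h⟩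
      refine T.eq_dualφ (hy ▸ hx) fun w hw => ?_
      rw [h w (hw.trans hy) hw, ← T.dualφ_apply hx]
      rfl
    · intro h
      refine ⟨hy, fun w h1 h2 => ?_⟩
      rw [← T.dualφ_apply hx, ← T.dualφ_apply (hy ▸ hx), h]
      rfl

end VecTriv

/-! ## Adapted trivializations of a special affine bundle -/

/-- Change of the fibre of an affine bundle along a smooth family of linear isomorphisms. -/
def AffTriv.transform {A B : Type*} [DiffeologicalSpace A] [DiffeologicalSpace B] {S : AffData A B}
    {U : Set B} {E E' : Type*} [NormedAddCommGroup E] [NormedSpace ℝ E] [DiffeologicalSpace E]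
    [NormedAddCommGroup E'] [NormedSpace ℝ E'] [DiffeologicalSpace E'] (T : AffTriv S U E)
    (hp : DSmooth S.proj) {U' : Set B} (hU' : DOpen U') (hUU' : U' ⊆ U) (G : B → E →ₗ[ℝ] E')
    (G' : B → E' → E) (hG : DSmoothOn (fun q : B × E => G q.1 q.2) {q | q.1 ∈ U'})
    (hG' : DSmoothOn (fun q : B × E' => G' q.1 q.2) {q | q.1 ∈ U'})
    (h₁ : ∀ b ∈ U', ∀ x, G' b (G b x) = x) (h₂ : ∀ b ∈ U', ∀ x, G b (G' b x) = x) :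
    AffTriv S U' E' where
  φ a := G (S.proj a) (T.φ a)
  ψ b x := T.ψ b (G' b x)
  dOpen := hU'
  proj_inv b hb x := T.proj_inv b (hUU' hb) _
  right_inv b hb x := by rw [T.proj_inv b (hUU' hb), T.right_inv b (hUU' hb), h₂ b hb]
  left_inv a ha := by rw [h₁ _ ha, T.left_inv a (hUU' ha)]
  smooth := hG.comp ((hp.dSmoothOn _).prodMk (T.smooth.mono fun _ h => hUU' h)) fun _ h => h
  smooth_inv := T.smooth_inv.comp ((dSmooth_fst.dSmoothOn _).prodMk hG') fun _ h => hUU' h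
  comb_iff t a b c ha hb hc := by
    rw [T.comb_iff t a b c (hUU' ha) hb hc, hb, hc, ← map_smul, ← map_smul, ← map_add]
    refine ⟨fun h => congrArg _ h, fun h => ?_⟩
    rw [← h₁ _ ha (T.φ c), h, h₁ _ ha]

/-- A trivialization of a special affine bundle in which `v_A` is the constant vector `(0, -1)`. -/
structure AdaptedTriv {A M : Type*} [DiffeologicalSpace A] [DiffeologicalSpace M]
    (S : SpecialAffineBundle A M) (U : Set M) (r : ℕ) extends
    AffTriv S.toAffData U (Euc r × ℝ) where
  v_eq : ∀ m ∈ U, (toAffTriv.model S.isAffineBundle.comb_proj).φ (S.v m) = (0, -1)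

namespace SpecialAffineBundle

variable {A M : Type*} [DiffeologicalSpace A] [DiffeologicalSpace M]
  (S : SpecialAffineBundle A M)

/-- Rescaling and shearing of the fibre that takes `(W₁, W₂)` to `(0, -1)`. -/
def shear {r : ℕ} (W : Euc r × ℝ) : Euc r × ℝ →ₗ[ℝ] Euc r × ℝ where
  toFun x := (x.1 + (-(x.2 / W.2)) • W.1, -(x.2 / W.2))
  map_add' x y := by
    ext1
    · simp only [Prod.fst_add, Prod.snd_add, add_div]
      module
    · simp only [Prod.snd_add, add_div]
      ring
  map_smul' t x := by
    ext1
    · simp only [Prod.smul_fst, Prod.smul_snd, smul_eq_mul, RingHom.id_apply, mul_div_assoc]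
      module
    · simp only [Prod.smul_snd, smul_eq_mul, RingHom.id_apply, mul_div_assoc]
      ring

theorem shear_apply {r : ℕ} (W x : Euc r × ℝ) :
    shear W x = (x.1 + (-(x.2 / W.2)) • W.1, -(x.2 / W.2)) := rfl

/-- A constant linear map takes the value of `v_A` at `m` to `(0, -1)`. Nearby its last component
stays nonzero, and there a smoothly varying rescaling and shear turns it into `(0, -1)` exactly. The
sign is chosen so that `[σ', σ] = f v_A` reads as `f = h' - h` for the last coordinates. -/
theorem exists_adapted : ∃ r : ℕ, ∀ m, ∃ (O : Set M), m ∈ O ∧ Nonempty (AdaptedTriv S O r) := by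
  obtain ⟨k, hk⟩ := S.isAffineBundle.locally_trivial
  have hS := S.isAffineBundle.comb_proj
  -- The truncation of the subtraction is harmless: over an existing point `m` the nonzero vector `w
  -- m` forces `k ≠ 0`.
  refine ⟨k - 1, fun m => ?_⟩
  obtain ⟨U, φ, ψ, hU, hm, hT, hc⟩ := hk m
  let T : AffTriv S.toAffData U (Euc k) :=
    { φ := φ
      ψ := fun b x => ψ (b, x)
      dOpen := hU
      proj_inv := hT.proj_inv
      right_inv := hT.right_inv
      left_inv := hT.left_inv
      smooth := hT.smooth
      smooth_inv := hT.smooth_inv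
      comb_iff := hc }
  let w : M → Euc k := fun b => (T.model hS).φ (S.v b)
  have hw : DSmoothOn w U := (T.model hS).smooth.comp (S.smooth_v.dSmoothOn _) fun b hb => by
    change S.toAffData.model.proj (S.v b) ∈ U
    rwa [S.proj_v]
  have hw0 : w m ≠ 0 := by
    intro h0
    have hp := T.proj_inv m hm 0
    refine S.v_ne_zero (T.ψ m 0) ((T.isVec_iff hS (by rwa [hp]) rfl (S.proj_v _)).2 ?_)
    rw [hp, sub_self]
    exact h0
  have hk1 : k ≠ 0 := by
    rintro rfl
    exact hw0 (Subsingleton.elim _ _)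
  have hfr : Module.finrank ℝ (Euc k) = Module.finrank ℝ (Euc (k - 1) × ℝ) := by
    rw [Module.finrank_prod, finrank_euclideanSpace_fin, finrank_euclideanSpace_fin,
      Module.finrank_self]
    omega
  let T1 := ContinuousLinearEquiv.ofFinrankEq hfr
  -- Linear automorphisms act transitively on nonzero vectors.
  obtain ⟨T2, hT2⟩ := SeparatingDual.exists_continuousLinearEquiv_apply_eq (R := ℝ) (x := T1 (w m))
    (y := ((0, -1) : Euc (k - 1) × ℝ)) (by simpa using hw0) (by simp)
  let T0 := T1.trans T2
  have hT0 : (T0 (w m)).2 = -1 := congrArg Prod.snd hT2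
  have hg : DSmoothOn (fun b => T0 (w b)) U :=
    (T0 : Euc k →L[ℝ] Euc (k - 1) × ℝ).dSmooth.comp_dSmoothOn hw
  have hO : DOpen {b | b ∈ U ∧ T0 (w b) ∈ {e : Euc (k - 1) × ℝ | e.2 ≠ 0}} :=
    hU.inter_preimage hg (isOpen_ne.preimage continuous_snd)
  have hmO : m ∈ {b | b ∈ U ∧ T0 (w b) ∈ {e : Euc (k - 1) × ℝ | e.2 ≠ 0}} :=
    ⟨hm, by rw [Set.mem_ofPred_eq, hT0]; norm_num⟩
  -- For `W = T0 (w b)` the shear is inverted by `x ↦ (x.1 - x.2 • W.1, -(x.2 * W.2))`; dividing by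
  -- `W.2` is legitimate on the chosen open set.
  refine ⟨_, hmO, ⟨⟨T.transform S.isAffineBundle.smooth_proj hO (fun _ h => h.1)
    (fun b => (shear (T0 (w b))).comp (T0 : Euc k →ₗ[ℝ] Euc (k - 1) × ℝ))
    (fun b x => T0.symm (x.1 - x.2 • (T0 (w b)).1, -(x.2 * (T0 (w b)).2))) ?_ ?_ ?_ ?_, ?_⟩⟩⟩
  · intro n p hp hb
    have h1 := isPlot_prod.1 hp
    have h2 : ContDiff ℝ ∞ (fun u => T0 (w (p u).1)) := (hg _ _ h1.1 fun u => (hb u).1).contDiff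
    have h3 : ContDiff ℝ ∞ (fun u => T0 (p u).2) := T0.contDiff.comp h1.2.contDiff
    have h4 : ContDiff ℝ ∞ (fun u => (T0 (p u).2).2 / (T0 (w (p u).1)).2) :=
      (contDiff_snd.comp h3).div (contDiff_snd.comp h2) fun u => (hb u).2
    exact (((contDiff_fst.comp h3).add (h4.neg.smul (contDiff_fst.comp h2))).prodMk h4.neg).isPlot
  · intro n p hp hb
    have h1 := isPlot_prod.1 hp
    have h2 : ContDiff ℝ ∞ (fun u => T0 (w (p u).1)) := (hg _ _ h1.1 fun u => (hb u).1).contDiff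
    have h3 : ContDiff ℝ ∞ (fun u => (p u).2) := h1.2.contDiff
    exact (T0.symm.contDiff.comp
      (((contDiff_fst.comp h3).sub ((contDiff_snd.comp h3).smul (contDiff_fst.comp h2))).prodMk
        ((contDiff_snd.comp h3).mul (contDiff_snd.comp h2)).neg)).isPlot
  · intro b hb x
    have hb2 : (T0 (w b)).2 ≠ 0 := hb.2
    change T0.symm ((shear (T0 (w b)) (T0 x)).1 - (shear (T0 (w b)) (T0 x)).2 • (T0 (w b)).1,
      -((shear (T0 (w b)) (T0 x)).2 * (T0 (w b)).2)) = x
    rw [ContinuousLinearEquiv.symm_apply_eq, shear_apply]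
    ext1
    · simp
    · field_simp
  · intro b hb x
    have hb2 : (T0 (w b)).2 ≠ 0 := hb.2
    change shear (T0 (w b)) (T0 (T0.symm _)) = x
    rw [T0.apply_symm_apply, shear_apply]
    ext1
    · simp only
      rw [neg_div, mul_div_assoc, div_self hb2]
      module
    · field_simp
  · intro b hb
    have hb2 : (T0 (w b)).2 ≠ 0 := hb.2
    obtain ⟨a, a', haa⟩ := AffData.exists_isVec (S.v b)
    have hab := haa.proj
    rw [S.proj_v] at hab
    rw [AffTriv.model_φ_eq _ hS haa (by rw [← hab.2]; exact hb)]
    change shear (T0 (w (S.proj a'))) (T0 (T.φ a')) - shear (T0 (w (S.proj a))) (T0 (T.φ a)) = _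
    rw [← hab.1, ← hab.2, ← map_sub, ← map_sub, ← T.model_φ_eq hS haa (by rw [← hab.2]; exact hb.1)]
    change shear (T0 (w b)) (T0 (w b)) = _
    rw [shear_apply, div_self hb2]
    simp

end SpecialAffineBundle

/-- The restriction of an adapted trivialization. -/
def AdaptedTriv.restrict {A M : Type*} [DiffeologicalSpace A] [DiffeologicalSpace M]
    {S : SpecialAffineBundle A M} {U U' : Set M} {r : ℕ} (T : AdaptedTriv S U r)
    (hU' : DOpen U') (h : U' ⊆ U) : AdaptedTriv S U' r where
  __ := T.toAffTriv.transform S.isAffineBundle.smooth_proj hU' h (fun _ => LinearMap.id)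
    (fun _ x => x) (dSmooth_snd.dSmoothOn _) (dSmooth_snd.dSmoothOn _) (fun _ _ _ => rfl)
    fun _ _ _ => rfl
  v_eq m hm := by
    obtain ⟨a, a', haa⟩ := AffData.exists_isVec (S.v m)
    have hab := haa.proj
    rw [S.proj_v] at hab
    have e := T.v_eq m (h hm)
    rw [AffTriv.model_φ_eq _ _ haa (by rw [← hab.2]; exact h hm)] at e
    rw [AffTriv.model_φ_eq _ _ haa (by rw [← hab.2]; exact hm)]
    exact e

/-! ## The quotients `A / ⟨v_A⟩` and `A^# / ⟨1_A⟩` in adapted trivializations -/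

variable {A M : Type*} [DiffeologicalSpace A] [DiffeologicalSpace M]
  {S : SpecialAffineBundle A M} {U : Set M} {r : ℕ}

namespace SpecialAffineBundle

theorem red_proj_ζ (a : A) : S.red.proj (S.ζ a) = S.proj a := rfl

theorem exists_ζ (y : S.Red) : ∃ a, S.ζ a = y := Quot.exists_rep y

theorem dSmooth_ζ : DSmooth S.ζ := dSmooth_quotMk (r := fun a b : A => ∃ t, S.Shift a b t)

theorem dSmooth_red_proj : DSmooth S.red.proj :=
  dSmooth_quot (r := fun a b : A => ∃ t, S.Shift a b t) S.isAffineBundle.smooth_proj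

theorem red_comb_proj (t : ℝ) (x y z : S.Red) (h : S.red.comb t x y z) :
    S.red.proj x = S.red.proj y ∧ S.red.proj z = S.red.proj x := by
  obtain ⟨a, b, c, h, rfl, rfl, rfl⟩ := h
  exact S.isAffineBundle.comb_proj _ _ _ _ h

theorem dSmooth_sharpRed_proj : DSmooth S.sharpRed.proj :=
  dSmooth_quot (r := S.constRel) (FibreFun.dSmooth_base.comp dSmooth_val)

theorem sharpRed_comb_proj (t : ℝ) (x y z : S.SharpRed) (h : S.sharpRed.comb t x y z) :
    S.sharpRed.proj x = S.sharpRed.proj y ∧ S.sharpRed.proj z = S.sharpRed.proj x := by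
  obtain ⟨φ, ψ, χ, h1, h2, -, rfl, rfl, rfl⟩ := h
  exact ⟨h1, h2⟩

end SpecialAffineBundle

namespace AdaptedTriv

open SpecialAffineBundle

variable (α : AdaptedTriv S U r)

/-- Adding `t v_A` lowers the last coordinate by `t` and changes nothing else. Hence forgetting the
last coordinate is `ζ`. -/
theorem shift_iff {a b : A} {t : ℝ} (ha : S.proj a ∈ U) :
    S.Shift a b t ↔ S.proj b = S.proj a ∧ (α.φ b).1 = (α.φ a).1 ∧
      (α.φ b).2 = (α.φ a).2 - t := by
  have hS := S.isAffineBundle.comb_proj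
  have hv := α.v_eq _ ha
  have hvU : S.toAffData.model.proj (S.v (S.proj a)) ∈ U := by rwa [S.proj_v]
  constructor
  · rintro ⟨X, hX, hab⟩
    have h1 := hab.proj
    have h2 : S.toAffData.model.proj X = S.toAffData.model.proj (S.v (S.proj a)) := by
      rw [h1.2, S.proj_v]
    have h3 := ((α.model hS).smul_iff t _ _ hvU h2).1 hX
    rw [α.model_φ_eq hS hab ha, hv] at h3
    have h4 := congrArg Prod.fst h3
    have h5 := congrArg Prod.snd h3
    simp only [Prod.fst_sub, Prod.smul_fst, smul_zero, sub_eq_zero] at h4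
    simp only [Prod.snd_sub, Prod.smul_snd, smul_eq_mul, mul_neg, mul_one] at h5
    exact ⟨h1.1.symm, h4, by linarith⟩
  · rintro ⟨h1, h2, h3⟩
    have h4 : S.toAffData.IsVec a b (S.toAffData.vec a b h1.symm) := ⟨h1.symm, rfl⟩
    refine ⟨S.toAffData.vec a b h1.symm, ?_, h4⟩
    refine ((α.model hS).smul_iff t _ _ hvU (by rw [h4.proj.2, S.proj_v])).2 ?_
    rw [α.model_φ_eq hS h4 ha, hv]
    ext1
    · simp [h2]
    · simp [h3]

open Classical in
/-- The fibre coordinate of `A / ⟨v_A⟩`. -/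
def redφ : S.Red → Euc r :=
  Quot.lift (fun a => if S.proj a ∈ U then (α.φ a).1 else 0) fun a b ⟨t, h⟩ => by
    have hp : S.proj b = S.proj a := by
      obtain ⟨X, -, hX⟩ := h
      exact hX.proj.1.symm
    by_cases ha : S.proj a ∈ U
    · rw [if_pos ha, if_pos (hp ▸ ha)]
      exact ((α.shift_iff ha).1 h).2.1.symm
    · rw [if_neg ha, if_neg (hp ▸ ha)]

theorem redφ_ζ {a : A} (ha : S.proj a ∈ U) : α.redφ (S.ζ a) = (α.φ a).1 := if_pos ha

theorem ζ_eq_iff {a b : A} (ha : S.proj a ∈ U) :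
    S.ζ b = S.ζ a ↔ S.proj b = S.proj a ∧ (α.φ b).1 = (α.φ a).1 := by
  constructor
  · intro h
    have h1 : S.proj b = S.proj a := congrArg S.red.proj h
    have h2 := congrArg α.redφ h
    rw [α.redφ_ζ ha, α.redφ_ζ (h1 ▸ ha)] at h2
    exact ⟨h1, h2⟩
  · rintro ⟨h1, h2⟩
    refine (Quot.sound ⟨(α.φ a).2 - (α.φ b).2, (α.shift_iff ha).2 ⟨h1, h2, by ring⟩⟩).symm

/-- The trivialization of `A / ⟨v_A⟩`. -/
def red : AffTriv S.red U (Euc r) where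
  φ := α.redφ
  ψ m x := S.ζ (α.ψ m (x, 0))
  dOpen := α.dOpen
  proj_inv m hm x := α.proj_inv m hm _
  right_inv m hm x := by
    rw [α.redφ_ζ (by rwa [α.proj_inv m hm]), α.right_inv m hm]
  left_inv y hy := by
    obtain ⟨a, rfl⟩ := S.exists_ζ y
    change S.proj a ∈ U at hy
    rw [α.redφ_ζ hy, α.ζ_eq_iff hy, red_proj_ζ, α.proj_inv _ hy, α.right_inv _ hy]
    exact ⟨rfl, rfl⟩
  smooth := dSmoothOn_quot (r := fun a b : A => ∃ t, S.Shift a b t)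
    (α.smooth.fst.congr fun _ ha => α.redφ_ζ ha)
  smooth_inv := dSmooth_ζ.comp_dSmoothOn (α.smooth_inv.comp ((dSmooth_fst.dSmoothOn _).prodMk
    ((dSmooth_snd.dSmoothOn _).prodMk (dSmoothOn_const _ _))) fun _ h => h)
  comb_iff t x y z hx hy hz := by
    constructor
    · rintro ⟨a, b, c, h, rfl, rfl, rfl⟩
      have h1 := (α.comb_iff t a b c hx hy hz).1 h
      rw [α.redφ_ζ hx, α.redφ_ζ (show S.proj b ∈ U from hy.symm ▸ hx),
        α.redφ_ζ (show S.proj c ∈ U from hz.symm ▸ hx), h1]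
      rfl
    · obtain ⟨a, rfl⟩ := S.exists_ζ x
      obtain ⟨b, rfl⟩ := S.exists_ζ y
      obtain ⟨c, rfl⟩ := S.exists_ζ z
      change S.proj a ∈ U at hx
      change S.proj b = S.proj a at hy
      change S.proj c = S.proj a at hz
      rw [α.redφ_ζ hx, α.redφ_ζ (a := b) (hy ▸ hx), α.redφ_ζ (a := c) (hz ▸ hx)]
      intro h
      -- Arbitrary lifts of the three classes need not form an affine combination; the lifts with
      -- last coordinate `0` do.
      refine ⟨α.ψ (S.proj a) ((α.φ a).1, 0), α.ψ (S.proj a) ((α.φ b).1, 0),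
        α.ψ (S.proj a) ((α.φ c).1, 0), ?_, ?_, ?_, ?_⟩
      · rw [α.comb_iff] <;> simp only [α.proj_inv _ hx, α.right_inv _ hx, hx]
        ext1
        · exact h
        · simp
      · rw [α.ζ_eq_iff hx, α.proj_inv _ hx, α.right_inv _ hx]
        exact ⟨rfl, rfl⟩
      · rw [α.ζ_eq_iff (hy ▸ hx), α.proj_inv _ hx, α.right_inv _ hx, hy]
        exact ⟨rfl, rfl⟩
      · rw [α.ζ_eq_iff (hz ▸ hx), α.proj_inv _ hx, α.right_inv _ hx, hz]
        exact ⟨rfl, rfl⟩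

theorem red_φ_ζ {a : A} (ha : S.proj a ∈ U) : α.red.φ (S.ζ a) = (α.φ a).1 := α.redφ_ζ ha

/-! ### Special affine functions -/

theorem sharp_affine {φ : S.Sharp} (h : φ.1.base ∈ U) (t : ℝ) (y z : Euc r × ℝ) :
    φ.1.eval (α.ψ φ.1.base (t • y + (1 - t) • z)) =
      t * φ.1.eval (α.ψ φ.1.base y) + (1 - t) * φ.1.eval (α.ψ φ.1.base z) := by
  have hp := α.proj_inv _ h
  rw [FibreFun.eval_eq _ (hp _), FibreFun.eval_eq _ (hp _), FibreFun.eval_eq _ (hp _)]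
  refine φ.2.1 t _ _ _ _ _ _ ((α.comb_iff _ _ _ _ (by rwa [hp]) (by rw [hp, hp])
    (by rw [hp, hp])).2 ?_)
  rw [α.right_inv _ h, α.right_inv _ h, α.right_inv _ h]

/-- The linear part of a special affine function, modulo its prescribed value on `v_A`. -/
def sharpLin (φ : S.Sharp) : Euc r →L[ℝ] ℝ :=
  (linPart fun e => φ.1.eval (α.ψ φ.1.base e)).comp (ContinuousLinearMap.inl ℝ (Euc r) ℝ)

/-- The prescribed value `1` on `v_A = (0, -1)` forces the coefficient `-1` on the last coordinate.
What remains free is a covector on `Euc r` and a constant. -/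
theorem sharp_apply {φ : S.Sharp} (h : φ.1.base ∈ U) (a : A) (ha : S.proj a = φ.1.base) :
    φ.1.fn a ha = α.sharpLin φ (α.φ a).1 - (α.φ a).2 + φ.1.eval (α.ψ φ.1.base 0) := by
  have hp := α.proj_inv _ h
  have hr := α.right_inv _ h
  have h1 := linPart_apply (f := fun e => φ.1.eval (α.ψ φ.1.base e)) (α.sharp_affine h)
  have h2 : linPart (fun e => φ.1.eval (α.ψ φ.1.base e)) (0, -1) = 1 := by
    rw [h1, FibreFun.eval_eq _ (hp _), FibreFun.eval_eq _ (hp _)]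
    refine φ.2.2 _ _ _ _ ((α.isVec_iff S.isAffineBundle.comb_proj (by rwa [hp])
      (by rw [hp, hp]) (by rw [hp, S.proj_v])).2 ?_)
    rw [α.v_eq _ h, hr, hr, sub_zero]
  have h3 := h1 (α.φ a)
  rw [← ha, α.left_inv a (ha.symm ▸ h), FibreFun.eval_eq _ ha] at h3
  rw [ha] at h3
  have h4 : α.φ a = ContinuousLinearMap.inl ℝ (Euc r) ℝ (α.φ a).1 +
      (-(α.φ a).2) • ((0, -1) : Euc r × ℝ) := by
    ext1 <;> simp
  have h5 : linPart (fun e => φ.1.eval (α.ψ φ.1.base e)) (α.φ a) =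
      α.sharpLin φ (α.φ a).1 - (α.φ a).2 := by
    conv_lhs => rw [h4, map_add, map_smul, h2]
    rw [smul_eq_mul, mul_one]
    rfl
  linarith

theorem eq_sharpLin {φ : S.Sharp} (h : φ.1.base ∈ U) {q : Euc r →L[ℝ] ℝ} {c : ℝ}
    (hq : ∀ a ha, φ.1.fn a ha = q (α.φ a).1 - (α.φ a).2 + c) : α.sharpLin φ = q := by
  ext x
  have hp := α.proj_inv _ h
  have hr := α.right_inv _ h
  change linPart (fun e => φ.1.eval (α.ψ φ.1.base e)) (x, 0) = q x
  rw [linPart_apply (f := fun e => φ.1.eval (α.ψ φ.1.base e)) (α.sharp_affine h), FibreFun.eval_eq _ (hp _), FibreFun.eval_eq _ (hp _), hq,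
    hq, hr, hr]
  simp

/-- Modulo constants only the covector of the normal form in `sharp_apply` survives; it is the fibre
coordinate of `A^# / ⟨1_A⟩`. -/
theorem constRel_iff {φ ψ : S.Sharp} (h : φ.1.base ∈ U) :
    S.constRel φ ψ ↔ ψ.1.base = φ.1.base ∧ α.sharpLin ψ = α.sharpLin φ := by
  constructor
  · rintro ⟨hb, c, hc⟩
    refine ⟨hb.symm, α.eq_sharpLin (c := φ.1.eval (α.ψ φ.1.base 0) + c) (hb ▸ h) fun a ha => ?_⟩
    rw [hc a (ha.trans hb.symm) ha, α.sharp_apply h]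
    ring
  · rintro ⟨hb, he⟩
    refine ⟨hb.symm, ψ.1.eval (α.ψ ψ.1.base 0) - φ.1.eval (α.ψ φ.1.base 0), fun a h1 h2 => ?_⟩
    rw [α.sharp_apply h, α.sharp_apply (hb ▸ h), he]
    ring

/-- The special affine function with given linear part, vanishing at the origin of the fibre. -/
def sharpOf {m : M} (hm : m ∈ U) (q : Euc r →L[ℝ] ℝ) : S.Sharp :=
  ⟨⟨m, fun a _ => q (α.φ a).1 - (α.φ a).2⟩, by
    constructor
    · intro t a b c ha hb hc h
      simp only at ha hb hc ⊢
      rw [(α.comb_iff t a b c (ha ▸ hm) (hb.trans ha.symm) (hc.trans ha.symm)).1 h]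
      simp only [Prod.fst_add, Prod.snd_add, Prod.smul_fst, Prod.smul_snd, map_add, map_smul,
        smul_eq_mul]
      ring
    · intro a b ha hb h
      simp only at ha hb h ⊢
      have h1 := α.model_φ_eq S.isAffineBundle.comb_proj h (ha ▸ hm)
      rw [α.v_eq m hm] at h1
      have h2 := congrArg Prod.fst h1
      have h3 := congrArg Prod.snd h1
      simp only [Prod.fst_sub, Prod.snd_sub] at h2 h3
      rw [eq_comm, sub_eq_zero] at h2
      rw [h2]
      linarith⟩

theorem sharpLin_sharpOf {m : M} (hm : m ∈ U) (q : Euc r →L[ℝ] ℝ) :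
    α.sharpLin (α.sharpOf hm q) = q :=
  α.eq_sharpLin (c := 0) hm fun _ _ => (add_zero _).symm

open Classical in
/-- The fibre coordinate of `A^# / ⟨1_A⟩`. -/
def sharpφ : S.SharpRed → (Euc r →L[ℝ] ℝ) :=
  Quot.lift (fun φ => if φ.1.base ∈ U then α.sharpLin φ else 0) fun φ ψ h => by
    by_cases hb : φ.1.base ∈ U
    · rw [if_pos hb, if_pos (h.1 ▸ hb)]
      exact ((α.constRel_iff hb).1 h).2.symm
    · rw [if_neg hb, if_neg (h.1 ▸ hb)]

theorem sharpφ_toSharpRed {φ : S.Sharp} (h : φ.1.base ∈ U) :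
    α.sharpφ (S.toSharpRed φ) = α.sharpLin φ := if_pos h

theorem _root_.DAff.SpecialAffineBundle.exists_toSharpRed (y : S.SharpRed) :
    ∃ φ, S.toSharpRed φ = y := Quot.exists_rep y

theorem toSharpRed_eq {φ : S.Sharp} {m : M} (h : φ.1.base = m) (hm : m ∈ U)
    {q : Euc r →L[ℝ] ℝ} (hq : α.sharpLin φ = q) :
    S.toSharpRed (α.sharpOf hm q) = S.toSharpRed φ :=
  (Quot.sound ((α.constRel_iff (h ▸ hm)).2 ⟨h.symm, by rw [sharpLin_sharpOf, hq]⟩)).symm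

open Classical in
/-- The trivialization of `A^# / ⟨1_A⟩`. -/
def sharpRed : AffTriv S.sharpRed U (Euc r →L[ℝ] ℝ) where
  φ := α.sharpφ
  ψ m q := if hm : m ∈ U then S.toSharpRed (α.sharpOf hm q) else (S.nonempty_sharp m).some.1
  dOpen := α.dOpen
  proj_inv m hm q := by
    rw [dif_pos hm]
    rfl
  right_inv m hm q := by
    rw [dif_pos hm, α.sharpφ_toSharpRed hm, sharpLin_sharpOf]
  left_inv y hy := by
    obtain ⟨φ, rfl⟩ := S.exists_toSharpRed y
    rw [dif_pos hy, α.sharpφ_toSharpRed hy]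
    exact α.toSharpRed_eq rfl hy rfl
  smooth := by
    refine dSmoothOn_quot (r := S.constRel) ?_
    refine DSmoothOn.congr (f := α.sharpLin) ?_ fun φ hφ => α.sharpφ_toSharpRed hφ
    intro n p hp hb
    have h1 : IsPlot (fun u => linPart fun e => (p u).1.eval (α.ψ (p u).1.base e)) := by
      refine isPlot_linPart (f := fun u e => (p u).1.eval (α.ψ (p u).1.base e)) fun e => ?_
      have h1 : DSmoothOn (fun m => α.ψ m e) U :=
        α.smooth_inv.comp ((dSmooth_id.dSmoothOn _).prodMk (dSmoothOn_const e _)) fun _ h => h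
      exact FibreFun.dSmoothOn_eval h1 (fun m hm => α.proj_inv m hm e) n (fun u => (p u).1) hp hb
    exact (h1.contDiff.clm_comp contDiff_const).isPlot
  smooth_inv := by
    intro n p hp hb
    have h1 := isPlot_prod.1 hp
    have h2 : IsPlot (fun u => α.sharpOf (hb u) (p u).2) := by
      refine isPlot_subtype.2 (FibreFun.isPlot_of h1.1 fun k f a hpa hf hpl => ?_)
      have h3 : ∀ w, S.proj (a w) ∈ U := fun w => by
        rw [hpa w]
        exact hb (f w)
      have h4 := (α.smooth _ _ hpl h3).contDiff
      have h5 := (isPlot_reparam h1.2 hf).contDiff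
      convert! (h5.clm_apply (contDiff_fst.comp h4)).sub (contDiff_snd.comp h4) using 1
      funext w
      exact FibreFun.eval_eq _ (hpa w)
    have h3 : IsPlot (fun u => S.toSharpRed (α.sharpOf (hb u) (p u).2)) :=
      dSmooth_quotMk (r := S.constRel) _ _ h2
    convert! h3 using 1
    exact funext fun u => dif_pos (hb u)
  comb_iff t x y z hx hy hz := by
    constructor
    · rintro ⟨φ, ψ, χ, h1, h2, h, rfl, rfl, rfl⟩
      change φ.1.base ∈ U at hx
      rw [α.sharpφ_toSharpRed hx, α.sharpφ_toSharpRed (φ := ψ) (h1 ▸ hx),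
        α.sharpφ_toSharpRed (φ := χ) (h2 ▸ hx)]
      refine α.eq_sharpLin (c := t * φ.1.eval (α.ψ φ.1.base 0) +
        (1 - t) * ψ.1.eval (α.ψ ψ.1.base 0)) (h2 ▸ hx) fun a ha => ?_
      rw [h a (ha.trans h2) (ha.trans (h2.trans h1)), α.sharp_apply hx, α.sharp_apply (h1 ▸ hx)]
      simp only [add_apply, smul_apply, smul_eq_mul]
      ring
    · intro h
      obtain ⟨φ, rfl⟩ := S.exists_toSharpRed x
      obtain ⟨ψ, rfl⟩ := S.exists_toSharpRed y
      obtain ⟨χ, rfl⟩ := S.exists_toSharpRed z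
      change φ.1.base ∈ U at hx
      change ψ.1.base = φ.1.base at hy
      change χ.1.base = φ.1.base at hz
      rw [α.sharpφ_toSharpRed hx, α.sharpφ_toSharpRed (φ := ψ) (hy ▸ hx),
        α.sharpφ_toSharpRed (φ := χ) (hz ▸ hx)] at h
      refine ⟨α.sharpOf hx (α.sharpLin φ), α.sharpOf hx (α.sharpLin ψ),
        α.sharpOf hx (α.sharpLin χ), rfl, rfl, fun a _ _ _ => ?_, α.toSharpRed_eq rfl hx rfl,
        α.toSharpRed_eq hy hx rfl, α.toSharpRed_eq hz hx rfl⟩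
      simp only [sharpOf, h]
      simp only [add_apply, smul_apply, smul_eq_mul]
      ring

end AdaptedTriv

/-! ## Affine differentials in coordinates -/

/-! ### Vertical and horizontal components of covectors -/

section CovectorSplitting

variable {V : Type*} [NormedAddCommGroup V] [NormedSpace ℝ V] [DiffeologicalSpace V]
  [IsContDiffCompatible V] [FiniteDimensional ℝ V]
  {E : Type*} [NormedAddCommGroup E] [NormedSpace ℝ E] [DiffeologicalSpace E]
  [IsContDiffCompatible E] [FiniteDimensional ℝ E]

/-- The covector on `V × E` with the given components on `E` and on `V`. -/
def joinCovec (q : E →L[ℝ] ℝ) (p : V →L[ℝ] ℝ) : V × E →L[ℝ] ℝ :=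
  p.comp (ContinuousLinearMap.fst ℝ V E) + q.comp (ContinuousLinearMap.snd ℝ V E)

theorem joinCovec_apply (q : E →L[ℝ] ℝ) (p : V →L[ℝ] ℝ) (x : V × E) :
    joinCovec q p x = p x.1 + q x.2 := rfl

/-- The component on `E` of a covector on `V × E`. -/
def vertCovec (L : V × E →L[ℝ] ℝ) : E →L[ℝ] ℝ := L.comp (ContinuousLinearMap.inr ℝ V E)

/-- The component on `V` of a covector on `V × E`. -/
def horCovec (L : V × E →L[ℝ] ℝ) : V →L[ℝ] ℝ := L.comp (ContinuousLinearMap.inl ℝ V E)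

theorem vertCovec_apply (L : V × E →L[ℝ] ℝ) (x : E) : vertCovec L x = L (0, x) := rfl

theorem horCovec_apply (L : V × E →L[ℝ] ℝ) (x : V) : horCovec L x = L (x, 0) := rfl

theorem covec_apply_eq (L : V × E →L[ℝ] ℝ) (x : V × E) :
    L x = horCovec L x.1 + vertCovec L x.2 := by
  rw [vertCovec_apply, horCovec_apply, ← map_add, Prod.mk_add_mk, add_zero, zero_add]

theorem vertCovec_joinCovec (q : E →L[ℝ] ℝ) (p : V →L[ℝ] ℝ) : vertCovec (joinCovec q p) = q := by
  ext x
  rw [vertCovec_apply, joinCovec_apply, map_zero, zero_add]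

theorem horCovec_joinCovec (q : E →L[ℝ] ℝ) (p : V →L[ℝ] ℝ) : horCovec (joinCovec q p) = p := by
  ext x
  rw [horCovec_apply, joinCovec_apply, map_zero, add_zero]

theorem covec_ext_iff {L L' : V × E →L[ℝ] ℝ} :
    L = L' ↔ vertCovec L = vertCovec L' ∧ horCovec L = horCovec L' := by
  refine ⟨fun h => h ▸ ⟨rfl, rfl⟩, fun ⟨h1, h2⟩ => ?_⟩
  refine ContinuousLinearMap.ext fun x => ?_
  rw [covec_apply_eq, covec_apply_eq L', h1, h2]

variable (V E) in
/-- A point of `E` and a covector on `V × E`, split into its components. -/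
def covecSplit : E × (V × E →L[ℝ] ℝ) ≃ E × (E →L[ℝ] ℝ) × (V →L[ℝ] ℝ) where
  toFun x := (x.1, vertCovec x.2, horCovec x.2)
  invFun x := (x.1, joinCovec x.2.1 x.2.2)
  left_inv _ := Prod.ext rfl (covec_ext_iff.2 ⟨vertCovec_joinCovec _ _, horCovec_joinCovec _ _⟩)
  right_inv _ := Prod.ext rfl (Prod.ext (vertCovec_joinCovec _ _) (horCovec_joinCovec _ _))

theorem dSmooth_covecSplit : DSmooth (covecSplit V E) := by
  refine ContDiff.dSmooth ?_
  exact contDiff_fst.prodMk ((contDiff_snd.clm_comp contDiff_const).prodMk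
    (contDiff_snd.clm_comp contDiff_const))

theorem dSmooth_covecSplit_symm : DSmooth (covecSplit V E).symm := by
  refine ContDiff.dSmooth ?_
  exact contDiff_fst.prodMk (((contDiff_snd.comp contDiff_snd).clm_comp contDiff_const).add
    ((contDiff_fst.comp contDiff_snd).clm_comp contDiff_const))

end CovectorSplitting

variable {A M : Type*} [DiffeologicalSpace A] [DiffeologicalSpace M]
  {S : SpecialAffineBundle A M} {d r : ℕ} {c : DChart M (Euc d)}

namespace SpecialAffineBundle

/-- `σ` is a smooth section of `ζ` near `x`. -/
def IsSectionNear (S : SpecialAffineBundle A M) (x : S.Red) (σ : S.Red → A) : Prop :=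
  ∃ O : Set S.Red, DOpen O ∧ x ∈ O ∧ DSmoothOn σ O ∧ ∀ y ∈ O, S.ζ (σ y) = y

/-- The affine differential of a germ of a section. -/
def Germ.affDifferential (g : S.Germ) : S.Phase := Quot.mk _ g

theorem Shift.proj {a b : A} {t : ℝ} (h : S.Shift a b t) : S.proj a = S.proj b := by
  obtain ⟨X, -, hX⟩ := h
  exact hX.proj.1

theorem exists_isAffDifferential (θ : S.Phase) : ∃ σ, S.IsAffDifferential (S.phasePt θ) σ θ := by
  obtain ⟨g, rfl⟩ := Quot.exists_rep θ
  exact ⟨g.sec, g, rfl, rfl, rfl⟩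

theorem IsAffDifferential.pt {x : S.Red} {σ : S.Red → A} {θ : S.Phase}
    (h : S.IsAffDifferential x σ θ) : S.phasePt θ = x := by
  obtain ⟨g, rfl, -, rfl⟩ := h
  rfl

theorem IsAffDifferential.isSectionNear {x : S.Red} {σ : S.Red → A} {θ : S.Phase}
    (h : S.IsAffDifferential x σ θ) : S.IsSectionNear x σ := by
  obtain ⟨g, rfl, rfl, -⟩ := h
  exact g.smooth

theorem dSmooth_phasePt : DSmooth S.phasePt := by
  refine dSmooth_generateFrom ?_
  rintro n q ⟨x, σ, W, hx, -, -, -, -, h⟩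
  convert! hx using 1
  exact funext fun u => (h u).pt

end SpecialAffineBundle

/-! ### The affine phase bundle over `A̲` in an adapted chart -/

namespace AdaptedTriv

open SpecialAffineBundle

variable (α : AdaptedTriv S c.source r)

/-- The chart of `A / ⟨v_A⟩`. -/
def redChart : DChart S.Red (Euc d × Euc r) := c.ofTriv α.red.toTriv dSmooth_red_proj

theorem redChart_κ (y : S.Red) : α.redChart.κ y = (c.κ (S.red.proj y), α.red.φ y) := rfl

theorem redChart_ψ_proj (e : Euc d × Euc r) : S.red.proj (α.redChart.ψ e) = c.ψ e.1 :=
  α.red.proj_inv _ (c.mem_source _) _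

/-- The function that represents a section of `ζ`. -/
def height (σ : S.Red → A) (y : S.Red) : ℝ := (α.φ (σ y)).2

/-- The section of `ζ` represented by a function. -/
def secOf (f : S.Red → ℝ) (y : S.Red) : A := α.ψ (S.red.proj y) (α.red.φ y, f y)

variable {α}

theorem φ_of_ζ_eq {a : A} {y : S.Red} (h : S.ζ a = y) (hy : S.red.proj y ∈ c.source) :
    S.proj a = S.red.proj y ∧ (α.φ a).1 = α.red.φ y := by
  subst h
  exact ⟨rfl, (α.red_φ_ζ hy).symm⟩

/-- Differences of sections become differences of the representing functions, with the right sign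
because `v_A` is `(0, -1)`. This reduces affine differentials to ordinary derivatives. -/
theorem shift_height {σ σ' : S.Red → A} {y : S.Red} {t : ℝ} (hy : S.red.proj y ∈ c.source)
    (h : S.ζ (σ y) = y) (h' : S.ζ (σ' y) = y) :
    S.Shift (σ' y) (σ y) t ↔ t = α.height σ' y - α.height σ y := by
  obtain ⟨h1, h2⟩ := φ_of_ζ_eq (α := α) h hy
  obtain ⟨h1', h2'⟩ := φ_of_ζ_eq (α := α) h' hy
  rw [α.shift_iff (by rw [h1']; exact hy), h1, h1', h2, h2']
  simp only [true_and, height]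
  constructor <;> intro h <;> linarith

theorem secOf_ψ {f : S.Red → ℝ} {y : S.Red} (hy : S.red.proj y ∈ c.source) :
    S.ζ (α.secOf f y) = y ∧ S.proj (α.secOf f y) = S.red.proj y ∧
      α.φ (α.secOf f y) = (α.red.φ y, f y) := by
  have h1 := α.proj_inv _ hy (α.red.φ y, f y)
  have h2 := α.right_inv _ hy (α.red.φ y, f y)
  refine ⟨?_, h1, h2⟩
  obtain ⟨a, rfl⟩ := S.exists_ζ y
  refine (α.ζ_eq_iff hy).2 ⟨h1, ?_⟩
  change (α.φ (α.ψ _ _)).1 = _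
  rw [h2, ← α.red_φ_ζ hy]

theorem height_secOf {f : S.Red → ℝ} {y : S.Red} (hy : S.red.proj y ∈ c.source) :
    α.height (α.secOf f) y = f y := congrArg Prod.snd (secOf_ψ hy).2.2

theorem dSmoothOn_secOf {f : S.Red → ℝ} {O : Set S.Red} (hO : ∀ y ∈ O, S.red.proj y ∈ c.source)
    (hf : DSmoothOn f O) : DSmoothOn (α.secOf f) O :=
  α.smooth_inv.comp ((dSmooth_red_proj.dSmoothOn O).prodMk
    ((α.red.smooth.mono hO).prodMk hf)) hO

theorem isSectionNear_secOf {f : S.Red → ℝ} (hf : DSmoothOn f α.redChart.source) {x : S.Red}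
    (hx : x ∈ α.redChart.source) : S.IsSectionNear x (α.secOf f) :=
  ⟨α.redChart.source, α.redChart.dOpen, hx, dSmoothOn_secOf (fun _ h => h) hf,
    fun _ hy => (secOf_ψ hy).1⟩

theorem dSmoothOn_height {σ : S.Red → A} {O : Set S.Red} (hσ : DSmoothOn σ O)
    (hs : ∀ y ∈ O, S.ζ (σ y) = y) : DSmoothOn (α.height σ) (O ∩ α.redChart.source) :=
  α.smooth.snd.comp (hσ.mono Set.inter_subset_left) fun y hy => by
    change S.proj (σ y) ∈ c.source
    rw [(φ_of_ζ_eq (α := α) (hs y hy.1) hy.2).1]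
    exact hy.2

theorem differentiableAt_height {σ : S.Red → A} {x : S.Red} (hx : x ∈ α.redChart.source)
    (hσ : S.IsSectionNear x σ) :
    DifferentiableAt ℝ (fun e => α.height σ (α.redChart.ψ e)) (α.redChart.κ x) := by
  obtain ⟨O, hO, hxO, hs, hζ⟩ := hσ
  exact α.redChart.differentiableAt (hO.inter α.redChart.dOpen) (dSmoothOn_height hs hζ)
    ⟨hxO, hx⟩ hx

theorem difference_eventuallyEq {σ σ' : S.Red → A} {f : S.Red → ℝ} {x : S.Red}
    (hx : x ∈ α.redChart.source) (hσ : S.IsSectionNear x σ) (hσ' : S.IsSectionNear x σ')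
    {O : Set S.Red} (hO : DOpen O) (hxO : x ∈ O) (h : S.IsDifference σ' σ f O) :
    (fun e => f (α.redChart.ψ e)) =ᶠ[𝓝 (α.redChart.κ x)]
      fun e => α.height σ' (α.redChart.ψ e) - α.height σ (α.redChart.ψ e) := by
  obtain ⟨O₁, hO₁, hx₁, -, hζ⟩ := hσ
  obtain ⟨O₂, hO₂, hx₂, -, hζ'⟩ := hσ'
  filter_upwards [α.redChart.eventually_mem hO hxO hx, α.redChart.eventually_mem hO₁ hx₁ hx,
    α.redChart.eventually_mem hO₂ hx₂ hx] with e h0 h1 h2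
  exact (shift_height (α.redChart.mem_source e) (hζ _ h1) (hζ' _ h2)).1 (h _ h0)

/-- Near `x` the function `f` is the difference of the heights. Hence equivalent germs have equal
derivatives of heights, and in an adapted chart `P A` looks like the cotangent bundle of `A̲`. -/
theorem fderiv_difference {σ σ' : S.Red → A} {f : S.Red → ℝ} {x : S.Red}
    (hx : x ∈ α.redChart.source) (hσ : S.IsSectionNear x σ) (hσ' : S.IsSectionNear x σ')
    {O : Set S.Red} (hO : DOpen O) (hxO : x ∈ O) (h : S.IsDifference σ' σ f O) :
    HasFDerivAt (fun e => f (α.redChart.ψ e))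
      (fderiv ℝ (fun e => α.height σ' (α.redChart.ψ e)) (α.redChart.κ x) -
        fderiv ℝ (fun e => α.height σ (α.redChart.ψ e)) (α.redChart.κ x)) (α.redChart.κ x) :=
  ((differentiableAt_height hx hσ').hasFDerivAt.sub
    (differentiableAt_height hx hσ).hasFDerivAt).congr_of_eventuallyEq
    (difference_eventuallyEq hx hσ hσ' hO hxO h)

variable (α)

open Classical in
/-- The coordinates of an affine differential: the differential of the function that represents
the section. -/
def momentum : S.Phase → (Euc d × Euc r →L[ℝ] ℝ) :=
  Quot.lift (fun g => if g.pt ∈ α.redChart.source then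
      fderiv ℝ (fun e => α.height g.sec (α.redChart.ψ e)) (α.redChart.κ g.pt) else 0)
    fun g g' h => by
    obtain ⟨hpt, O, f, hO, hx, hd, hz⟩ := h
    by_cases hg : g.pt ∈ α.redChart.source
    · have h1 := fderiv_difference (α := α) hg (hpt ▸ g'.smooth) g.smooth hO hx hd
      rw [α.redChart.hasZeroDifferential_iff hg h1.differentiableAt, h1.fderiv, sub_eq_zero] at hz
      rw [if_pos hg, if_pos (hpt ▸ hg), hz, hpt]
    · rw [if_neg hg, if_neg (hpt ▸ hg)]

variable {α}

theorem momentum_eq {x : S.Red} {σ : S.Red → A} {θ : S.Phase} (h : S.IsAffDifferential x σ θ)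
    (hx : x ∈ α.redChart.source) :
    HasFDerivAt (fun e => α.height σ (α.redChart.ψ e)) (α.momentum θ) (α.redChart.κ x) := by
  obtain ⟨g, rfl, rfl, rfl⟩ := h
  have e : α.momentum g.affDifferential =
    fderiv ℝ (fun e => α.height g.sec (α.redChart.ψ e)) (α.redChart.κ g.pt) := if_pos hx
  change HasFDerivAt _ (α.momentum g.affDifferential) _
  rw [e]
  exact (differentiableAt_height hx g.smooth).hasFDerivAt

/-- As for covectors, every smooth section whose height has the right derivative represents `θ`.
Sections linear in the chart, and affine ones, can therefore be used as representatives. -/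
theorem isAffDifferential_of {θ : S.Phase} {x : S.Red} (hθ : S.phasePt θ = x)
    (hx : x ∈ α.redChart.source) {σ : S.Red → A} (hσ : S.IsSectionNear x σ)
    (h : HasFDerivAt (fun e => α.height σ (α.redChart.ψ e)) (α.momentum θ) (α.redChart.κ x)) :
    S.IsAffDifferential x σ θ := by
  subst hθ
  obtain ⟨σ', hσ'⟩ := S.exists_isAffDifferential θ
  have h' := momentum_eq hσ' hx
  obtain ⟨g, hg, rfl, hθ⟩ := hσ'
  refine ⟨⟨S.phasePt θ, σ, hσ⟩, rfl, rfl, hθ.trans (Quot.sound ⟨hg, ?_⟩)⟩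
  have hgs : S.IsSectionNear (S.phasePt θ) g.sec := hg ▸ g.smooth
  obtain ⟨O, hO, hxO, -, hζ⟩ := hσ
  obtain ⟨O', hO', hxO', -, hζ'⟩ := hgs
  refine ⟨O ∩ O' ∩ α.redChart.source, fun y => α.height g.sec y - α.height σ y,
    (hO.inter hO').inter α.redChart.dOpen, hg ▸ ⟨⟨hxO, hxO'⟩, hx⟩,
    fun y hy => (shift_height hy.2 (hζ y hy.1.1) (hζ' y hy.1.2)).2 rfl, ?_⟩
  rw [hg]
  have h2 := h'.sub h
  rw [sub_self] at h2
  exact (α.redChart.hasZeroDifferential_iff hx h2.differentiableAt).2 h2.fderiv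

theorem hasFDerivAt_of_eq {f : S.Red → ℝ} {e₀ : Euc d × Euc r} {L : Euc d × Euc r →L[ℝ] ℝ} {k : ℝ}
    (hf : ∀ e, f (α.redChart.ψ e) = L e + k) :
    HasFDerivAt (fun e => α.height (α.secOf f) (α.redChart.ψ e)) L e₀ := by
  have : (fun e => α.height (α.secOf f) (α.redChart.ψ e)) = fun e => L e + k :=
    funext fun e => by rw [height_secOf (α.redChart.mem_source e), hf]
  rw [this]
  exact L.hasFDerivAt.add_const k

/-- The section represented by a linear function in the chart. -/
theorem isAffDifferential_linFun {θ : S.Phase} {x : S.Red} (hθ : S.phasePt θ = x)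
    (hx : x ∈ α.redChart.source) {L : Euc d × Euc r →L[ℝ] ℝ} (h : α.momentum θ = L) :
    S.IsAffDifferential x (α.secOf (α.redChart.linFun L)) θ := by
  refine isAffDifferential_of hθ hx
    (isSectionNear_secOf (α.redChart.dSmoothOn_linFun L) hx) ?_
  rw [h]
  refine hasFDerivAt_of_eq (k := 0) fun e => ?_
  rw [add_zero]
  exact congrFun (α.redChart.linFun_ψ L) e

variable (α)

/-- The affine differential with given coordinates. -/
def phaseOf {x : S.Red} (hx : x ∈ α.redChart.source) (L : Euc d × Euc r →L[ℝ] ℝ) : S.Phase :=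
  Germ.affDifferential ⟨x, α.secOf (α.redChart.linFun L),
    isSectionNear_secOf (α.redChart.dSmoothOn_linFun L) hx⟩

theorem momentum_phaseOf {x : S.Red} (hx : x ∈ α.redChart.source) (L : Euc d × Euc r →L[ℝ] ℝ) :
    α.momentum (α.phaseOf hx L) = L :=
  HasFDerivAt.unique (momentum_eq (x := x) ⟨_, rfl, rfl, rfl⟩ hx) <| hasFDerivAt_of_eq (k := 0)
    fun e => (congrFun (α.redChart.linFun_ψ L) e).trans (add_zero _).symm

theorem phaseOf_momentum {θ : S.Phase} (h : S.phasePt θ ∈ α.redChart.source) :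
    α.phaseOf h (α.momentum θ) = θ := by
  obtain ⟨g, hg, hg', hθ⟩ := isAffDifferential_linFun (α := α) rfl h rfl
  refine Eq.trans (congrArg Germ.affDifferential ?_) hθ.symm
  obtain ⟨pt, fn, hs⟩ := g
  subst hg hg'
  rfl

open Classical in
/-- The trivialization of `P A → A / ⟨v_A⟩`. -/
def phase : AffTriv S.phaseAff₁ {y | S.red.proj y ∈ c.source} (Euc d × Euc r →L[ℝ] ℝ) where
  φ := α.momentum
  ψ x L := if h : S.red.proj x ∈ c.source then α.phaseOf h L
    else α.phaseOf (α.redChart.mem_source 0) 0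
  dOpen := α.redChart.dOpen
  proj_inv x h L := by
    change S.red.proj x ∈ c.source at h
    rw [dif_pos h]
    rfl
  right_inv x h L := by
    change S.red.proj x ∈ c.source at h
    rw [dif_pos h]
    exact α.momentum_phaseOf h L
  left_inv θ h := by
    change S.red.proj (S.phaseAff₁.proj θ) ∈ c.source at h
    rw [dif_pos h]
    exact α.phaseOf_momentum h
  smooth := by
    refine dSmoothOn_generateFrom ?_
    rintro n q ⟨x, σ, W, hx, hW, hxW, hσ, hζ, h⟩ k g hg hs
    have hs' : ∀ w, x (g w) ∈ α.redChart.source := fun w => (h (g w)).pt ▸ hs w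
    have hG : DSmooth (fun r : Euc k × S.Red => (g r.1, r.2)) := dSmoothOn_univ.1
      (((hg.dSmooth.comp dSmooth_fst).dSmoothOn _).prodMk (dSmooth_snd.dSmoothOn _))
    -- The height of the family makes sense where the sections are defined and the point lies over
    -- the chart; both conditions are open and hold along the graph.
    have hF : DSmoothOn (fun r : Euc k × S.Red => (α.φ (σ (g r.1, r.2))).2)
        ((fun r : Euc k × S.Red => (g r.1, r.2)) ⁻¹' W ∩ Prod.snd ⁻¹' α.redChart.source) :=
      α.smooth.snd.comp (hσ.comp (hG.dSmoothOn _) fun _ h => h.1) fun r hr => by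
        change S.proj (σ _) ∈ c.source
        rw [(φ_of_ζ_eq (α := α) (hζ _ hr.1) hr.2).1]
        exact hr.2
    have key := α.redChart.contDiff_fderiv
      ((hW.preimage hG).inter (α.redChart.dOpen.preimage dSmooth_snd)) hF
      (isPlot_reparam hx hg) hs' fun w => ⟨hxW (g w), hs' w⟩
    convert! key.isPlot using 1
    funext w
    exact (momentum_eq (h (g w)) (hs' w)).fderiv.symm
  smooth_inv := by
    intro n p hp hU
    have h1 := isPlot_prod.1 hp
    have hsrc : DOpen {r : Euc n × S.Red | r.2 ∈ α.redChart.source} :=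
      α.redChart.dOpen.preimage dSmooth_snd
    refine DiffeologicalSpace.isPlot_generatedFrom_of_mem
      ⟨fun u => (p u).1, fun r => α.secOf (α.redChart.linFun (p r.1).2) r.2,
        {r | r.2 ∈ α.redChart.source}, h1.1, hsrc, hU, ?_, fun r hr => (secOf_ψ hr).1, fun u => ?_⟩
    · refine α.smooth_inv.comp (((dSmooth_red_proj.comp dSmooth_snd).dSmoothOn _).prodMk
        ((α.red.smooth.comp (dSmooth_snd.dSmoothOn _) fun _ h => h).prodMk ?_)) fun _ h => h
      exact ((dSmooth_snd.comp (hp.dSmooth.comp dSmooth_fst)).dSmoothOn _).clm_apply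
        (α.redChart.smooth.comp (dSmooth_snd.dSmoothOn _) fun _ h => h)
    · exact ⟨⟨(p u).1, α.secOf (α.redChart.linFun (p u).2),
        isSectionNear_secOf (α.redChart.dSmoothOn_linFun _) (hU u)⟩, rfl, rfl, dif_pos (hU u)⟩
  comb_iff t θ₁ θ₂ θ₃ h₁ h₂ h₃ := by
    change S.phasePt θ₂ = S.phasePt θ₁ at h₂
    change S.phasePt θ₃ = S.phasePt θ₁ at h₃
    change S.phasePt θ₁ ∈ α.redChart.source at h₁
    constructor
    · rintro ⟨x, σ₁, σ₂, σ₃, d₁, d₂, d₃, O, hO, hxO, hc⟩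
      obtain rfl := d₁.pt
      obtain ⟨O₁, hO₁, hx₁, -, hζ₁⟩ := d₁.isSectionNear
      obtain ⟨O₂, hO₂, hx₂, -, hζ₂⟩ := d₂.isSectionNear
      obtain ⟨O₃, hO₃, hx₃, -, hζ₃⟩ := d₃.isSectionNear
      -- The heights satisfy the affine relation only near the point, so they are compared as germs
      -- before differentiating.
      refine (momentum_eq d₃ h₁).unique ((((momentum_eq d₁ h₁).const_smul t).add
        ((momentum_eq d₂ h₁).const_smul (1 - t))).congr_of_eventuallyEq ?_)
      filter_upwards [α.redChart.eventually_mem hO hxO h₁, α.redChart.eventually_mem hO₁ hx₁ h₁,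
        α.redChart.eventually_mem hO₂ hx₂ h₁, α.redChart.eventually_mem hO₃ hx₃ h₁]
        with e e0 e1 e2 e3
      have k1 := (φ_of_ζ_eq (α := α) (hζ₁ _ e1) (α.redChart.mem_source e)).1
      have k2 := (φ_of_ζ_eq (α := α) (hζ₂ _ e2) (α.redChart.mem_source e)).1
      have k3 := (φ_of_ζ_eq (α := α) (hζ₃ _ e3) (α.redChart.mem_source e)).1
      exact congrArg Prod.snd ((α.comb_iff _ _ _ _ (by rw [k1]; exact α.redChart.mem_source e)
        (k2.trans k1.symm) (k3.trans k1.symm)).1 (hc _ e0))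
    · intro h
      refine ⟨S.phasePt θ₁, _, _, _, isAffDifferential_linFun rfl h₁ rfl,
        isAffDifferential_linFun h₂ h₁ rfl, isAffDifferential_linFun h₃ h₁ h,
        α.redChart.source, α.redChart.dOpen, h₁, fun y hy => ?_⟩
      obtain ⟨-, k1, l1⟩ := secOf_ψ (α := α) (f := α.redChart.linFun (α.momentum θ₁)) hy
      obtain ⟨-, k2, l2⟩ := secOf_ψ (α := α) (f := α.redChart.linFun (α.momentum θ₂)) hy
      obtain ⟨-, k3, l3⟩ := secOf_ψ (α := α)
        (f := α.redChart.linFun (t • α.momentum θ₁ + (1 - t) • α.momentum θ₂)) hy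
      refine (α.comb_iff _ _ _ _ (by rw [k1]; exact hy) (k2.trans k1.symm) (k3.trans k1.symm)).2 ?_
      rw [l1, l2, l3]
      ext1
      · change _ = t • _ + (1 - t) • _
        module
      · rfl

end AdaptedTriv

/-! ## The double affine phase bundle -/

variable {A M : Type*} [DiffeologicalSpace A] [DiffeologicalSpace M]
  {S : SpecialAffineBundle A M} {d r : ℕ} {c : DChart M (Euc d)}

namespace AdaptedTriv

open SpecialAffineBundle

section

variable (α : AdaptedTriv S c.source r)

/-- The affine section over the chart with differential `L`, based at `m`. -/
def affSec (L : Euc d × Euc r →L[ℝ] ℝ) (m : M) : S.Red → A :=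
  α.secOf fun y => horCovec L (c.κ (S.red.proj y) - c.κ m) + vertCovec L (α.red.φ y)

end

variable {α : AdaptedTriv S c.source r}

theorem isAffineSection_affSec (L : Euc d × Euc r →L[ℝ] ℝ) (m : M) :
    S.IsAffineSection c.source (α.affSec L m) where
  smooth := by
    refine dSmoothOn_secOf (fun _ h => h) ?_
    refine DSmoothOn.add ((horCovec L).dSmooth.comp_dSmoothOn (DSmoothOn.sub ?_
      (dSmoothOn_const _ _))) ((vertCovec L).dSmooth.comp_dSmoothOn α.red.smooth)
    exact c.smooth.comp (dSmooth_red_proj.dSmoothOn _) fun _ h => h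
  section_eq y hy := (secOf_ψ hy).1
  affine t x y z hx h := by
    obtain ⟨hy, hz⟩ := red_comb_proj _ _ _ _ h
    rw [α.red.comb_iff t x y z hx hy.symm hz] at h
    obtain ⟨-, k1, l1⟩ := secOf_ψ (α := α)
      (f := fun y => horCovec L (c.κ (S.red.proj y) - c.κ m) + vertCovec L (α.red.φ y)) hx
    obtain ⟨-, k2, l2⟩ := secOf_ψ (α := α)
      (f := fun y => horCovec L (c.κ (S.red.proj y) - c.κ m) + vertCovec L (α.red.φ y)) (hy ▸ hx)
    obtain ⟨-, k3, l3⟩ := secOf_ψ (α := α) (y := z)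
      (f := fun y => horCovec L (c.κ (S.red.proj y) - c.κ m) + vertCovec L (α.red.φ y))
      (hz.symm ▸ hx)
    refine (α.comb_iff _ _ _ _ (by unfold affSec; rw [k1]; exact hx)
      (by unfold affSec; rw [k1, k2, hy]) (by unfold affSec; rw [k1, k3, hz])).2 ?_
    unfold affSec
    rw [l1, l2, l3]
    ext1
    · exact h
    · simp only [h, hz, ← hy, map_add, map_smul, Prod.snd_add, Prod.smul_snd, smul_eq_mul]
      ring

theorem isAffDifferential_affSec {θ : S.Phase} {x : S.Red} (hθ : S.phasePt θ = x)
    (hx : x ∈ α.redChart.source) (m : M) {L : Euc d × Euc r →L[ℝ] ℝ} (h : α.momentum θ = L) :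
    S.IsAffDifferential x (α.affSec L m) θ := by
  have hs := isAffineSection_affSec (α := α) L m
  refine isAffDifferential_of hθ hx ⟨_, α.redChart.dOpen, hx, hs.smooth, hs.section_eq⟩ ?_
  rw [h]
  refine hasFDerivAt_of_eq (k := -(horCovec L (c.κ m))) fun e => ?_
  have h1 : α.red.φ (α.redChart.ψ e) = e.2 := congrArg Prod.snd (α.redChart.right_inv e)
  rw [redChart_ψ_proj, c.right_inv, h1, map_sub, covec_apply_eq L e]
  ring

/-- An affine section is represented by functions that are affine on the fibres. -/
theorem height_affine {U : Set M} {σ : S.Red → A} (hσ : S.IsAffineSection U σ) {b : Euc d}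
    (hb : c.ψ b ∈ U) (t : ℝ) (y z : Euc r) :
    α.height σ (α.redChart.ψ (b, t • y + (1 - t) • z)) =
      t * α.height σ (α.redChart.ψ (b, y)) + (1 - t) * α.height σ (α.redChart.ψ (b, z)) := by
  have hp : ∀ w, S.red.proj (α.redChart.ψ (b, w)) = c.ψ b := fun w => α.redChart_ψ_proj (b, w)
  have hφ : ∀ w, α.red.φ (α.redChart.ψ (b, w)) = w := fun w =>
    congrArg Prod.snd (α.redChart.right_inv (b, w))
  have hc : S.red.comb t (α.redChart.ψ (b, y)) (α.redChart.ψ (b, z))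
      (α.redChart.ψ (b, t • y + (1 - t) • z)) := by
    rw [α.red.comb_iff _ _ _ _ (by rw [hp]; exact c.mem_source _) (by rw [hp, hp])
      (by rw [hp, hp]), hφ, hφ, hφ]
  have h := hσ.affine _ _ _ _ (by rwa [hp]) hc
  have hs : ∀ w, S.proj (σ (α.redChart.ψ (b, w))) = c.ψ b := fun w =>
    ((φ_of_ζ_eq (α := α) (hσ.section_eq _ (by rwa [hp])) (by rw [hp]; exact c.mem_source _)).1).trans
      (hp w)
  exact congrArg Prod.snd ((α.comb_iff _ _ _ _ (by rw [hs]; exact c.mem_source _) (by rw [hs, hs])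
    (by rw [hs, hs])).1 h)

theorem vertCovec_hasFDerivAt {f : S.Red → ℝ} {e : Euc d × Euc r} {L : Euc d × Euc r →L[ℝ] ℝ}
    (h : HasFDerivAt (fun e => f (α.redChart.ψ e)) L e) :
    HasFDerivAt (fun w => f (α.redChart.ψ (e.1, w))) (vertCovec L) e.2 :=
  HasFDerivAt.comp e.2 (g := fun e => f (α.redChart.ψ e)) (f := fun w => (e.1, w)) h
    (hasFDerivAt_prodMk_right e.1 e.2)

theorem horCovec_hasFDerivAt {f : S.Red → ℝ} {e : Euc d × Euc r} {L : Euc d × Euc r →L[ℝ] ℝ}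
    (h : HasFDerivAt (fun e => f (α.redChart.ψ e)) L e) :
    HasFDerivAt (fun w => f (α.redChart.ψ (w, e.2))) (horCovec L) e.1 :=
  HasFDerivAt.comp e.1 (g := fun e => f (α.redChart.ψ e)) (f := fun w => (w, e.2)) h
    (hasFDerivAt_prodMk_left e.1 e.2)

theorem mem_redChart {y : S.Red} (hy : S.red.proj y ∈ c.source) : y ∈ α.redChart.source := hy

/-- The image of an affine differential in `A^# / ⟨1_A⟩` in coordinates. -/
theorem sharpRed_φ_phaseSharp {θ : S.Phase} (hθ : S.phasePt θ ∈ α.redChart.source) :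
    α.sharpRed.φ (S.phaseSharp θ).1 = vertCovec (α.momentum θ) := by
  set m := S.red.proj (S.phasePt θ) with hmdef
  have hm : m ∈ c.source := hθ
  set L := α.momentum θ with hL
  have hs := isAffineSection_affSec (α := α) L m
  have key := Classical.epsilon_spec (p := fun Y : {Y : S.SharpRed // S.sharpRed.proj Y = m} =>
    ∃ (U : Set M) (σ : S.Red → A) (φ : S.Sharp), DOpen U ∧ S.red.proj (S.phasePt θ) ∈ U ∧
      S.IsAffineSection U σ ∧ S.IsAffDifferential (S.phasePt θ) σ θ ∧
      (∀ a h, S.Shift (σ (S.ζ a)) a (φ.1.fn a h)) ∧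
      φ.1.base = S.red.proj (S.phasePt θ) ∧ Y.1 = S.toSharpRed φ)
    -- The affine section is based at `m`, so its horizontal term vanishes on the fibre over `m`,
    -- and there `f_σ` is exactly `q y - z` with `q` the vertical part of `L`.
    ⟨⟨S.toSharpRed (α.sharpOf hm (vertCovec L)), rfl⟩, c.source, α.affSec L m,
      α.sharpOf hm (vertCovec L), c.dOpen, hm, hs, isAffDifferential_affSec rfl hθ m rfl,
      fun a h => ?_, rfl, rfl⟩
  · obtain ⟨U, σ, φ, hU, hmU, hσ, hd, hf, hb, hY⟩ := key
    have hY' : (S.phaseSharp θ).1 = S.toSharpRed φ := hY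
    have hbU : φ.1.base ∈ c.source := hb ▸ hm
    rw [hY']
    refine (α.sharpφ_toSharpRed hbU).trans ?_
    have h1 := vertCovec_hasFDerivAt (momentum_eq hd hθ)
    -- Whichever section and function were chosen, the relation between them gives the height along
    -- the fibre over `m` as the linear part of `φ` plus a constant. Its derivative is also the
    -- vertical part of the momentum, so the choice does not matter.
    refine HasFDerivAt.unique ((α.sharpLin φ).hasFDerivAt.add_const
      (φ.1.eval (α.ψ φ.1.base 0)) |>.congr_of_eventuallyEq (Filter.Eventually.of_forall ?_)) h1
    intro w
    change α.height σ (α.redChart.ψ (c.κ m, w)) = α.sharpLin φ w + _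
    obtain ⟨a, ha⟩ := S.exists_ζ (α.redChart.ψ (c.κ m, w))
    have hpa : S.proj a = m := by
      rw [← red_proj_ζ, ha, redChart_ψ_proj, c.left_inv _ hm]
    have hwa : (α.φ a).1 = w := by
      rw [← α.red_φ_ζ (by rw [hpa]; exact hm), ha]
      exact congrArg Prod.snd (α.redChart.right_inv (c.κ m, w))
    have h2 := hf a (hpa.trans hb.symm)
    have h3 : S.proj (σ (S.ζ a)) = m := h2.proj.trans hpa
    rw [α.shift_iff (by rw [h3]; exact hm), α.sharp_apply hbU, ha, hwa] at h2
    have h4 := h2.2.2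
    change (α.φ (σ _)).2 = _
    linarith
  · have hφa : S.proj a = m := h
    have haU : S.red.proj (S.ζ a) ∈ c.source := by
      rw [red_proj_ζ, hφa]
      exact hm
    obtain ⟨-, k, l⟩ := secOf_ψ (α := α)
      (f := fun y => horCovec L (c.κ (S.red.proj y) - c.κ m) + vertCovec L (α.red.φ y)) haU
    change S.Shift (α.secOf _ (S.ζ a)) a (vertCovec L (α.φ a).1 - (α.φ a).2)
    rw [α.shift_iff (by rw [k]; exact haU), k, l, α.red_φ_ζ haU, red_proj_ζ, hφa]
    refine ⟨rfl, rfl, ?_⟩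
    simp

/-- Affine sections with the same vertical covector differ by a function of the base point alone,
which is the form required of the `αᵢ` in the definition of `phaseAff₂`. -/
theorem affSec_difference {L : Euc d × Euc r →L[ℝ] ℝ} {q : Euc r →L[ℝ] ℝ} (hL : vertCovec L = q)
    (m : M) : S.IsDifference (α.affSec L m) (α.affSec (joinCovec q 0) m)
      (fun y => horCovec L (c.κ (S.red.proj y) - c.κ m)) {y | S.red.proj y ∈ c.source} := by
  intro y hy
  refine (shift_height (α := α) hy ((isAffineSection_affSec (α := α) _ m).section_eq y hy)
    ((isAffineSection_affSec (α := α) _ m).section_eq y hy)).2 ?_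
  unfold affSec
  rw [height_secOf hy, height_secOf hy, hL, vertCovec_joinCovec, horCovec_joinCovec]
  simp

/-- The height of `σ₀` is affine along fibres. Its vertical derivative is therefore constant on the
fibre over `m`, and adding functions pulled back from `M` leaves it unchanged: the three vertical
parts agree. The horizontal derivative is affine in the fibre coordinate, so it combines in the same
way as the points do. -/
theorem phaseAff₂_comb_iff {t : ℝ} {θ₁ θ₂ θ₃ : S.Phase} {m : M}
    (h₁ : S.red.proj (S.phasePt θ₁) = m) (hm : m ∈ c.source) :
    S.phaseAff₂.comb t θ₁ θ₂ θ₃ ↔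
      (S.red.proj (S.phasePt θ₂) = m ∧ S.red.proj (S.phasePt θ₃) = m ∧
        vertCovec (α.momentum θ₂) = vertCovec (α.momentum θ₁) ∧
        vertCovec (α.momentum θ₃) = vertCovec (α.momentum θ₁)) ∧
      α.red.φ (S.phasePt θ₃) = t • α.red.φ (S.phasePt θ₁) + (1 - t) • α.red.φ (S.phasePt θ₂) ∧
      horCovec (α.momentum θ₃) =
        t • horCovec (α.momentum θ₁) + (1 - t) • horCovec (α.momentum θ₂) := by
  constructor
  · rintro ⟨U, σ, τ₁, τ₂, τ₃, k₁, k₂, x₁, x₂, x₃, hU, hxU, hσ, -, -, i₁, i₂, i₃, hc, d₁, d₂, d₃⟩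
    obtain rfl := d₁.pt
    obtain rfl := d₂.pt
    obtain rfl := d₃.pt
    obtain ⟨h₂, h₃⟩ := red_comb_proj _ _ _ _ hc
    rw [h₁] at h₂ h₃ hxU
    have s₁ : S.phasePt θ₁ ∈ α.redChart.source := mem_redChart (by rwa [h₁])
    have s₂ : S.phasePt θ₂ ∈ α.redChart.source := mem_redChart (by rwa [← h₂])
    have s₃ : S.phasePt θ₃ ∈ α.redChart.source := mem_redChart (by rwa [h₃])
    rw [α.red.comb_iff _ _ _ _ s₁ (by rw [h₁, h₂]) (by rw [h₁, h₃])] at hc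
    have m₁ := momentum_eq d₁ s₁
    have m₂ := momentum_eq d₂ s₂
    have m₃ := momentum_eq d₃ s₃
    rw [redChart_κ, h₁] at m₁
    rw [redChart_κ, ← h₂] at m₂
    rw [redChart_κ, h₃] at m₃
    -- In the chart each `τ` is `σ` raised by a function of the base point.
    have hrep : ∀ (τ : S.Red → A) (k : M → ℝ), S.IsDifference τ σ (fun y => k (S.red.proj y))
        {y | S.red.proj y ∈ U} → ∀ b w, c.ψ b ∈ U → α.height τ (α.redChart.ψ (b, w)) =
          α.height σ (α.redChart.ψ (b, w)) + k (c.ψ b) := by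
      intro τ k hτ b w hb
      have hp : S.red.proj (α.redChart.ψ (b, w)) = c.ψ b := α.redChart_ψ_proj (b, w)
      have h4 := hτ (α.redChart.ψ (b, w)) (by rw [Set.mem_ofPred_eq, hp]; exact hb)
      have h5 : S.proj (σ (α.redChart.ψ (b, w))) = c.ψ b :=
        (φ_of_ζ_eq (α := α) (hσ.section_eq _ (by rw [hp]; exact hb))
          (by rw [hp]; exact c.mem_source _)).1.trans hp
      rw [α.shift_iff (by rw [h4.proj, h5]; exact c.mem_source _)] at h4
      have h6 := h4.2.2
      simp only [hp] at h6
      change (α.φ _).2 = (α.φ _).2 + _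
      linarith
    have hκU : c.ψ (c.κ m) ∈ U := by rwa [c.left_inv m hm]
    -- The vertical part of the momentum is the linear part of the height of `σ` over `m`, whatever
    -- the point of the fibre and the pulled-back function.
    have hq : ∀ (τ : S.Red → A) (k : M → ℝ) (L : Euc d × Euc r →L[ℝ] ℝ) (w : Euc r),
        S.IsDifference τ σ (fun y => k (S.red.proj y)) {y | S.red.proj y ∈ U} →
        HasFDerivAt (fun e => α.height τ (α.redChart.ψ e)) L (c.κ m, w) →
        vertCovec L = linPart fun w => α.height σ (α.redChart.ψ (c.κ m, w)) := by
      intro τ k L w hτ hL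
      refine (vertCovec_hasFDerivAt hL).unique (((hasFDerivAt_of_affine
        (f := fun w => α.height σ (α.redChart.ψ (c.κ m, w)))
        (fun t y z => height_affine hσ hκU t y z) w).add_const
        (k (c.ψ (c.κ m)))).congr_of_eventuallyEq (Filter.Eventually.of_forall fun w => ?_))
      exact hrep τ k hτ _ w hκU
    have q₁ := hq _ _ _ _ i₁ m₁
    have q₂ := hq _ _ _ _ i₂ m₂
    have q₃ := hq _ (fun m => t * k₁ m + (1 - t) * k₂ m) _ _ i₃ m₃
    refine ⟨⟨h₂.symm, h₃, q₂.trans q₁.symm, q₃.trans q₁.symm⟩, hc, ?_⟩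
    -- With the fibre coordinates frozen at those of the three points, the height of `τ₃` is the
    -- affine combination of the heights of `τ₁` and `τ₂` for all nearby base points; this is then
    -- differentiated in the base direction.
    refine (horCovec_hasFDerivAt m₃).unique ((((horCovec_hasFDerivAt m₁).const_smul t).add
      ((horCovec_hasFDerivAt m₂).const_smul (1 - t))).congr_of_eventuallyEq ?_)
    filter_upwards [c.eventually_mem hU hxU hm] with b hb
    simp only [Pi.add_apply, Pi.smul_apply, smul_eq_mul]
    rw [hrep _ _ i₁ _ _ hb, hrep _ _ i₂ _ _ hb, hrep _ (fun m => t * k₁ m + (1 - t) * k₂ m) i₃ _ _ hb,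
      hc, height_affine hσ hb]
    ring
  · rintro ⟨⟨h₂, h₃, q₂, q₃⟩, hx, hp⟩
    have s₁ : S.phasePt θ₁ ∈ α.redChart.source := mem_redChart (by rwa [h₁])
    have s₂ : S.phasePt θ₂ ∈ α.redChart.source := mem_redChart (by rwa [h₂])
    have s₃ : S.phasePt θ₃ ∈ α.redChart.source := mem_redChart (by rwa [h₃])
    have hsm : ∀ p : Euc d →L[ℝ] ℝ, DSmoothOn (fun m' => p (c.κ m' - c.κ m)) c.source := fun p =>
      p.dSmooth.comp_dSmoothOn (c.smooth.sub (dSmoothOn_const _ _))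
    have e₃ := affSec_difference (α := α) q₃ m
    rw [hp] at e₃
    -- The reference section has the common vertical covector and no horizontal part. The horizontal
    -- parts of the momenta supply the pulled-back functions.
    refine ⟨c.source, α.affSec (joinCovec (vertCovec (α.momentum θ₁)) 0) m,
      α.affSec (α.momentum θ₁) m, α.affSec (α.momentum θ₂) m, α.affSec (α.momentum θ₃) m,
      _, _, S.phasePt θ₁, S.phasePt θ₂, S.phasePt θ₃, c.dOpen, s₁, isAffineSection_affSec _ m,
      hsm (horCovec (α.momentum θ₁)), hsm (horCovec (α.momentum θ₂)), affSec_difference rfl m,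
      affSec_difference q₂ m, e₃, ?_, isAffDifferential_affSec rfl s₁ m rfl,
      isAffDifferential_affSec rfl s₂ m rfl, isAffDifferential_affSec rfl s₃ m rfl⟩
    exact (α.red.comb_iff _ _ _ _ s₁ (h₂.trans h₁.symm) (h₃.trans h₁.symm)).2 hx

variable (α)

/-- The trivialization of the double affine phase bundle. -/
def phaseDouble : DoubleAffTriv S.phaseDouble c.source (Euc r) (Euc r →L[ℝ] ℝ)
    (Euc d →L[ℝ] ℝ) where
  t₁ := α.red
  t₂ := α.sharpRed
  t := (Triv.total α.red.toTriv α.phase.toTriv dSmooth_phasePt).map (covecSplit (Euc d) (Euc r))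
    dSmooth_covecSplit dSmooth_covecSplit_symm fun _ => rfl
  fst _ _ := rfl
  snd _ ha := sharpRed_φ_phaseSharp ha
  comb₁_iff s θ₁ θ₂ θ₃ h₁ h₂ h₃ := by
    refine (α.phase.comb_iff s θ₁ θ₂ θ₃ h₁ h₂ h₃).trans ?_
    exact covec_ext_iff
  comb₂_iff s θ₁ θ₂ θ₃ h₁ h₂ h₃ := by
    -- Equality of the images in `A^# / ⟨1_A⟩` already contains the first group of conditions: the
    -- same base point and the same vertical part.
    refine (phaseAff₂_comb_iff (α := α) rfl h₁).trans (and_iff_right ?_)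
    have b₂ : S.red.proj (S.phasePt θ₂) = S.red.proj (S.phasePt θ₁) := by
      rw [← (S.phaseSharp θ₂).2, ← (S.phaseSharp θ₁).2]
      exact congrArg S.sharpRed.proj h₂
    have b₃ : S.red.proj (S.phasePt θ₃) = S.red.proj (S.phasePt θ₁) := by
      rw [← (S.phaseSharp θ₃).2, ← (S.phaseSharp θ₁).2]
      exact congrArg S.sharpRed.proj h₃
    have u₁ : S.red.proj (S.phasePt θ₁) ∈ c.source := h₁
    have e₂ := congrArg α.sharpRed.φ h₂
    have e₃ := congrArg α.sharpRed.φ h₃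
    refine ⟨b₂, b₃, ?_, ?_⟩
    · rw [← sharpRed_φ_phaseSharp (α := α) u₁,
        ← sharpRed_φ_phaseSharp (α := α) (θ := θ₂) (mem_redChart (b₂.symm ▸ u₁))]
      exact e₂
    · rw [← sharpRed_φ_phaseSharp (α := α) u₁,
        ← sharpRed_φ_phaseSharp (α := α) (θ := θ₃) (mem_redChart (b₃.symm ▸ u₁))]
      exact e₃

end AdaptedTriv

section

variable [TopologicalSpace M] [ChartedSpace (Euc d) M] [IsManifold (𝓡 d) ∞ M]
  [IsContMDiffCompatible d M]

/-- The chart of `M` is shrunk until its domain lies in that of an adapted trivialization, which is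
then restricted. -/
theorem SpecialAffineBundle.exists_adapted_chart (S : SpecialAffineBundle A M) :
    ∃ r, ∀ m, ∃ c : DChart M (Euc d), m ∈ c.source ∧ Nonempty (AdaptedTriv S c.source r) := by
  obtain ⟨r, hr⟩ := S.exists_adapted
  refine ⟨r, fun m => ?_⟩
  obtain ⟨O, hO, ⟨α⟩⟩ := hr m
  obtain ⟨c, hc, hcO⟩ := exists_dChart_subset (d := d) α.dOpen hO
  exact ⟨c, hc, ⟨α.restrict c.dOpen hcO⟩⟩

end

/-- The affine phase bundle is locally trivial as soon as there are adapted charts. -/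
theorem SpecialAffineBundle.locallyTrivial_phaseDouble
    (h : ∀ m, ∃ c : DChart M (Euc d), m ∈ c.source ∧ Nonempty (AdaptedTriv S c.source r)) :
    S.phaseDouble.LocallyTrivial (Euc r) (Euc r →L[ℝ] ℝ) (Euc d →L[ℝ] ℝ) where
  smooth_str₁ := dSmooth_phasePt
  smooth_base₁ := dSmooth_sharpRed_proj
  smooth_base₂ := dSmooth_red_proj
  comb_str₁ := by
    rintro t θ₁ θ₂ θ₃ ⟨x, σ₁, σ₂, σ₃, d₁, d₂, d₃, -⟩
    exact ⟨d₁.pt.trans d₂.pt.symm, d₃.pt.trans d₁.pt.symm⟩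
  comb_str₂ t θ₁ θ₂ θ₃ hc := by
    obtain ⟨c, hm, ⟨α⟩⟩ := h (S.red.proj (S.phasePt θ₁))
    obtain ⟨⟨h₂, h₃, q₂, q₃⟩, -⟩ := (AdaptedTriv.phaseAff₂_comb_iff (α := α) rfl hm).1 hc
    refine ⟨((α.phaseDouble.proj₂_eq_iff hm).2 ⟨h₂, q₂⟩).symm,
      (α.phaseDouble.proj₂_eq_iff hm).2 ⟨h₃, q₃⟩⟩
  comb_base₁ := sharpRed_comb_proj
  comb_base₂ := red_comb_proj
  exists_triv m := by
    obtain ⟨c, hm, ⟨α⟩⟩ := h m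
    exact ⟨c.source, hm, ⟨α.phaseDouble⟩⟩

/-! ## The cotangent bundle of a vector bundle as a double vector bundle -/

/-- Smoothness of the projection, and addition and multiplication by numbers act on fibres. -/
structure VecData.IsFibrewise {D M : Type*} [DiffeologicalSpace D] [DiffeologicalSpace M]
    (E : VecData D M) : Prop where
  smooth_proj : DSmooth E.proj
  add_proj : ∀ x y z, E.add x y z → E.proj x = E.proj y ∧ E.proj z = E.proj x
  smul_proj : ∀ t x y, E.smul t x y → E.proj y = E.proj x

namespace VecTriv

variable {D M : Type*} [DiffeologicalSpace D] [DiffeologicalSpace M] {E : VecData D M}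
  {B : Type*} [NormedAddCommGroup B] [NormedSpace ℝ B] [DiffeologicalSpace B]
  [IsContDiffCompatible B] [FiniteDimensional ℝ B] {c : DChart M B}
  {V : Type*} [NormedAddCommGroup V] [NormedSpace ℝ V] [DiffeologicalSpace V]
  [IsContDiffCompatible V] [FiniteDimensional ℝ V]

theorem add_iff_coord (T : VecTriv E c.source V) (hE : E.IsFibrewise) {x y z : D}
    (hx : E.proj x ∈ c.source) :
    E.add x y z ↔ E.proj y = E.proj x ∧ E.proj z = E.proj x ∧ T.φ z = T.φ x + T.φ y := by
  constructor
  · intro h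
    obtain ⟨h1, h2⟩ := hE.add_proj _ _ _ h
    exact ⟨h1.symm, h2, (T.add_iff x y z hx h1.symm h2).1 h⟩
  · rintro ⟨h1, h2, h⟩
    exact (T.add_iff x y z hx h1 h2).2 h

theorem smul_iff_coord (T : VecTriv E c.source V) (hE : E.IsFibrewise) {t : ℝ} {x y : D}
    (hx : E.proj x ∈ c.source) :
    E.smul t x y ↔ E.proj y = E.proj x ∧ T.φ y = t • T.φ x := by
  constructor
  · intro h
    have h1 := hE.smul_proj _ _ _ h
    exact ⟨h1, (T.smul_iff t x y hx h1).1 h⟩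
  · rintro ⟨h1, h⟩
    exact (T.smul_iff t x y hx h1).2 h

/-- The chart of the total space of a vector bundle. -/
def chart (T : VecTriv E c.source V) (hE : E.IsFibrewise) : DChart D (B × V) :=
  c.ofTriv T.toTriv hE.smooth_proj

variable {T : VecTriv E c.source V} {hE : E.IsFibrewise}

theorem chart_κ (x : D) : (T.chart hE).κ x = (c.κ (E.proj x), T.φ x) := rfl

theorem chart_line (x : D) (v : B × V) (t : ℝ) :
    E.proj ((T.chart hE).line x v t) = c.ψ (c.κ (E.proj x) + t • v.1) ∧
      T.φ ((T.chart hE).line x v t) = T.φ x + t • v.2 :=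
  ⟨T.proj_inv _ (c.mem_source _) _, T.right_inv _ (c.mem_source _) _⟩

theorem hasPairing_line {θ : Cotangent D} (h : E.proj θ.pt ∈ c.source) (v : B × V) :
    θ.HasPairing ((T.chart hE).line θ.pt v) ((T.chart hE).covec θ v) :=
  DChart.hasPairing_covec ((T.chart hE).line_zero h v).symm
    (Filter.Eventually.of_forall fun _ => (T.chart hE).mem_source _)
    ((T.chart hE).hasDerivAt_line _ _)

/-- The choice defining `verticalPart` is made among functions over the correct base point, so this
holds before the characterizing property is known to be satisfiable. -/
theorem verticalPart_base (θ : Cotangent D) : (E.verticalPart θ).1.base = E.proj θ.pt :=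
  (Classical.epsilon (h := ⟨E.dualZero (E.proj θ.pt)⟩)
    fun φ : {φ : E.Dual // φ.1.base = E.proj θ.pt} =>
    ∀ w hw (γ : ℝ → D), (∀ t, ∃ y, E.smul t w y ∧ E.add θ.pt y (γ t)) →
      θ.HasPairing γ (φ.1.1.fn w hw)).2

/-- The vertical component of the covector satisfies the property that defines `verticalPart`, so
the choice is meaningful. Testing on the lines `θ.pt + t w` shows that the property determines the
function. -/
theorem dual_φ_verticalPart {θ : Cotangent D} (h : E.proj θ.pt ∈ c.source) :
    T.dual.φ (E.verticalPart θ) = vertCovec ((T.chart hE).covec θ) := by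
  set L := (T.chart hE).covec θ with hL
  have e := T.dualψ_spec h (vertCovec L)
  have key := Classical.epsilon_spec (p := fun φ : {φ : E.Dual // φ.1.base = E.proj θ.pt} =>
    ∀ w hw (γ : ℝ → D), (∀ t, ∃ y, E.smul t w y ∧ E.add θ.pt y (γ t)) →
      θ.HasPairing γ (φ.1.1.fn w hw)) ⟨⟨T.dualψ (E.proj θ.pt) (vertCovec L), e.1⟩, ?_⟩
  · refine T.eq_dualφ (by rwa [verticalPart_base]) fun w hw => ?_
    have hwp : E.proj w = E.proj θ.pt := hw.trans (verticalPart_base θ)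
    have h1 := key w hw ((T.chart hE).line θ.pt (0, T.φ w)) fun t => ?_
    · exact h1.unique (hasPairing_line h (0, T.φ w))
    · have hp := T.proj_inv _ h (t • T.φ w)
      have hr := T.right_inv _ h (t • T.φ w)
      have hl := chart_line (T := T) (hE := hE) θ.pt (0, T.φ w) t
      refine ⟨T.ψ (E.proj θ.pt) (t • T.φ w),
        (T.smul_iff_coord hE (hwp ▸ h)).2 ⟨hp.trans hwp.symm, hr⟩,
        (T.add_iff_coord hE h).2 ⟨hp, ?_, ?_⟩⟩
      · rw [hl.1, smul_zero, add_zero, c.left_inv _ h]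
      · rw [hl.2, hr]
  · intro w hw γ hγ
    have hwp : E.proj w = E.proj θ.pt := hw.trans e.1
    have h1 : ∀ t, E.proj (γ t) = E.proj θ.pt ∧ T.φ (γ t) = T.φ θ.pt + t • T.φ w := by
      intro t
      obtain ⟨y, hy, hy'⟩ := hγ t
      rw [T.smul_iff_coord hE (hwp ▸ h)] at hy
      rw [T.add_iff_coord hE h, hy.2] at hy'
      exact hy'.2
    rw [e.2 w hw, vertCovec_apply]
    refine DChart.hasPairing_covec ?_ (Filter.Eventually.of_forall fun t => ?_) ?_
    · refine ((T.ext_iff h).2 ⟨(h1 0).1, ?_⟩)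
      rw [(h1 0).2, zero_smul, add_zero]
    · change E.proj _ ∈ c.source
      rw [(h1 t).1]
      exact h
    · have h2 : (fun t => (T.chart hE).κ (γ t)) =
          fun t => (T.chart hE).κ θ.pt + t • ((0, T.φ w) : B × V) := by
        funext t
        rw [chart_κ, chart_κ, (h1 t).1, (h1 t).2]
        simp
      rw [h2]
      simpa using ((hasDerivAt_id (0 : ℝ)).smul_const ((0, T.φ w) : B × V)).const_add
        ((T.chart hE).κ θ.pt)

theorem hasDerivAt_fst {f : ℝ → B × V} {v : B × V} {t : ℝ} (h : HasDerivAt f v t) :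
    HasDerivAt (fun t => (f t).1) v.1 t :=
  (ContinuousLinearMap.fst ℝ B V).hasFDerivAt.comp_hasDerivAt t h

theorem hasDerivAt_snd {f : ℝ → B × V} {v : B × V} {t : ℝ} (h : HasDerivAt f v t) :
    HasDerivAt (fun t => (f t).2) v.2 t :=
  (ContinuousLinearMap.snd ℝ B V).hasFDerivAt.comp_hasDerivAt t h

/-- Velocities that can be added have a common base component `u`. With a common vertical part `q`,
the identity `p₃ u + q (w₁ + w₂) = (p₁ u + q w₁) + (p₂ u + q w₂)` is equivalent to `p₃ = p₁ + p₂`.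
-/
theorem pairing_add_iff {θ₁ θ₂ θ₃ : Cotangent D} (h₁ : E.proj θ₁.pt ∈ c.source)
    (hadd : E.add θ₁.pt θ₂.pt θ₃.pt)
    (hv₂ : vertCovec ((T.chart hE).covec θ₂) = vertCovec ((T.chart hE).covec θ₁))
    (hv₃ : vertCovec ((T.chart hE).covec θ₃) = vertCovec ((T.chart hE).covec θ₁)) :
    (∀ γ₁ γ₂ γ₃ : ℝ → D, DSmooth γ₁ → DSmooth γ₂ → DSmooth γ₃ →
        (∀ t, E.add (γ₁ t) (γ₂ t) (γ₃ t)) →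
        ∀ r₁ r₂, θ₁.HasPairing γ₁ r₁ → θ₂.HasPairing γ₂ r₂ → θ₃.HasPairing γ₃ (r₁ + r₂)) ↔
      horCovec ((T.chart hE).covec θ₃) =
        horCovec ((T.chart hE).covec θ₁) + horCovec ((T.chart hE).covec θ₂) := by
  have hc := (T.add_iff_coord hE h₁).1 hadd
  have h₂ : E.proj θ₂.pt ∈ c.source := hc.1.symm ▸ h₁
  have h₃ : E.proj θ₃.pt ∈ c.source := hc.2.1.symm ▸ h₁
  constructor
  · intro h
    refine ContinuousLinearMap.ext fun v => ?_
    -- Lines with constant fibre coordinate test the horizontal parts alone.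
    refine (hasPairing_line h₃ ((v, 0) : B × V)).unique
      (h _ _ _ ((T.chart hE).dSmooth_line θ₁.pt (v, 0)) ((T.chart hE).dSmooth_line θ₂.pt (v, 0))
        ((T.chart hE).dSmooth_line θ₃.pt (v, 0)) (fun t => ?_) _ _ (hasPairing_line h₁ _)
        (hasPairing_line h₂ _))
    have l₁ := chart_line (T := T) (hE := hE) θ₁.pt (v, 0) t
    have l₂ := chart_line (T := T) (hE := hE) θ₂.pt (v, 0) t
    have l₃ := chart_line (T := T) (hE := hE) θ₃.pt (v, 0) t
    rw [T.add_iff_coord hE (by rw [l₁.1]; exact c.mem_source _), l₁.1, l₂.1, l₃.1, l₁.2, l₂.2, l₃.2,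
      hc.1, hc.2.1, hc.2.2]
    refine ⟨rfl, rfl, ?_⟩
    simp
  · intro h γ₁ γ₂ γ₃ s₁ s₂ _ hγ r₁ r₂ p₁ p₂
    have u₁ : γ₁ 0 ∈ (T.chart hE).source := p₁.1 ▸ h₁
    have u₂ : γ₂ 0 ∈ (T.chart hE).source := p₂.1 ▸ h₂
    have ev := (T.chart hE).dOpen.eventually_mem s₁ u₁
    have d₁ := (T.chart hE).hasDerivAt_of_dSmooth s₁ u₁
    have d₂ := (T.chart hE).hasDerivAt_of_dSmooth s₂ u₂
    set v₁ := deriv (fun t => (T.chart hE).κ (γ₁ t)) 0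
    set v₂ := deriv (fun t => (T.chart hE).κ (γ₂ t)) 0
    have hco : ∀ t, γ₁ t ∈ (T.chart hE).source → E.proj (γ₂ t) = E.proj (γ₁ t) ∧
        E.proj (γ₃ t) = E.proj (γ₁ t) ∧ T.φ (γ₃ t) = T.φ (γ₁ t) + T.φ (γ₂ t) := fun t ht =>
      (T.add_iff_coord hE ht).1 (hγ t)
    -- Summands lie in one fibre, so both curves project to the same curve in `M`.
    have hfst : v₂.1 = v₁.1 := by
      refine (hasDerivAt_fst d₂).unique ((hasDerivAt_fst d₁).congr_of_eventuallyEq ?_)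
      filter_upwards [ev] with t ht
      rw [chart_κ, chart_κ, (hco t ht).1]
    have d₃ : HasDerivAt (fun t => (T.chart hE).κ (γ₃ t)) (v₁.1, v₁.2 + v₂.2) 0 := by
      refine ((hasDerivAt_fst d₁).prodMk ((hasDerivAt_snd d₁).add (hasDerivAt_snd d₂))).congr_of_eventuallyEq ?_
      filter_upwards [ev] with t ht
      rw [chart_κ, (hco t ht).2.1, (hco t ht).2.2]
      rfl
    have hz : θ₃.pt = γ₃ 0 := by
      have h0 := hco 0 u₁
      rw [← p₁.1, ← p₂.1] at h0
      refine (T.ext_iff h₃).2 ⟨h0.2.1.trans hc.2.1.symm, h0.2.2.trans hc.2.2.symm⟩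
    have ev₃ : ∀ᶠ t in 𝓝 (0 : ℝ), γ₃ t ∈ (T.chart hE).source := by
      filter_upwards [ev] with t ht
      change E.proj _ ∈ c.source
      rw [(hco t ht).2.1]
      exact ht
    have ev₂ : ∀ᶠ t in 𝓝 (0 : ℝ), γ₂ t ∈ (T.chart hE).source :=
      (T.chart hE).dOpen.eventually_mem s₂ u₂
    rw [p₁.unique (DChart.hasPairing_covec p₁.1 ev d₁),
      p₂.unique (DChart.hasPairing_covec p₂.1 ev₂ d₂)]
    convert! DChart.hasPairing_covec hz ev₃ d₃ using 1
    rw [covec_apply_eq _ v₁, covec_apply_eq _ v₂, covec_apply_eq _ (v₁.1, _), h, hv₂, hv₃, hfst]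
    simp only [add_apply, map_add]
    ring

/-- Multiplication by `s` takes a velocity `(u, w)` to `(u, s w)`. With a common vertical part, the
factor `s` in the pairing must therefore come from the horizontal part. -/
theorem pairing_smul_iff {s : ℝ} {θ₁ θ₂ : Cotangent D} (h₁ : E.proj θ₁.pt ∈ c.source)
    (hsmul : E.smul s θ₁.pt θ₂.pt)
    (hv₂ : vertCovec ((T.chart hE).covec θ₂) = vertCovec ((T.chart hE).covec θ₁)) :
    (∀ γ₁ γ₂ : ℝ → D, DSmooth γ₁ → DSmooth γ₂ → (∀ t, E.smul s (γ₁ t) (γ₂ t)) →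
        ∀ r, θ₁.HasPairing γ₁ r → θ₂.HasPairing γ₂ (s * r)) ↔
      horCovec ((T.chart hE).covec θ₂) = s • horCovec ((T.chart hE).covec θ₁) := by
  have hc := (T.smul_iff_coord hE h₁).1 hsmul
  have h₂ : E.proj θ₂.pt ∈ c.source := hc.1.symm ▸ h₁
  constructor
  · intro h
    refine ContinuousLinearMap.ext fun v => ?_
    refine (hasPairing_line h₂ ((v, 0) : B × V)).unique
      (h _ _ ((T.chart hE).dSmooth_line θ₁.pt (v, 0)) ((T.chart hE).dSmooth_line θ₂.pt (v, 0))
        (fun t => ?_) _ (hasPairing_line h₁ _))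
    have l₁ := chart_line (T := T) (hE := hE) θ₁.pt (v, 0) t
    have l₂ := chart_line (T := T) (hE := hE) θ₂.pt (v, 0) t
    rw [T.smul_iff_coord hE (by rw [l₁.1]; exact c.mem_source _), l₁.1, l₂.1, l₁.2, l₂.2,
      hc.1, hc.2]
    refine ⟨rfl, ?_⟩
    simp
  · intro h γ₁ γ₂ s₁ _ hγ r₁ p₁
    have u₁ : γ₁ 0 ∈ (T.chart hE).source := p₁.1 ▸ h₁
    have ev := (T.chart hE).dOpen.eventually_mem s₁ u₁
    have d₁ := (T.chart hE).hasDerivAt_of_dSmooth s₁ u₁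
    set v₁ := deriv (fun t => (T.chart hE).κ (γ₁ t)) 0
    have hco : ∀ t, γ₁ t ∈ (T.chart hE).source → E.proj (γ₂ t) = E.proj (γ₁ t) ∧
        T.φ (γ₂ t) = s • T.φ (γ₁ t) := fun t ht =>
      (T.smul_iff_coord hE ht).1 (hγ t)
    have d₂ : HasDerivAt (fun t => (T.chart hE).κ (γ₂ t)) (v₁.1, s • v₁.2) 0 := by
      refine ((hasDerivAt_fst d₁).prodMk ((hasDerivAt_snd d₁).const_smul s)).congr_of_eventuallyEq ?_
      filter_upwards [ev] with t ht
      rw [chart_κ, (hco t ht).1, (hco t ht).2]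
      rfl
    have hz : θ₂.pt = γ₂ 0 := by
      have h0 := hco 0 u₁
      rw [← p₁.1] at h0
      refine (T.ext_iff h₂).2 ⟨h0.1.trans hc.1.symm, h0.2.trans hc.2.symm⟩
    have ev₂ : ∀ᶠ t in 𝓝 (0 : ℝ), γ₂ t ∈ (T.chart hE).source := by
      filter_upwards [ev] with t ht
      change E.proj _ ∈ c.source
      rw [(hco t ht).1]
      exact ht
    rw [p₁.unique (DChart.hasPairing_covec p₁.1 ev d₁)]
    convert! DChart.hasPairing_covec hz ev₂ d₂ using 1
    rw [covec_apply_eq _ v₁, covec_apply_eq _ (v₁.1, _), h, hv₂]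
    simp only [smul_apply, map_smul, smul_eq_mul]
    ring

variable (T hE)

/-- The trivialization of the cotangent bundle of a vector bundle. -/
def cotangentDouble : DoubleVecTriv E.cotangentDouble c.source V (V →L[ℝ] ℝ) (B →L[ℝ] ℝ) where
  t₁ := T
  t₂ := T.dual
  t := (Triv.total T.toTriv (T.chart hE).cotangent.toTriv Cotangent.dSmooth_pt).map
    (covecSplit B V) dSmooth_covecSplit dSmooth_covecSplit_symm fun _ => rfl
  fst _ _ := rfl
  snd _ ha := dual_φ_verticalPart ha
  add₁_iff θ₁ θ₂ θ₃ h₁ h₂ h₃ :=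
    ((T.chart hE).cotangent.add_iff θ₁ θ₂ θ₃ h₁ h₂ h₃).trans covec_ext_iff
  smul₁_iff s θ₁ θ₂ h₁ h₂ :=
    ((T.chart hE).cotangent.smul_iff s θ₁ θ₂ h₁ h₂).trans covec_ext_iff
  add₂_iff θ₁ θ₂ θ₃ h₁ h₂ h₃ := by
    change E.verticalPart θ₂ = E.verticalPart θ₁ at h₂
    change E.verticalPart θ₃ = E.verticalPart θ₁ at h₃
    change E.proj θ₁.pt ∈ c.source at h₁
    have b₂ : E.proj θ₂.pt = E.proj θ₁.pt := by
      rw [← verticalPart_base, ← verticalPart_base, h₂]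
    have b₃ : E.proj θ₃.pt = E.proj θ₁.pt := by
      rw [← verticalPart_base, ← verticalPart_base, h₃]
    have v₂ : vertCovec ((T.chart hE).covec θ₂) = vertCovec ((T.chart hE).covec θ₁) := by
      rw [← dual_φ_verticalPart (b₂ ▸ h₁), ← dual_φ_verticalPart h₁, h₂]
    have v₃ : vertCovec ((T.chart hE).covec θ₃) = vertCovec ((T.chart hE).covec θ₁) := by
      rw [← dual_φ_verticalPart (b₃ ▸ h₁), ← dual_φ_verticalPart h₁, h₃]
    constructor
    · rintro ⟨-, -, hadd, h⟩
      exact ⟨((T.add_iff_coord hE h₁).1 hadd).2.2, (pairing_add_iff h₁ hadd v₂ v₃).1 h⟩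
    · rintro ⟨h, h'⟩
      have hadd := (T.add_iff_coord hE h₁).2 ⟨b₂, b₃, h⟩
      exact ⟨h₂.symm, h₃, hadd, (pairing_add_iff h₁ hadd v₂ v₃).2 h'⟩
  smul₂_iff s θ₁ θ₂ h₁ h₂ := by
    change E.verticalPart θ₂ = E.verticalPart θ₁ at h₂
    change E.proj θ₁.pt ∈ c.source at h₁
    have b₂ : E.proj θ₂.pt = E.proj θ₁.pt := by
      rw [← verticalPart_base, ← verticalPart_base, h₂]
    have v₂ : vertCovec ((T.chart hE).covec θ₂) = vertCovec ((T.chart hE).covec θ₁) := by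
      rw [← dual_φ_verticalPart (b₂ ▸ h₁), ← dual_φ_verticalPart h₁, h₂]
    constructor
    · rintro ⟨-, hsmul, h⟩
      exact ⟨((T.smul_iff_coord hE h₁).1 hsmul).2, (pairing_smul_iff h₁ hsmul v₂).1 h⟩
    · rintro ⟨h, h'⟩
      have hsmul := (T.smul_iff_coord hE h₁).2 ⟨b₂, h⟩
      exact ⟨h₂, hsmul, (pairing_smul_iff h₁ hsmul v₂).2 h'⟩

theorem _root_.DAff.VecData.locallyTrivial_cotangentDouble (hE : E.IsFibrewise)
    (h : ∀ m, ∃ c : DChart M B, m ∈ c.source ∧ Nonempty (VecTriv E c.source V)) :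
    E.cotangentDouble.LocallyTrivial V (V →L[ℝ] ℝ) (B →L[ℝ] ℝ) where
  comm := verticalPart_base
  smooth_str₁ := Cotangent.dSmooth_pt
  smooth_base₁ := FibreFun.dSmooth_base.comp dSmooth_val
  smooth_base₂ := hE.smooth_proj
  add_str₁ := by
    rintro θ₁ θ₂ θ₃ ⟨x, f, g, ⟨g₁, rfl, -, rfl⟩, ⟨g₂, h₂, -, rfl⟩, ⟨g₃, h₃, -, rfl⟩⟩
    exact ⟨h₂.symm, h₃⟩
  add_str₂ _ _ _ h := ⟨h.1, h.2.1⟩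
  add_base₁ _ _ _ h := ⟨h.1, h.2.1⟩
  add_base₂ := hE.add_proj
  smul_str₁ := by
    rintro s θ₁ θ₂ ⟨x, f, ⟨g₁, rfl, -, rfl⟩, ⟨g₂, h₂, -, rfl⟩⟩
    exact h₂
  smul_str₂ _ _ _ h := h.1
  smul_base₁ _ _ _ h := h.1
  smul_base₂ := hE.smul_proj
  exists_triv m := by
    obtain ⟨c, hm, ⟨T⟩⟩ := h m
    exact ⟨c.source, hm, ⟨T.cotangentDouble hE⟩⟩

end VecTriv

/-! ## Gluing of isomorphisms -/

/-- A relation that is the equality of coordinates in suitable local trivializations is a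
diffeomorphism. -/
theorem Triv.exists_equiv {A A' M E : Type*} [DiffeologicalSpace A] [DiffeologicalSpace A']
    [DiffeologicalSpace M] [DiffeologicalSpace E] {π : A → M} {π' : A' → M} (hπ : DSmooth π)
    (hπ' : DSmooth π') {R : A → A' → Prop}
    (h : ∀ m, ∃ (U : Set M) (T : Triv π U E) (T' : Triv π' U E), m ∈ U ∧
      ∀ x y, π x ∈ U → (R x y ↔ π' y = π x ∧ T'.φ y = T.φ x)) :
    ∃ e : A ≃ A', DSmooth e ∧ DSmooth e.symm ∧ ∀ x y, R x y ↔ e x = y := by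
  have hbase : ∀ x y, R x y → π' y = π x := by
    intro x y hxy
    obtain ⟨U, T, T', hm, hR⟩ := h (π x)
    exact ((hR x y hm).1 hxy).1
  have ex : ∀ x, ∃ y, R x y := by
    intro x
    obtain ⟨U, T, T', hm, hR⟩ := h (π x)
    exact ⟨T'.ψ (π x) (T.φ x), (hR _ _ hm).2 ⟨T'.proj_inv _ hm _, T'.right_inv _ hm _⟩⟩
  have ex' : ∀ y, ∃ x, R x y := by
    intro y
    obtain ⟨U, T, T', hm, hR⟩ := h (π' y)
    have hp := T.proj_inv _ hm (T'.φ y)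
    refine ⟨T.ψ (π' y) (T'.φ y), (hR _ _ (by rwa [hp])).2 ⟨hp.symm, ?_⟩⟩
    rw [T.right_inv _ hm]
  have uniq : ∀ x y y', R x y → R x y' → y = y' := by
    intro x y y' h1 h2
    obtain ⟨U, T, T', hm, hR⟩ := h (π x)
    have h3 := (hR _ _ hm).1 h1
    have h4 := (hR _ _ hm).1 h2
    exact (T'.ext_iff (h3.1 ▸ hm)).2 ⟨h4.1.trans h3.1.symm, h4.2.trans h3.2.symm⟩
  have uniq' : ∀ x x' y, R x y → R x' y → x = x' := by
    intro x x' y h1 h2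
    obtain ⟨U, T, T', hm, hR⟩ := h (π x)
    have hb : π x' = π x := (hbase _ _ h2).symm.trans (hbase _ _ h1)
    have h3 := (hR _ _ hm).1 h1
    have h4 := (hR _ _ (hb ▸ hm)).1 h2
    exact (T.ext_iff hm).2 ⟨hb, h4.2.symm.trans h3.2⟩
  -- The relation is total and single-valued in both directions, so the choices are forced and the
  -- two maps are mutually inverse.
  choose f hf using ex
  choose g hg using ex'
  let e : A ≃ A' :=
    { toFun := f
      invFun := g
      left_inv := fun x => uniq' _ _ _ (hg (f x)) (hf x)
      right_inv := fun y => uniq _ _ _ (hf (g y)) (hg y) }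
  refine ⟨e, dSmooth_of_local fun x => ?_, dSmooth_of_local fun y => ?_,
    fun x y => ⟨fun hxy => uniq _ _ _ (hf x) hxy, fun hxy => hxy ▸ hf x⟩⟩
  · obtain ⟨U, T, T', hm, hR⟩ := h (π x)
    refine ⟨π ⁻¹' U, T.dOpen.preimage hπ, hm, T'.dSmoothOn_of ?_ ?_ ?_⟩
    · intro x' hx'
      change π' (f x') ∈ U
      rw [hbase _ _ (hf x')]
      exact hx'
    · exact (hπ.dSmoothOn _).congr fun x' _ => hbase _ _ (hf x')
    · exact T.smooth.congr fun x' hx' => ((hR _ _ hx').1 (hf x')).2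
  · obtain ⟨U, T, T', hm, hR⟩ := h (π' y)
    have hb : ∀ y, π (g y) = π' y := fun y => (hbase _ _ (hg y)).symm
    refine ⟨π' ⁻¹' U, T.dOpen.preimage hπ', hm, T.dSmoothOn_of ?_ ?_ ?_⟩
    · intro y' hy'
      change π (g y') ∈ U
      rw [hb]
      exact hy'
    · exact (hπ'.dSmoothOn _).congr fun y' _ => hb y'
    · exact T'.smooth.congr fun y' hy' => ((hR _ _ (by rw [hb]; exact hy')).1 (hg y')).2.symm

section

variable {E₁ : Type*} [NormedAddCommGroup E₁] [NormedSpace ℝ E₁]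
  [DiffeologicalSpace E₁] [IsContDiffCompatible E₁]
  {E₂ : Type*} [NormedAddCommGroup E₂] [NormedSpace ℝ E₂]
  [DiffeologicalSpace E₂] [IsContDiffCompatible E₂]
  {E₃ : Type*} [NormedAddCommGroup E₃] [NormedSpace ℝ E₃]
  [DiffeologicalSpace E₃] [IsContDiffCompatible E₃]
  {D D₁ D₂ D' D₁' D₂' M : Type*} [DiffeologicalSpace D]
  [DiffeologicalSpace D₁] [DiffeologicalSpace D₂] [DiffeologicalSpace D']
  [DiffeologicalSpace D₁'] [DiffeologicalSpace D₂'] [DiffeologicalSpace M]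

theorem VecTriv.add_congr {S : VecData D M} {S' : VecData D' M} {U : Set M} (T : VecTriv S U E₁)
    (T' : VecTriv S' U E₁) (hS : ∀ x y z, S.add x y z → S.proj x = S.proj y ∧ S.proj z = S.proj x)
    (hS' : ∀ x y z, S'.add x y z → S'.proj x = S'.proj y ∧ S'.proj z = S'.proj x) {f : D → D'}
    (hf : ∀ x, S'.proj (f x) = S.proj x) (hφ : ∀ x, S.proj x ∈ U → T'.φ (f x) = T.φ x) {x y z : D}
    (hx : S.proj x ∈ U) : S.add x y z ↔ S'.add (f x) (f y) (f z) := by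
  have key : ∀ (hy : S.proj y = S.proj x) (hz : S.proj z = S.proj x),
      (S.add x y z ↔ S'.add (f x) (f y) (f z)) := fun hy hz => by
    rw [T.add_iff x y z hx hy hz, T'.add_iff _ _ _ (by rwa [hf]) (by rw [hf, hf, hy])
      (by rw [hf, hf, hz]), hφ x hx, hφ y (hy ▸ hx), hφ z (hz ▸ hx)]
  refine ⟨fun h => (key (hS _ _ _ h).1.symm (hS _ _ _ h).2).1 h, fun h => ?_⟩
  have h1 := hS' _ _ _ h
  rw [hf, hf, hf] at h1
  exact (key h1.1.symm h1.2).2 h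

theorem VecTriv.smul_congr {S : VecData D M} {S' : VecData D' M} {U : Set M} (T : VecTriv S U E₁)
    (T' : VecTriv S' U E₁) (hS : ∀ t x y, S.smul t x y → S.proj y = S.proj x)
    (hS' : ∀ t x y, S'.smul t x y → S'.proj y = S'.proj x) {f : D → D'}
    (hf : ∀ x, S'.proj (f x) = S.proj x) (hφ : ∀ x, S.proj x ∈ U → T'.φ (f x) = T.φ x) {t : ℝ}
    {x y : D} (hx : S.proj x ∈ U) : S.smul t x y ↔ S'.smul t (f x) (f y) := by
  have key : ∀ (hy : S.proj y = S.proj x), (S.smul t x y ↔ S'.smul t (f x) (f y)) := fun hy => by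
    rw [T.smul_iff t x y hx hy, T'.smul_iff _ _ _ (by rwa [hf]) (by rw [hf, hf, hy]),
      hφ x hx, hφ y (hy ▸ hx)]
  refine ⟨fun h => (key (hS _ _ _ h)).1 h, fun h => ?_⟩
  have h1 := hS' _ _ _ h
  rw [hf, hf] at h1
  exact (key h1).2 h

/-- Relations that are the equality of coordinates in suitable local trivializations form an
isomorphism of double vector bundles. -/
theorem DoubleVecData.LocallyTrivial.exists_iso {S : DoubleVecData D D₁ D₂ M}
    {S' : DoubleVecData D' D₁' D₂' M} (L : S.LocallyTrivial E₁ E₂ E₃)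
    (L' : S'.LocallyTrivial E₁ E₂ E₃) {R : D → D' → Prop} {R₁ : D₁ → D₁' → Prop}
    {R₂ : D₂ → D₂' → Prop}
    (h : ∀ m, ∃ (U : Set M) (T : DoubleVecTriv S U E₁ E₂ E₃) (T' : DoubleVecTriv S' U E₁ E₂ E₃),
      m ∈ U ∧ (∀ x y, S.base x ∈ U → (R x y ↔ S'.base y = S.base x ∧ T'.t.φ y = T.t.φ x)) ∧
      (∀ x y, S.base₂.proj x ∈ U →
        (R₁ x y ↔ S'.base₂.proj y = S.base₂.proj x ∧ T'.t₁.φ y = T.t₁.φ x)) ∧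
      ∀ x y, S.base₁.proj x ∈ U →
        (R₂ x y ↔ S'.base₁.proj y = S.base₁.proj x ∧ T'.t₂.φ y = T.t₂.φ x)) :
    ∃ Φ : S.Iso S', (∀ x y, R x y ↔ Φ.toEquiv x = y) ∧ (∀ x y, R₁ x y ↔ Φ.side₁ x = y) ∧
      ∀ x y, R₂ x y ↔ Φ.side₂ x = y := by
  have hb : DSmooth S.base := L.smooth_base₂.comp L.smooth_str₁
  have hb' : DSmooth S'.base := L'.smooth_base₂.comp L'.smooth_str₁
  obtain ⟨e, he, he', hR⟩ := Triv.exists_equiv hb hb' (R := R) fun m => by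
    obtain ⟨U, T, T', hm, h1, -, -⟩ := h m
    exact ⟨U, T.t, T'.t, hm, h1⟩
  obtain ⟨e₁, he₁, he₁', hR₁⟩ := Triv.exists_equiv L.smooth_base₂ L'.smooth_base₂ (R := R₁)
    fun m => by
    obtain ⟨U, T, T', hm, -, h1, -⟩ := h m
    exact ⟨U, T.t₁.toTriv, T'.t₁.toTriv, hm, h1⟩
  obtain ⟨e₂, he₂, he₂', hR₂⟩ := Triv.exists_equiv L.smooth_base₁ L'.smooth_base₁ (R := R₂)
    fun m => by
    obtain ⟨U, T, T', hm, -, -, h1⟩ := h m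
    exact ⟨U, T.t₂.toTriv, T'.t₂.toTriv, hm, h1⟩
  have hbe : ∀ x, S'.base (e x) = S.base x := fun x => by
    obtain ⟨U, T, T', hm, h1, -, -⟩ := h (S.base x)
    exact ((h1 x _ hm).1 ((hR x _).2 rfl)).1
  have hbe₁ : ∀ x, S'.base₂.proj (e₁ x) = S.base₂.proj x := fun x => by
    obtain ⟨U, T, T', hm, -, h1, -⟩ := h (S.base₂.proj x)
    exact ((h1 x _ hm).1 ((hR₁ x _).2 rfl)).1
  have hbe₂ : ∀ x, S'.base₁.proj (e₂ x) = S.base₁.proj x := fun x => by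
    obtain ⟨U, T, T', hm, -, -, h1⟩ := h (S.base₁.proj x)
    exact ((h1 x _ hm).1 ((hR₂ x _).2 rfl)).1
  -- From here on the relations are the graphs of `e`, `e₁`, `e₂`, and these maps preserve
  -- coordinates. Since both structures have the same expression in coordinates, they are preserved
  -- as well.
  replace h : ∀ m, ∃ (U : Set M) (T : DoubleVecTriv S U E₁ E₂ E₃)
      (T' : DoubleVecTriv S' U E₁ E₂ E₃), m ∈ U ∧ (∀ x, S.base x ∈ U → T'.t.φ (e x) = T.t.φ x) ∧
      (∀ x, S.base₂.proj x ∈ U → T'.t₁.φ (e₁ x) = T.t₁.φ x) ∧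
      ∀ x, S.base₁.proj x ∈ U → T'.t₂.φ (e₂ x) = T.t₂.φ x := by
    intro m
    obtain ⟨U, T, T', hm, h1, h2, h3⟩ := h m
    exact ⟨U, T, T', hm, fun x hx => ((h1 x _ hx).1 ((hR x _).2 rfl)).2,
      fun x hx => ((h2 x _ hx).1 ((hR₁ x _).2 rfl)).2,
      fun x hx => ((h3 x _ hx).1 ((hR₂ x _).2 rfl)).2⟩
  have hc : ∀ x, S.base₁.proj (S.str₂.proj x) = S.base x := L.comm
  have hc' : ∀ x, S'.base₁.proj (S'.str₂.proj x) = S'.base x := L'.comm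
  refine ⟨⟨e, e₁, e₂, he, he', he₁, he₁', he₂, he₂', fun x => ?_, fun x => ?_, hbe₂, hbe₁,
    fun x y z => ?_, fun x y z => ?_, fun t x y => ?_, fun t x y => ?_, fun x y z => ?_,
    fun x y z => ?_, fun t x y => ?_, fun t x y => ?_⟩, hR, hR₁, hR₂⟩
  · obtain ⟨U, T, T', hm, h1, h2, -⟩ := h (S.base x)
    have hm' : S'.base (e x) ∈ U := (hbe x).symm ▸ hm
    refine ((T'.t₁.ext_iff hm').2 ⟨(hbe₁ _).trans (hbe x).symm, ?_⟩)
    rw [T'.fst _ hm', h1 x hm, h2 _ hm, T.fst _ hm]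
  · obtain ⟨U, T, T', hm, h1, -, h2⟩ := h (S.base x)
    have hm' : S'.base (e x) ∈ U := (hbe x).symm ▸ hm
    refine ((T'.t₂.ext_iff (by rwa [hc'])).2 ⟨?_, ?_⟩)
    · rw [hbe₂, hc', hc, hbe]
    · rw [T'.snd _ hm', h1 x hm, h2 _ (by rwa [hc]), T.snd _ hm]
  · obtain ⟨U, T, T', hm, h1, -, -⟩ := h (S.base x)
    rw [T.add₁_iff_coord L hm, T'.add₁_iff_coord L' ((hbe x).symm ▸ hm), hbe, hbe, hbe]
    refine and_congr_right fun hy => and_congr_right fun hz => ?_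
    rw [h1 x hm, h1 y (hy ▸ hm), h1 z (hz ▸ hm)]
  · obtain ⟨U, T, T', hm, h1, -, -⟩ := h (S.base x)
    rw [T.add₂_iff_coord L hm, T'.add₂_iff_coord L' ((hbe x).symm ▸ hm), hbe, hbe, hbe]
    refine and_congr_right fun hy => and_congr_right fun hz => ?_
    rw [h1 x hm, h1 y (hy ▸ hm), h1 z (hz ▸ hm)]
  · obtain ⟨U, T, T', hm, h1, -, -⟩ := h (S.base x)
    rw [T.smul₁_iff_coord L t hm, T'.smul₁_iff_coord L' t ((hbe x).symm ▸ hm), hbe, hbe]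
    refine and_congr_right fun hy => ?_
    rw [h1 x hm, h1 y (hy ▸ hm)]
  · obtain ⟨U, T, T', hm, h1, -, -⟩ := h (S.base x)
    rw [T.smul₂_iff_coord L t hm, T'.smul₂_iff_coord L' t ((hbe x).symm ▸ hm), hbe, hbe]
    refine and_congr_right fun hy => ?_
    rw [h1 x hm, h1 y (hy ▸ hm)]
  · obtain ⟨U, T, T', hm, -, -, h1⟩ := h (S.base₁.proj x)
    exact T.t₂.add_congr T'.t₂ L.add_base₁ L'.add_base₁ hbe₂ h1 hm
  · obtain ⟨U, T, T', hm, -, h1, -⟩ := h (S.base₂.proj x)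
    exact T.t₁.add_congr T'.t₁ L.add_base₂ L'.add_base₂ hbe₁ h1 hm
  · obtain ⟨U, T, T', hm, -, -, h1⟩ := h (S.base₁.proj x)
    exact T.t₂.smul_congr T'.t₂ L.smul_base₁ L'.smul_base₁ hbe₂ h1 hm
  · obtain ⟨U, T, T', hm, -, h1, -⟩ := h (S.base₂.proj x)
    exact T.t₁.smul_congr T'.t₁ L.smul_base₂ L'.smul_base₂ hbe₁ h1 hm

end

/-! ## The canonical isomorphism -/

variable {A M : Type*} [DiffeologicalSpace A] [DiffeologicalSpace M]
  {S : SpecialAffineBundle A M} {d r : ℕ} {c : DChart M (Euc d)}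

namespace SpecialAffineBundle

/-- The characterization of the canonical isomorphism on total spaces. -/
def PairingRel (S : SpecialAffineBundle A M) (P : S.phaseDouble.VV) (Θ : Cotangent S.red.Model) :
    Prop :=
  Θ.pt = S.phaseDouble.linearPart₁ P ∧
  ∀ (X₁ X₂ : S.phaseAff₁.Model) (θ₁ θ₁' θ₂ θ₂' : S.Phase)
    (x₁ x₂ : S.Red) (σ₁ σ₁' σ₂ σ₂' : S.Red → A) (f₁ f₂ : S.Red → ℝ) (O₁ O₂ : Set S.Red),
    S.IsAffDifferential x₁ σ₁ θ₁ → S.IsAffDifferential x₁ σ₁' θ₁' →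
    S.IsAffDifferential x₂ σ₂ θ₂ → S.IsAffDifferential x₂ σ₂' θ₂' →
    S.phaseAff₁.IsVec θ₁ θ₁' X₁ → S.phaseAff₁.IsVec θ₂ θ₂' X₂ →
    S.phaseDouble.modelAff.IsVec X₁ X₂ P →
    DOpen O₁ → x₁ ∈ O₁ → S.IsDifference σ₁' σ₁ f₁ O₁ →
    DOpen O₂ → x₂ ∈ O₂ → S.IsDifference σ₂' σ₂ f₂ O₂ →
    ∀ (γ₁ γ₂ : ℝ → S.Red) (γ : ℝ → S.red.Model) (r₁ r₂ : ℝ), DSmooth γ₁ → DSmooth γ₂ →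
      γ₁ 0 = x₁ → γ₂ 0 = x₂ → (∀ t, S.red.IsVec (γ₁ t) (γ₂ t) (γ t)) →
      HasDerivAt (fun t => f₁ (γ₁ t)) r₁ 0 → HasDerivAt (fun t => f₂ (γ₂ t)) r₂ 0 →
      Θ.HasPairing γ (r₂ - r₁)

/-- The characterization of the canonical isomorphism on the side bundles `𝒱(A^# / ⟨1_A⟩)` and
`F*`. -/
def DualRel (S : SpecialAffineBundle A M) (X : S.sharpRed.Model) (Θ : S.modelRed.Dual) : Prop :=
  Θ.1.base = S.sharpRed.model.proj X ∧
  ∀ (φ ψ : S.Sharp) (a b : A) (w : S.red.Model) ha hb ha' hb' hw,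
    S.sharpRed.IsVec (S.toSharpRed φ) (S.toSharpRed ψ) X → S.red.IsVec (S.ζ a) (S.ζ b) w →
    Θ.1.fn w hw = (ψ.1.fn b hb' - φ.1.fn b hb) - (ψ.1.fn a ha' - φ.1.fn a ha)

theorem isFibrewise_modelRed (S : SpecialAffineBundle A M) : S.modelRed.IsFibrewise where
  smooth_proj := AffData.dSmooth_model_proj dSmooth_red_proj
  add_proj := AffData.model_add_proj
  smul_proj := AffData.model_smul_proj

end SpecialAffineBundle

namespace AdaptedTriv

open SpecialAffineBundle

section

variable (α : AdaptedTriv S c.source r)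

/-- The trivialization of `F = 𝒱(A / ⟨v_A⟩)`. -/
def modelRed : VecTriv S.modelRed c.source (Euc r) := α.red.model red_comb_proj

/-- The trivialization of `𝒱(A^# / ⟨1_A⟩)`. -/
def modelSharpRed : VecTriv S.sharpRed.model c.source (Euc r →L[ℝ] ℝ) :=
  α.sharpRed.model sharpRed_comb_proj

end

variable {α : AdaptedTriv S c.source r}

/-- In `ψ - φ` the terms `-z` cancel, leaving a covector plus a constant; the difference of its
values at `b` and `a` removes the constant. The result depends only on the two classes and is
bilinear in their coordinates. -/
theorem modelSharpRed_apply {X : S.sharpRed.Model} {φ ψ : S.Sharp} {a b : A} {w : S.red.Model}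
    {ha : S.proj a = φ.1.base} {hb : S.proj b = φ.1.base} {ha' : S.proj a = ψ.1.base}
    {hb' : S.proj b = ψ.1.base} (hφ : φ.1.base ∈ c.source)
    (hX : S.sharpRed.IsVec (S.toSharpRed φ) (S.toSharpRed ψ) X)
    (hw : S.red.IsVec (S.ζ a) (S.ζ b) w) :
    (ψ.1.fn b hb' - φ.1.fn b hb) - (ψ.1.fn a ha' - φ.1.fn a ha) =
      α.modelSharpRed.φ X (α.modelRed.φ w) := by
  have hψ : ψ.1.base ∈ c.source := by
    rw [← ha', ha]
    exact hφ
  have h1 : α.modelSharpRed.φ X = α.sharpLin ψ - α.sharpLin φ := by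
    refine (α.sharpRed.model_φ_eq sharpRed_comb_proj hX hφ).trans ?_
    exact congrArg₂ _ (α.sharpφ_toSharpRed hψ) (α.sharpφ_toSharpRed hφ)
  have haU : S.proj a ∈ c.source := ha ▸ hφ
  have hbU : S.proj b ∈ c.source := hb ▸ hφ
  have h2 : α.modelRed.φ w = (α.φ b).1 - (α.φ a).1 := by
    refine (α.red.model_φ_eq red_comb_proj hw haU).trans ?_
    exact congrArg₂ _ (α.red_φ_ζ hbU) (α.red_φ_ζ haU)
  rw [h1, h2, α.sharp_apply hφ, α.sharp_apply hφ, α.sharp_apply hψ, α.sharp_apply hψ, map_sub,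
    sub_apply, sub_apply]
  ring

/-- Every vector of `F` and every `X` have representatives, so the formula fixes all values of `Θ`;
in coordinates it says that `Θ` and `X` are the same covector. -/
theorem dualRel_iff {X : S.sharpRed.Model} {Θ : S.modelRed.Dual}
    (hX : S.sharpRed.model.proj X ∈ c.source) :
    S.DualRel X Θ ↔ Θ.1.base = S.sharpRed.model.proj X ∧
      α.modelRed.dual.φ Θ = α.modelSharpRed.φ X := by
  refine and_congr_right fun hb => ?_
  have hΘ : Θ.1.base ∈ c.source := hb ▸ hX
  constructor
  · intro h
    obtain ⟨y, z, hyz⟩ := AffData.exists_isVec X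
    obtain ⟨φ, rfl⟩ := S.exists_toSharpRed y
    obtain ⟨ψ, rfl⟩ := S.exists_toSharpRed z
    have hp := hyz.proj
    have hφ : S.sharpRed.model.proj X = φ.1.base := hp.2
    have hψ : φ.1.base = ψ.1.base := hp.1
    refine α.modelRed.eq_dualφ hΘ fun w hw => ?_
    obtain ⟨y', z', hw'⟩ := AffData.exists_isVec w
    obtain ⟨a, rfl⟩ := S.exists_ζ y'
    obtain ⟨b, rfl⟩ := S.exists_ζ z'
    have hq := hw'.proj
    have ha : S.proj a = φ.1.base := (hq.2.symm.trans (hw.trans hb)).trans hφ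
    have hab : S.proj a = S.proj b := hq.1
    rw [h φ ψ a b w ha (hab ▸ ha) (ha.trans hψ) (hab ▸ ha.trans hψ) hw hyz hw']
    exact modelSharpRed_apply (hφ ▸ hX) hyz hw'
  · intro h φ ψ a b w ha hb ha' hb' hw hφψ hab
    have hφ : S.sharpRed.model.proj X = φ.1.base := hφψ.proj.2
    rw [modelSharpRed_apply (α := α) (hφ ▸ hX) hφψ hab, ← h]
    exact (α.modelRed.dualφ_apply hΘ w hw).symm

/-- The chain rule expresses each term of the pairing formula through momenta. The value thus
depends on the affine differentials and the velocity only. -/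
theorem hasDerivAt_difference {θ θ' : S.Phase} {x : S.Red} {σ σ' : S.Red → A} {f : S.Red → ℝ}
    {O : Set S.Red} (hx : x ∈ α.redChart.source) (hd : S.IsAffDifferential x σ θ)
    (hd' : S.IsAffDifferential x σ' θ') (hO : DOpen O) (hxO : x ∈ O)
    (h : S.IsDifference σ' σ f O) {γ : ℝ → S.Red} (hγ : DSmooth γ) (h0 : γ 0 = x)
    {v : Euc d × Euc r} (hv : HasDerivAt (fun t => α.redChart.κ (γ t)) v 0) :
    HasDerivAt (fun t => f (γ t)) (α.momentum θ' v - α.momentum θ v) 0 := by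
  subst h0
  have h1 := fderiv_difference (α := α) hx hd.isSectionNear hd'.isSectionNear hO hxO h
  rw [(momentum_eq hd hx).fderiv, (momentum_eq hd' hx).fderiv] at h1
  have h2 := α.redChart.hasDerivAt_comp (α.redChart.dOpen.eventually_mem hγ hx) hv
    h1.differentiableAt
  rw [h1.fderiv] at h2
  exact h2

/-- The vertical difference can be computed from either pair because `X₁` and `X₂` have the same
image in `𝒱(A^# / ⟨1_A⟩)`; the horizontal parts enter through the double difference. -/
theorem modelTotal_φ_eq
    (L : S.phaseDouble.LocallyTrivial (Euc r) (Euc r →L[ℝ] ℝ) (Euc d →L[ℝ] ℝ))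
    {P : S.phaseDouble.VV} {X₁ X₂ : S.phaseAff₁.Model} {θ₁ θ₁' θ₂ θ₂' : S.Phase}
    (h₁ : S.red.proj (S.phasePt θ₁) ∈ c.source) (hX₁ : S.phaseAff₁.IsVec θ₁ θ₁' X₁)
    (hX₂ : S.phaseAff₁.IsVec θ₂ θ₂' X₂) (hP : S.phaseDouble.modelAff.IsVec X₁ X₂ P) :
    S.red.proj (S.phasePt θ₂) = S.red.proj (S.phasePt θ₁) ∧
    ((α.phaseDouble.modelTotal L).φ P).2.1 =
      vertCovec (α.momentum θ₁') - vertCovec (α.momentum θ₁) ∧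
    ((α.phaseDouble.modelTotal L).φ P).2.1 =
      vertCovec (α.momentum θ₂') - vertCovec (α.momentum θ₂) ∧
    ((α.phaseDouble.modelTotal L).φ P).2.2 =
      (horCovec (α.momentum θ₂') - horCovec (α.momentum θ₂)) -
      (horCovec (α.momentum θ₁') - horCovec (α.momentum θ₁)) := by
  obtain ⟨-, b2, -, -, b5, b6⟩ := (α.phaseDouble.isVec₁_iff L h₁).1 hX₁
  have hX₁U : S.phaseDouble.baseModel₁ X₁ ∈ c.source := b2 ▸ h₁
  obtain ⟨e1, e2, e3, e4, e5, e6⟩ := (α.phaseDouble.isVec₂_iff L hX₁U).1 hP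
  have hθ₂ : S.phaseDouble.baseModel₁ X₂ = S.red.proj (S.phasePt θ₂) :=
    congrArg S.red.proj hX₂.proj.2
  have h₂ : S.red.proj (S.phasePt θ₂) = S.red.proj (S.phasePt θ₁) :=
    hθ₂.symm.trans (e1.trans b2)
  obtain ⟨-, -, -, -, c5, c6⟩ := (α.phaseDouble.isVec₁_iff L
    (show S.red.proj (S.phasePt θ₂) ∈ c.source by rw [h₂]; exact h₁)).1 hX₂
  refine ⟨h₂, ?_, ?_, ?_⟩
  · rw [e4, b5]
    rfl
  · rw [e4, ← e3, c5]
    rfl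
  · rw [e6, c6, b6]
    rfl

/-- The pairing with the velocity of a curve of vectors in coordinates. -/
theorem modelTotal_pairing
    (L : S.phaseDouble.LocallyTrivial (Euc r) (Euc r →L[ℝ] ℝ) (Euc d →L[ℝ] ℝ))
    {P : S.phaseDouble.VV} {X₁ X₂ : S.phaseAff₁.Model} {θ₁ θ₁' θ₂ θ₂' : S.Phase}
    (h₁ : S.red.proj (S.phasePt θ₁) ∈ c.source) (hX₁ : S.phaseAff₁.IsVec θ₁ θ₁' X₁)
    (hX₂ : S.phaseAff₁.IsVec θ₂ θ₂' X₂) (hP : S.phaseDouble.modelAff.IsVec X₁ X₂ P)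
    {v₁ v₂ : Euc d × Euc r} (hv : v₂.1 = v₁.1) :
    (α.momentum θ₂' v₂ - α.momentum θ₂ v₂) - (α.momentum θ₁' v₁ - α.momentum θ₁ v₁) =
      ((α.phaseDouble.modelTotal L).φ P).2.2 v₁.1 +
        ((α.phaseDouble.modelTotal L).φ P).2.1 (v₂.2 - v₁.2) := by
  obtain ⟨-, e1, e2, e3⟩ := modelTotal_φ_eq (α := α) L h₁ hX₁ hX₂ hP
  -- The same covector is expanded with the first pair on `v₁.2` and with the second pair on `v₂.2`.
  -- The two horizontal contributions combine because `v₁` and `v₂` have the same base component.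
  have k1 : ((α.phaseDouble.modelTotal L).φ P).2.1 v₁.2 =
      vertCovec (α.momentum θ₁') v₁.2 - vertCovec (α.momentum θ₁) v₁.2 := by
    rw [e1]
    rfl
  have k2 : ((α.phaseDouble.modelTotal L).φ P).2.1 v₂.2 =
      vertCovec (α.momentum θ₂') v₂.2 - vertCovec (α.momentum θ₂) v₂.2 := by
    rw [e2]
    rfl
  rw [map_sub, k1, k2, e3, covec_apply_eq _ v₁, covec_apply_eq _ v₂, covec_apply_eq _ v₁,
    covec_apply_eq _ v₂, hv]
  simp only [sub_apply]
  ring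

theorem chart_modelRed_κ {x y : S.Red} {w : S.red.Model} (h : S.red.IsVec x y w)
    (hx : S.red.proj x ∈ c.source) :
    (α.modelRed.chart S.isFibrewise_modelRed).κ w =
      (c.κ (S.red.proj x), α.red.φ y - α.red.φ x) :=
  Prod.ext (congrArg c.κ h.proj.2) (α.red.model_φ_eq red_comb_proj h hx)

/-- The pairing formula prescribes the value of the covector `Θ` on velocities of curves of vectors,
and by `modelTotal_pairing` this value is that of the covector with the coordinates of `P`. Enough
pairs of curves exist to reach every velocity, so the formula is equivalent to equality of
coordinates. -/
theorem pairingRel_iff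
    (L : S.phaseDouble.LocallyTrivial (Euc r) (Euc r →L[ℝ] ℝ) (Euc d →L[ℝ] ℝ))
    {P : S.phaseDouble.VV} {Θ : Cotangent S.red.Model}
    (hP : S.phaseDouble.modelDouble.base P ∈ c.source) :
    S.PairingRel P Θ ↔
      S.modelRed.cotangentDouble.base Θ = S.phaseDouble.modelDouble.base P ∧
      (α.modelRed.cotangentDouble S.isFibrewise_modelRed).t.φ Θ =
        (α.phaseDouble.modelDouble L).t.φ P := by
  have hfst : α.modelRed.φ (S.phaseDouble.linearPart₁ P) =
      ((α.phaseDouble.modelTotal L).φ P).1 := α.phaseDouble.modelBase₂_φ L P hP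
  have hpt : Θ.pt = S.phaseDouble.linearPart₁ P ↔
      S.modelRed.cotangentDouble.base Θ = S.phaseDouble.modelDouble.base P ∧
      α.modelRed.φ Θ.pt = ((α.phaseDouble.modelTotal L).φ P).1 := by
    rw [← hfst]
    exact eq_comm.trans (α.modelRed.ext_iff hP)
  set F := α.modelRed.chart S.isFibrewise_modelRed with hF
  -- The foot points account for the base point and the first coordinate; the two components of the
  -- covector remain.
  suffices h : Θ.pt = S.phaseDouble.linearPart₁ P → (S.PairingRel P Θ ↔
      vertCovec (F.covec Θ) = ((α.phaseDouble.modelTotal L).φ P).2.1 ∧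
      horCovec (F.covec Θ) = ((α.phaseDouble.modelTotal L).φ P).2.2) by
    constructor
    · intro h'
      obtain ⟨h1, h2⟩ := hpt.1 h'.1
      obtain ⟨h3, h4⟩ := (h h'.1).1 h'
      exact ⟨h1, Prod.ext h2 (Prod.ext h3 h4)⟩
    · rintro ⟨h1, h2⟩
      have h3 := hpt.2 ⟨h1, congrArg Prod.fst h2⟩
      exact (h h3).2 ⟨congrArg (fun e => e.2.1) h2, congrArg (fun e => e.2.2) h2⟩
  intro hΘ
  have hΘU : S.modelRed.proj Θ.pt ∈ c.source := by
    rw [hΘ]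
    exact hP
  have hlin : ∀ {X₁ X₂ : S.phaseAff₁.Model} {θ₁ θ₁' θ₂ θ₂' : S.Phase},
      S.phaseAff₁.IsVec θ₁ θ₁' X₁ → S.phaseAff₁.IsVec θ₂ θ₂' X₂ →
      S.phaseDouble.modelAff.IsVec X₁ X₂ P → S.red.IsVec (S.phasePt θ₁) (S.phasePt θ₂) Θ.pt := by
    intro X₁ X₂ θ₁ θ₁' θ₂ θ₂' hX₁ hX₂ hX
    have h1 := L.isVec_linearPart₁ hX
    rw [hΘ]
    have e1 : S.phaseDouble.str₁.model.proj X₁ = S.phasePt θ₁ := hX₁.proj.2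
    have e2 : S.phaseDouble.str₁.model.proj X₂ = S.phasePt θ₂ := hX₂.proj.2
    rw [e1, e2] at h1
    exact h1
  constructor
  · rintro ⟨-, h⟩
    -- Some representatives are needed so that the universally quantified formula can be applied.
    obtain ⟨X₁, X₂, hX⟩ := AffData.exists_isVec P
    obtain ⟨θ₁, θ₁', hX₁⟩ := AffData.exists_isVec (S := S.phaseAff₁) X₁
    obtain ⟨θ₂, θ₂', hX₂⟩ := AffData.exists_isVec (S := S.phaseAff₁) X₂
    have hv := hlin hX₁ hX₂ hX
    have hp₁ : S.modelRed.proj Θ.pt = S.red.proj (S.phasePt θ₁) := hv.proj.2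
    have u₁ : S.phasePt θ₁ ∈ α.redChart.source := mem_redChart (hp₁ ▸ hΘU)
    have hp₂ : S.red.proj (S.phasePt θ₁) = S.red.proj (S.phasePt θ₂) := hv.proj.1
    have u₂ : S.phasePt θ₂ ∈ α.redChart.source := mem_redChart (hp₂ ▸ u₁)
    have q₁ : S.phasePt θ₁' = S.phasePt θ₁ := hX₁.proj.1.symm
    have q₂ : S.phasePt θ₂' = S.phasePt θ₂ := hX₂.proj.1.symm
    have key : ∀ v : Euc d × Euc r, F.covec Θ v =
        ((α.phaseDouble.modelTotal L).φ P).2.2 v.1 +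
          ((α.phaseDouble.modelTotal L).φ P).2.1 v.2 := by
      intro v
      have hsec : ∀ (L L' : Euc d × Euc r →L[ℝ] ℝ), S.IsDifference
          (α.secOf (α.redChart.linFun L')) (α.secOf (α.redChart.linFun L))
          (fun y => α.redChart.linFun L' y - α.redChart.linFun L y) α.redChart.source := by
        intro L L' y hy
        refine (shift_height (α := α) hy (secOf_ψ hy).1 (secOf_ψ hy).1).2 ?_
        rw [height_secOf hy, height_secOf hy]
      have i₁ := isAffDifferential_linFun (α := α) (θ := θ₁) rfl u₁ rfl
      have i₁' := isAffDifferential_linFun (α := α) q₁ u₁ rfl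
      have i₂ := isAffDifferential_linFun (α := α) (θ := θ₂) rfl u₂ rfl
      have i₂' := isAffDifferential_linFun (α := α) q₂ u₂ rfl
      -- The first curve moves only in the base direction and the second in the direction `v`, over
      -- the same base curve; the connecting vectors then run along the line with velocity `v` in
      -- `F`.
      have s₁ := α.redChart.dSmooth_line (S.phasePt θ₁) (v.1, 0)
      have s₂ := α.redChart.dSmooth_line (S.phasePt θ₂) v
      have z₁ := α.redChart.line_zero u₁ (v.1, 0)
      have z₂ := α.redChart.line_zero u₂ v
      have l₁ : ∀ t, S.red.proj (α.redChart.line (S.phasePt θ₁) (v.1, 0) t) =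
          c.ψ (c.κ (S.red.proj (S.phasePt θ₁)) + t • v.1) := fun t => α.redChart_ψ_proj _
      have l₂ : ∀ t, S.red.proj (α.redChart.line (S.phasePt θ₂) v t) =
          c.ψ (c.κ (S.red.proj (S.phasePt θ₂)) + t • v.1) := fun t => α.redChart_ψ_proj _
      have hvec : ∀ t, S.red.IsVec (α.redChart.line (S.phasePt θ₁) (v.1, 0) t)
          (α.redChart.line (S.phasePt θ₂) v t) (F.line Θ.pt v t) := by
        intro t
        have l₃ := (VecTriv.chart_line (T := α.modelRed) (hE := S.isFibrewise_modelRed) Θ.pt v t)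
        refine (α.red.isVec_iff red_comb_proj (by rw [l₁]; exact c.mem_source _) ?_ ?_).2 ?_
        · rw [l₁, l₂, hp₂]
        · refine l₃.1.trans ?_
          rw [hp₁, l₁]
        · refine l₃.2.trans ?_
          have e₁ : α.red.φ (α.redChart.line (S.phasePt θ₁) (v.1, 0) t) =
            α.red.φ (S.phasePt θ₁) + t • 0 := congrArg Prod.snd (α.redChart.κ_line _ _ t)
          have e₂ : α.red.φ (α.redChart.line (S.phasePt θ₂) v t) =
            α.red.φ (S.phasePt θ₂) + t • v.2 := congrArg Prod.snd (α.redChart.κ_line _ _ t)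
          have e₃ : α.modelRed.φ Θ.pt = α.red.φ (S.phasePt θ₂) - α.red.φ (S.phasePt θ₁) :=
            α.red.model_φ_eq red_comb_proj hv u₁
          rw [e₁, e₂, e₃, smul_zero]
          abel
      have hpair := h X₁ X₂ θ₁ θ₁' θ₂ θ₂' _ _ _ _ _ _ _ _ _ _ i₁ i₁' i₂ i₂' hX₁ hX₂ hX
        α.redChart.dOpen u₁ (hsec _ _) α.redChart.dOpen u₂ (hsec _ _) _ _ _ _ _ s₁ s₂ z₁ z₂ hvec
        (hasDerivAt_difference u₁ i₁ i₁' α.redChart.dOpen u₁ (hsec _ _) s₁ z₁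
          (α.redChart.hasDerivAt_line _ _))
        (hasDerivAt_difference u₂ i₂ i₂' α.redChart.dOpen u₂ (hsec _ _) s₂ z₂
          (α.redChart.hasDerivAt_line _ _))
      rw [modelTotal_pairing L u₁ hX₁ hX₂ hX (by rfl)] at hpair
      have := (VecTriv.hasPairing_line (T := α.modelRed) (hE := S.isFibrewise_modelRed) hΘU v).unique
        hpair
      rw [sub_zero] at this
      exact this
    constructor
    · refine ContinuousLinearMap.ext fun v => ?_
      rw [vertCovec_apply, key, map_zero, zero_add]
    · refine ContinuousLinearMap.ext fun v => ?_
      rw [horCovec_apply, key, map_zero, add_zero]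
  · rintro ⟨hq, hp⟩
    refine ⟨hΘ, ?_⟩
    intro X₁ X₂ θ₁ θ₁' θ₂ θ₂' x₁ x₂ σ₁ σ₁' σ₂ σ₂' f₁ f₂ O₁ O₂ i₁ i₁' i₂ i₂' hX₁ hX₂ hX hO₁ hx₁ hf₁
      hO₂ hx₂ hf₂ γ₁ γ₂ γ r₁ r₂ s₁ s₂ z₁ z₂ hγ hr₁ hr₂
    have hv := hlin hX₁ hX₂ hX
    obtain rfl := i₁.pt
    obtain rfl := i₂.pt
    have hp₁ : S.modelRed.proj Θ.pt = S.red.proj (S.phasePt θ₁) := hv.proj.2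
    have u₁ : S.phasePt θ₁ ∈ α.redChart.source := mem_redChart (hp₁ ▸ hΘU)
    have hp₂ : S.red.proj (S.phasePt θ₁) = S.red.proj (S.phasePt θ₂) := hv.proj.1
    have u₂ : S.phasePt θ₂ ∈ α.redChart.source := mem_redChart (hp₂ ▸ u₁)
    have w₁ : γ₁ 0 ∈ α.redChart.source := z₁.symm ▸ u₁
    have w₂ : γ₂ 0 ∈ α.redChart.source := z₂.symm ▸ u₂
    have d₁ := α.redChart.hasDerivAt_of_dSmooth s₁ w₁
    have d₂ := α.redChart.hasDerivAt_of_dSmooth s₂ w₂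
    have ev := α.redChart.dOpen.eventually_mem s₁ w₁
    -- The curves have the same projection to `M`, which is the hypothesis needed for
    -- `modelTotal_pairing`.
    have hbase : (deriv (fun t => α.redChart.κ (γ₂ t)) 0).1 =
        (deriv (fun t => α.redChart.κ (γ₁ t)) 0).1 := by
      refine (VecTriv.hasDerivAt_fst d₂).unique
        ((VecTriv.hasDerivAt_fst d₁).congr_of_eventuallyEq (Filter.Eventually.of_forall fun t => ?_))
      exact congrArg c.κ (hγ t).proj.1.symm
    have d : HasDerivAt (fun t => F.κ (γ t)) ((deriv (fun t => α.redChart.κ (γ₁ t)) 0).1,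
        (deriv (fun t => α.redChart.κ (γ₂ t)) 0).2 -
        (deriv (fun t => α.redChart.κ (γ₁ t)) 0).2) 0 := by
      refine ((VecTriv.hasDerivAt_fst d₁).prodMk
        ((VecTriv.hasDerivAt_snd d₂).sub (VecTriv.hasDerivAt_snd d₁))).congr_of_eventuallyEq ?_
      filter_upwards [ev] with t ht
      exact chart_modelRed_κ (hγ t) ht
    have hz : Θ.pt = γ 0 := by
      have h0 := hγ 0
      rw [z₁, z₂] at h0
      exact hv.2.trans h0.2.symm
    have evF : ∀ᶠ t in 𝓝 (0 : ℝ), γ t ∈ F.source := by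
      filter_upwards [ev] with t ht
      change S.red.model.proj (γ t) ∈ c.source
      rw [(hγ t).proj.2]
      exact ht
    rw [hr₁.unique (hasDerivAt_difference u₁ i₁ i₁' hO₁ hx₁ hf₁ s₁ z₁ d₁),
      hr₂.unique (hasDerivAt_difference u₂ i₂ i₂' hO₂ hx₂ hf₂ s₂ z₂ d₂),
      modelTotal_pairing L u₁ hX₁ hX₂ hX hbase]
    convert! DChart.hasPairing_covec hz evF d using 1
    rw [covec_apply_eq _ (Prod.mk _ _), hq, hp]

end AdaptedTriv

/-! ### Existence and uniqueness of the canonical isomorphism -/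

namespace SpecialAffineBundle

/-- The three characterizing relations are stated without charts and become equality of coordinates
in every adapted chart, so they glue to an isomorphism. They also determine it, since any canonical
isomorphism satisfies them. -/
theorem existsUnique_isCanonical
    (L : S.phaseDouble.LocallyTrivial (Euc r) (Euc r →L[ℝ] ℝ) (Euc d →L[ℝ] ℝ))
    (L' : S.modelRed.cotangentDouble.LocallyTrivial (Euc r) (Euc r →L[ℝ] ℝ) (Euc d →L[ℝ] ℝ))
    (h : ∀ m, ∃ c : DChart M (Euc d), m ∈ c.source ∧ Nonempty (AdaptedTriv S c.source r)) :
    ∃! Φ : S.phaseDouble.modelDouble.Iso S.modelRed.cotangentDouble, S.IsCanonical Φ := by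
  obtain ⟨Φ, hR, hR₁, hR₂⟩ := L.modelDouble.exists_iso L' (R := S.PairingRel)
    (R₁ := fun w w' : S.red.Model => w' = w) (R₂ := S.DualRel) fun m => by
    obtain ⟨c, hm, ⟨α⟩⟩ := h m
    refine ⟨c.source, α.phaseDouble.modelDouble L,
      α.modelRed.cotangentDouble S.isFibrewise_modelRed, hm,
      fun P Θ hP => AdaptedTriv.pairingRel_iff L hP, fun w w' hw => ?_,
      fun X Θ hX => AdaptedTriv.dualRel_iff hX⟩
    exact eq_comm.trans (α.modelRed.ext_iff hw)
  refine ⟨Φ, ⟨fun w => ((hR₁ w _).2 rfl), ?_, ?_⟩, ?_⟩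
  · intro φ ψ X a b w ha hb ha' hb' hw
    exact ((hR₂ X _).2 rfl).2 φ ψ a b w ha hb ha' hb' hw
  · intro P
    exact ((hR P _).2 rfl).2
  · intro Ψ hΨ
    -- The condition on foot points comes from compatibility with the first projection together with
    -- the identity on the side bundle `F`; the rest is the pairing formula.
    have e : ∀ P, Φ.toEquiv P = Ψ.toEquiv P := fun P => (hR P _).1
      ⟨(Ψ.proj₁ P).trans (hΨ.side₁ _), hΨ.pairing P⟩
    have e₁ : ∀ w, Φ.side₁ w = Ψ.side₁ w := fun w => (hR₁ w _).1 (hΨ.side₁ w)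
    have e₂ : ∀ X, Φ.side₂ X = Ψ.side₂ X := fun X => (hR₂ X _).1
      ⟨Ψ.base_proj₁ X, fun φ ψ a b w ha hb ha' hb' hw =>
        hΨ.side₂ φ ψ X a b w ha hb ha' hb' hw⟩
    exact DoubleVecData.Iso.ext (Equiv.ext fun P => (e P).symm) (Equiv.ext fun w => (e₁ w).symm)
      (Equiv.ext fun X => (e₂ X).symm)

end SpecialAffineBundle

end DAff

end

theorem mainTheorem10 {d : ℕ} {M : Type*} [TopologicalSpace M] [T2Space M]
    [SecondCountableTopology M] [ChartedSpace (DAff.Euc d) M] [IsManifold (𝓡 d) ∞ M]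
    [DiffeologicalSpace M] [DAff.IsContMDiffCompatible d M]
    {A : Type*} [DiffeologicalSpace A] (S : DAff.SpecialAffineBundle A M) :
    S.phaseDouble.IsDoubleAffineBundle ∧
    S.phaseDouble.modelDouble.IsDoubleVectorBundle ∧
    S.modelRed.cotangentDouble.IsDoubleVectorBundle ∧
    ∃! Φ : S.phaseDouble.modelDouble.Iso S.modelRed.cotangentDouble, S.IsCanonical Φ := by
  obtain ⟨r, h⟩ := S.exists_adapted_chart (d := d)
  have L := DAff.SpecialAffineBundle.locallyTrivial_phaseDouble h
  have L' : S.modelRed.cotangentDouble.LocallyTrivial (DAff.Euc r) (DAff.Euc r →L[ℝ] ℝ)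
      (DAff.Euc d →L[ℝ] ℝ) :=
    DAff.VecData.locallyTrivial_cotangentDouble S.isFibrewise_modelRed fun m => by
      obtain ⟨c, hm, ⟨α⟩⟩ := h m
      exact ⟨c, hm, ⟨α.modelRed⟩⟩
  exact ⟨L.isDoubleAffineBundle, L.modelDouble.isDoubleVectorBundle, L'.isDoubleVectorBundle,
    DAff.SpecialAffineBundle.existsUnique_isCanonical L L' h⟩
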